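/- All vector spaces are over $\mathbb{C}$. Let $(\mathfrak g,\cdot)$ be a (left) pre-Lie algebra, i.e. $(x\cdot y)\cdot z-x\cdot(y\cdot z)$ is symmetric in $x,y$, and let $(V;\mathcal L,\mathcal R)$ be a representation of it: $\mathcal L,\mathcal R:\mathfrak g\to \mathfrak{gl}(V)$ are linear with $$\mathcal L_x\mathcal L_y-\mathcal L_{x\cdot y}=\mathcal L_y\mathcal L_x-\mathcal L_{y\cdot x},\qquad \mathcal L_x\mathcal R_y-\mathcal R_y\mathcal L_x=\mathcal R_{x\cdot y}-\mathcal R_y\mathcal R_x .$$ Let $H:\mathfrak g\otimes\mathfrak g\to V$ be a $2$-cocycle: for all $x,y,z\in\mathfrak g$, $$\mathcal L_xH(y,z)-\mathcal L_yH(x,z)+\mathcal R_zH(y,x)-\mathcal R_zH(x,y)-H(y,x\cdot z)+H(x,y\cdot z)-H(x\cdot y-y\cdot x,z)=0 .$$ A linear map $K:V\to\mathfrak g$ is a *relative cocycle weighted Reynolds operator* (with weight $H$) if $Ku\cdot Kv=K(\mathcal L_{Ku}v+\mathcal R_{Kv}u+H(Ku,Kv))$ for all $u,v\in V$. *Conventions.*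 $S_{(i_1,\dots,i_k)}$ denotes the set of permutations $\sigma$ of $\{1,\dots,i_1+\dots+i_k\}$ that are increasing on each of the consecutive blocks of sizes $i_1,\dots,i_k$; it is empty if some $i_j<0$. $\chi(\sigma)$ is the Koszul sign for $x\wedge y=-(-1)^{|x||y|}y\wedge x$ (the signature times the usual Koszul sign). An *$L_\infty$-algebra* is a $\mathbb Z$-graded vector space $E$ with graded skew-symmetric multilinear maps $l_k:E^k\to E$ of degree $2-k$, $k\ge1$, such that for all $n\ge1$ and all homogeneous $x_1,\dots,x_n$ $$\sum_{i+j=n+1}(-1)^i\sum_{\sigma\in S_{(i,n-i)}}\chi(\sigma)\,l_j(l_i(x_{\sigma(1)},\dots,x_{\sigma(i)}),x_{\sigma(i+1)},\dots,x_{\sigma(n)})=0 .$$ A *Maurer–Cartan element* is an $\alpha$ of degree $1$ such that $l_k(\alpha,\dots,\alpha)$ vanishes for all sufficiently large $k$ and $\sum_{k\ge1}\frac1{k!}l_k(\alpha,\dots,\alpha)=0$. For a vector space $W$ and $P\in\mathrm{Hom}(\wedge^{p}W\otimes W,W)$, $Q\in\mathrm{Hom}(\wedge^{q}W\otimes W,W)$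 the *Matsushima–Nijenhuis bracket* is $[P,Q]^{MN}=P\diamond Q-(-1)^{pq}Q\diamond P$, where $$\begin{aligned}(P\diamond Q)(x_1,\dots,x_{p+q+1})={}&\sum_{\sigma\in S_{(q,1,p-1)}}\mathrm{sgn}(\sigma)\,P(Q(x_{\sigma(1)},\dots,x_{\sigma(q+1)}),x_{\sigma(q+2)},\dots,x_{\sigma(p+q)},x_{p+q+1})\\&+(-1)^{pq}\sum_{\sigma\in S_{(p,q)}}\mathrm{sgn}(\sigma)\,P(x_{\sigma(1)},\dots,x_{\sigma(p)},Q(x_{\sigma(p+1)},\dots,x_{\sigma(p+q)},x_{p+q+1})).\end{aligned}$$ Maps $\wedge^{n-1}V\otimes V\to\mathfrak g$ are regarded as maps $\wedge^{n-1}(\mathfrak g\oplus V)\otimes(\mathfrak g\oplus V)\to\mathfrak g\oplus V$ by the projection to $V$ and the inclusion of $\mathfrak g$. Let $\mu+\mathcal L+\mathcal R$ be the product $((x,u),(y,v))\mapsto(x\cdot y,\mathcal L_xv+\mathcal R_yu)$ on $\mathfrak g\oplus V$. **Theorem.** The graded vector space $\bigoplus_{n\ge0}\mathrm{Hom}(\wedge^{n-1}V\otimes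 V,\mathfrak g)$ (with $\mathrm{Hom}(\wedge^{n-1}V\otimes V,\mathfrak g)$ in degree $n$, the summand for $n=0$ being zero) is an $L_\infty$-algebra with $l_1=0$, $l_k=0$ for $k\ge4$, and, for $P,Q,R$ of degrees $p,q,r\geq 1$, with $$l_2(P,Q)=\llbracket P,Q\rrbracket:=(-1)^{p-1}[[\mu+\mathcal L+\mathcal R,P]^{MN},Q]^{MN}$$ and $$\begin{aligned}l_3(P,Q,R)=\llbracket P,Q,R\rrbracket:={}&(-1)^{rq+p-1}A(P;Q,R)+(-1)^{p}A(P;R,Q)\\ &+(-1)^{(r+1)(p+q+1)+pq+p+1}B(P;Q,R)+(-1)^{pq+pr+q+r+1}B(P;R,Q)\\ &+(-1)^{pq+q+1}A(Q;R,P)+(-1)^{rp+pq+q}A(Q;P,R)\\ &+(-1)^{qr+p+r}B(Q;R,P)+(-1)^{(r-1)(p+q-1)+q}B(Q;P,R)\\ &+(-1)^{(r-1)(p+q-1)+p+q-1}A(R;Q,P)+(-1)^{p(q-1)+(r-1)(p+q-1)+q}A(R;P,Q)\\ &+(-1)^{p+q+1}B(R;Q,P)+(-1)^{pq+p+q}B(R;P,Q),\end{aligned}$$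 where, for $P,Q,R$ of any degrees $p,q,r\ge1$ and $u_1,\dots,u_{p+q+r-1}\in V$, $$\begin{aligned}A(P;Q,R)(u_1,\dots,u_{p+q+r-1})=\sum_{\sigma\in S_{(q-1,1,r-1,1,p-2)}}\mathrm{sgn}(\sigma)\,P\big(&H(Q(u_{\sigma(1)},\dots,u_{\sigma(q)}),R(u_{\sigma(q+1)},\dots,u_{\sigma(q+r)})),\\&u_{\sigma(q+r+1)},\dots,u_{\sigma(p+q+r-2)},u_{p+q+r-1}\big),\\ B(P;Q,R)(u_1,\dots,u_{p+q+r-1})=\sum_{\sigma\in S_{(p-1,q-1,1,r-1)}}\mathrm{sgn}(\sigma)\,P\big(&u_{\sigma(1)},\dots,u_{\sigma(p-1)},H(Q(u_{\sigma(p)},\dots,u_{\sigma(p+q-1)}),\\&R(u_{\sigma(p+q)},\dots,u_{\sigma(p+q+r-2)},u_{p+q+r-1}))\big).\end{aligned}$$ Moreover, a linear map $K:V\to\mathfrak g$ is a relative cocycle weighted Reynolds operator if and only if $K$, as an element of degree $1$, is a Maurer–Cartan element of this $L_\infty$-algebra. -/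

import Mathlib

open scoped DirectSum

/-! ### Unshuffles and Koszul signs -/

/-- `σ` is an unshuffle with consecutive blocks of sizes `b = [i₁, …, i_k]`, where
`i₁ + ⋯ + i_k = n`: it is increasing on each block.  Two positions `s < t` lie in the same block iff
no partial sum `c = i₁ + ⋯ + i_l` satisfies `s < c ≤ t`. -/
def IsUnshuffle (b : List ℕ) {n : ℕ} (σ : Equiv.Perm (Fin n)) : Prop :=
  ∀ s t : Fin n, s < t →
    (∀ c ∈ b.scanl (· + ·) 0, ¬ ((s : ℕ) < c ∧ c ≤ (t : ℕ))) → σ s < σ t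

instance (b : List ℕ) {n : ℕ} (σ : Equiv.Perm (Fin n)) : Decidable (IsUnshuffle b σ) := by
  unfold IsUnshuffle
  infer_instance

/-- The set `S(i₁, …, i_k)` of the unshuffles of `n = i₁ + ⋯ + i_k` elements. -/
def unshuffles (b : List ℕ) (n : ℕ) : Finset (Equiv.Perm (Fin n)) :=
  Finset.univ.filter (IsUnshuffle b)

/-- The block `x_k, …, x_{k + m - 1}` of a finite sequence `x_0, …, x_{n - 1}`. -/
def block {W : Type*} {n : ℕ} (x : Fin n → W) (k m : ℕ) (h : k + m ≤ n) : Fin m → W :=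
  fun i => x ⟨k + i, by omega⟩

/-- The graded-skew Koszul sign `χ(σ)` of a permutation `σ` acting on homogeneous elements of
degrees `d`: the signature times the usual Koszul sign, so that
`x_{σ(1)} ∧ ⋯ ∧ x_{σ(n)} = χ(σ) x_1 ∧ ⋯ ∧ x_n` where `x ∧ y = -(-1)^{|x||y|} y ∧ x`. -/
def koszulSign {n : ℕ} (d : Fin n → ℤ) (σ : Equiv.Perm (Fin n)) : ℤˣ :=
  Equiv.Perm.sign σ *
    ∏ s : Fin n, ∏ t : Fin n,
      if s < t ∧ σ t < σ s then Int.negOnePow (d (σ s) * d (σ t)) else 1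

/-! ### L-infinity algebras and Maurer-Cartan elements -/

/-- An L-infinity algebra structure on a complex vector space `E` graded by the subspaces `𝒜 n`.
The operations `l k` are relevant for `k ≥ 1` only. -/
structure LInftyStructure {E : Type*} [AddCommGroup E] [Module ℂ E]
    (𝒜 : ℤ → Submodule ℂ E) where
  isInternal : DirectSum.IsInternal 𝒜
  l : (k : ℕ) → MultilinearMap ℂ (fun _ : Fin k => E) E
  /-- `l k` has degree `2 - k`. -/
  degree : ∀ k : ℕ, 1 ≤ k → ∀ (d : Fin k → ℤ) (x : Fin k → E), (∀ i, x i ∈ 𝒜 (d i)) →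
    l k x ∈ 𝒜 ((∑ i, d i) + (2 - (k : ℤ)))
  /-- `l k` is graded skew-symmetric. -/
  skew : ∀ k : ℕ, 1 ≤ k → ∀ (d : Fin k → ℤ) (x : Fin k → E), (∀ i, x i ∈ 𝒜 (d i)) →
    ∀ σ : Equiv.Perm (Fin k), l k (x ∘ σ) = koszulSign d σ • l k x
  /-- The higher Jacobi identities
  `∑_{i + j = n + 1} (-1)^i ∑_σ χ(σ) l_j (l_i (x_{σ(1)}, …, x_{σ(i)}), x_{σ(i+1)}, …, x_{σ(n)}) = 0`,
  the inner sum being over the `(i, n - i)`-unshuffles. -/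
  jacobi : ∀ n : ℕ, 1 ≤ n → ∀ (d : Fin n → ℤ) (x : Fin n → E), (∀ i, x i ∈ 𝒜 (d i)) →
    ∑ i : Fin (n + 1), (if (i : ℕ) = 0 then 0 else
      ((-1 : ℤ) ^ (i : ℕ)) • ∑ σ ∈ unshuffles [(i : ℕ), n - i] n, koszulSign d σ •
        l (n - i + 1) (Fin.cons (l i (block (x ∘ σ) 0 i (by omega)))
          (block (x ∘ σ) i (n - i) (by omega)))) = 0

/-- `α` is a Maurer-Cartan element: it has degree `1`, only finitely many of the terms
`l_k(α, …, α)` are nonzero, and `∑_{k ≥ 1} (1 / k!) l_k(α, …, α) = 0`. -/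
def LInftyStructure.IsMaurerCartan {E : Type*} [AddCommGroup E] [Module ℂ E]
    {𝒜 : ℤ → Submodule ℂ E} (A : LInftyStructure 𝒜) (α : E) : Prop :=
  α ∈ 𝒜 1 ∧ ∃ N : ℕ, (∀ k : ℕ, N < k → A.l k (fun _ => α) = 0) ∧
    ∑ k ∈ Finset.Icc 1 N, ((Nat.factorial k : ℂ)⁻¹) • A.l k (fun _ => α) = 0

/-! ### The Matsushima-Nijenhuis bracket -/

/-- An operation of arity `p + 1` on `W`, that is of degree `p`, with its last argument kept
apart.  The elements of `Hom (∧^p W ⊗ W, W)` are such operations. -/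
abbrev Operation (W : Type*) (p : ℕ) : Type _ := (Fin p → W) → W → W

/-- The first sum in `P ⋄ Q`, where `Q` is inserted in one of the skew arguments of `P`:
`∑_{σ ∈ S(q, 1, p-1)} sgn(σ) P(Q(x_{σ(1)}, …, x_{σ(q+1)}), x_{σ(q+2)}, …, x_{σ(p+q)}, y)`,
which is empty for `p = 0`. -/
def diamondSkew {W : Type*} [AddCommGroup W] : {p q : ℕ} → Operation W p → Operation W q →
    Operation W (p + q)
  | 0, _, _, _ => fun _ _ => 0
  | p + 1, q, P, Q => fun x y => ∑ σ ∈ unshuffles [q, 1, p] (p + 1 + q), Equiv.Perm.sign σ •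
      P (Fin.cons (Q (block (x ∘ σ) 0 q (by omega)) (x (σ ⟨q, by omega⟩)))
        (block (x ∘ σ) (q + 1) p (by omega))) y

/-- The second sum in `P ⋄ Q`, without the global sign, where `Q` is inserted in the last argument:
`∑_{σ ∈ S(p, q)} sgn(σ) P(x_{σ(1)}, …, x_{σ(p)}, Q(x_{σ(p+1)}, …, x_{σ(p+q)}, y))`. -/
def diamondLast {W : Type*} [AddCommGroup W] {p q : ℕ} (P : Operation W p) (Q : Operation W q) :
    Operation W (p + q) :=
  fun x y => ∑ σ ∈ unshuffles [p, q] (p + q), Equiv.Perm.sign σ •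
    P (block (x ∘ σ) 0 p (by omega)) (Q (block (x ∘ σ) p q (by omega)) y)

/-- The product `P ⋄ Q`. -/
def diamond {W : Type*} [AddCommGroup W] {p q : ℕ} (P : Operation W p) (Q : Operation W q) :
    Operation W (p + q) :=
  fun x y => diamondSkew P Q x y + ((-1 : ℤ) ^ (p * q)) • diamondLast P Q x y

/-- The Matsushima-Nijenhuis bracket `[P, Q] = P ⋄ Q - (-1)^{pq} Q ⋄ P`. -/
def mnBracket {W : Type*} [AddCommGroup W] {p q : ℕ} (P : Operation W p) (Q : Operation W q) :
    Operation W (p + q) :=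
  fun x y => diamond P Q x y
    - ((-1 : ℤ) ^ (p * q)) • diamond Q P (x ∘ Fin.cast (Nat.add_comm q p)) y

/-! ### Representations, 2-cocycles and relative cocycle weighted Reynolds operators -/

section PreLie

variable (g V : Type*) [LeftPreLieRing g] [LeftPreLieAlgebra ℂ g] [AddCommGroup V] [Module ℂ V]

/-- A representation `(V; L, R)` of a pre-Lie algebra `g`. -/
structure PreLieRep where
  L : g →ₗ[ℂ] Module.End ℂ V
  R : g →ₗ[ℂ] Module.End ℂ V
  left_left : ∀ (x y : g) (u : V), L x (L y u) - L (x * y) u = L y (L x u) - L (y * x) u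
  left_right : ∀ (x y : g) (u : V), L x (R y u) - R y (L x u) = R (x * y) u - R y (R x u)

variable {g V}

/-- `H : g ⊗ g → V` is a 2-cocycle of `g` with coefficients in the representation `ρ`. -/
def PreLieRep.IsTwoCocycle (ρ : PreLieRep g V) (H : g →ₗ[ℂ] g →ₗ[ℂ] V) : Prop :=
  ∀ x y z : g, ρ.L x (H y z) - ρ.L y (H x z) + ρ.R z (H y x) - ρ.R z (H x y)
    - H y (x * z) + H x (y * z) - H (x * y - y * x) z = 0

/-- `K` is a relative cocycle weighted Reynolds operator with weight `H`. -/
def PreLieRep.IsReynolds (ρ : PreLieRep g V) (H : g →ₗ[ℂ] g →ₗ[ℂ] V) (K : V →ₗ[ℂ] g) : Prop :=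
  ∀ u v : V, K u * K v = K (ρ.L (K u) v + ρ.R (K v) u + H (K u) (K v))

/-- The operation `μ + L + R` on `g ⊕ V`, with `μ` the product of `g`: the product
`((x, u), (y, v)) ↦ (x * y, L_x v + R_y u)`. -/
def PreLieRep.semidirect (ρ : PreLieRep g V) : Operation (g × V) 1 :=
  fun a b => ((a 0).1 * b.1, ρ.L (a 0).1 b.2 + ρ.R b.1 (a 0).2)

/-! ### The graded space of cochains -/

variable (g V) in
/-- `Hom (∧^m V ⊗ V, g)`, presented as the alternating `m`-linear maps with values in
`Hom (V, g)`. -/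
abbrev Cochain (m : ℕ) : Type _ := V [⋀^Fin m]→ₗ[ℂ] (V →ₗ[ℂ] g)

variable (g V) in
/-- The total space `⨁ₙ Hom (∧^{n-1} V ⊗ V, g)`; the summand `m` is the one with `n = m + 1`, the
space for `n = 0` being zero. -/
abbrev CochainSpace : Type _ := ⨁ m : ℕ, Cochain g V m

variable (g V) in
/-- The grading of the total space: `Hom (∧^{n-1} V ⊗ V, g)` has degree `n` for `n ≥ 1`, and the
part of degree `n ≤ 0` is zero. -/
def cochainGrading (n : ℤ) : Submodule ℂ (CochainSpace g V) where
  carrier := {x | ∀ m : ℕ, (m : ℤ) + 1 ≠ n → x m = 0}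
  zero_mem' := fun _ _ => rfl
  add_mem' := fun hx hy m hm => by rw [DirectSum.add_apply, hx m hm, hy m hm, add_zero]
  smul_mem' := fun c x hx m hm => by rw [DirectSum.smul_apply, hx m hm, smul_zero]

/-- A cochain as a homogeneous element of the total space. -/
noncomputable def Cochain.toSpace {m : ℕ} (P : Cochain g V m) : CochainSpace g V :=
  DirectSum.lof ℂ ℕ (Cochain g V) m P

/-- A linear map `V → g` as an element of degree `1` of the total space. -/
noncomputable def linearCochain (K : V →ₗ[ℂ] g) : CochainSpace g V :=
  Cochain.toSpace (AlternatingMap.constOfIsEmpty ℂ V (Fin 0) K)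

/-- A cochain `P : ∧^m V ⊗ V → g` as an operation on `g ⊕ V`, extended by zero. -/
def Cochain.lift {m : ℕ} (P : Cochain g V m) : Operation (g × V) m :=
  fun x y => (P (fun i => (x i).2) y.2, 0)

/-- The part of the ternary bracket in which `H(Q, R)` is inserted in a skew argument of `P`, for
`P, Q, R` of arities `p = a + 1`, `q = b + 1`, `r = c + 1`; it is empty for `p = 1`:
`∑_{σ ∈ S(q-1, 1, r-1, 1, p-2)} sgn(σ) P(H(Q(u_{σ(1)}, …, u_{σ(q-1)}, u_{σ(q)}),
R(u_{σ(q+1)}, …, u_{σ(q+r-1)}, u_{σ(q+r)})), u_{σ(q+r+1)}, …, u_{σ(p+q+r-2)}, v)`. -/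
def insertSkew (H : g →ₗ[ℂ] g →ₗ[ℂ] V) : {a b c : ℕ} →
    Cochain g V a → Cochain g V b → Cochain g V c → (Fin (a + b + c + 1) → V) → V → g
  | 0, _, _, _, _, _ => fun _ _ => 0
  | a + 1, b, c, P, Q, R => fun u v =>
      ∑ σ ∈ unshuffles [b, 1, c, 1, a] (a + 1 + b + c + 1), Equiv.Perm.sign σ •
        P (Fin.cons
          (H (Q (block (u ∘ σ) 0 b (by omega)) (u (σ ⟨b, by omega⟩)))
            (R (block (u ∘ σ) (b + 1) c (by omega)) (u (σ ⟨b + 1 + c, by omega⟩))))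
          (block (u ∘ σ) (b + 1 + c + 1) a (by omega))) v

/-- The part of the ternary bracket in which `H(Q, R)` is inserted in the last argument of `P`,
for `P, Q, R` of arities `p = a + 1`, `q = b + 1`, `r = c + 1`:
`∑_{σ ∈ S(p-1, q-1, 1, r-1)} sgn(σ) P(u_{σ(1)}, …, u_{σ(p-1)},
H(Q(u_{σ(p)}, …, u_{σ(p+q-2)}, u_{σ(p+q-1)}), R(u_{σ(p+q)}, …, u_{σ(p+q+r-2)}, v)))`. -/
def insertLast (H : g →ₗ[ℂ] g →ₗ[ℂ] V) {a b c : ℕ}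
    (P : Cochain g V a) (Q : Cochain g V b) (R : Cochain g V c)
    (u : Fin (a + b + c + 1) → V) (v : V) : g :=
  ∑ σ ∈ unshuffles [a, b, 1, c] (a + b + c + 1), Equiv.Perm.sign σ •
    P (block (u ∘ σ) 0 a (by omega))
      (H (Q (block (u ∘ σ) a b (by omega)) (u (σ ⟨a + b, by omega⟩)))
        (R (block (u ∘ σ) (a + b + 1) c (by omega)) v))

/-- The explicit ternary bracket of `P, Q, R`, of arities `p = a + 1`, `q = b + 1`, `r = c + 1`,
evaluated at `u_1, …, u_{p+q+r-2}, v`.  Exponents of `-1` are written without subtraction. -/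
def ternaryBracket (H : g →ₗ[ℂ] g →ₗ[ℂ] V) {a b c : ℕ}
    (P : Cochain g V a) (Q : Cochain g V b) (R : Cochain g V c)
    (u : Fin (a + b + c + 1) → V) (v : V) : g :=
  let p := a + 1
  let q := b + 1
  let r := c + 1
  ((-1 : ℤ) ^ (r * q + p + 1)) • insertSkew H P Q R u v
  + ((-1 : ℤ) ^ p) • insertSkew H P R Q (u ∘ Fin.cast (by omega)) v
  + ((-1 : ℤ) ^ ((r + 1) * (p + q + 1) + p * q + p + 1)) • insertLast H P Q R u v
  + ((-1 : ℤ) ^ (p * q + p * r + q + r + 1)) • insertLast H P R Q (u ∘ Fin.cast (by omega)) v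
  + ((-1 : ℤ) ^ (p * q + q + 1)) • insertSkew H Q R P (u ∘ Fin.cast (by omega)) v
  + ((-1 : ℤ) ^ (r * p + p * q + q)) • insertSkew H Q P R (u ∘ Fin.cast (by omega)) v
  + ((-1 : ℤ) ^ (q * r + p + r)) • insertLast H Q R P (u ∘ Fin.cast (by omega)) v
  + ((-1 : ℤ) ^ ((r + 1) * (p + q + 1) + q)) • insertLast H Q P R (u ∘ Fin.cast (by omega)) v
  + ((-1 : ℤ) ^ ((r + 1) * (p + q + 1) + p + q + 1)) •
      insertSkew H R Q P (u ∘ Fin.cast (by omega)) v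
  + ((-1 : ℤ) ^ (p * (q + 1) + (r + 1) * (p + q + 1) + q)) •
      insertSkew H R P Q (u ∘ Fin.cast (by omega)) v
  + ((-1 : ℤ) ^ (p + q + 1)) • insertLast H R Q P (u ∘ Fin.cast (by omega)) v
  + ((-1 : ℤ) ^ (p * q + p + q)) • insertLast H R P Q (u ∘ Fin.cast (by omega)) v

end PreLie

/-! The brackets are derived brackets in the sense of Voronov. On W = g ⊕ V the product ⋄ satisfies
a graded right pre-Lie identity (`circ_circ_comm`): the terms of (P ⋄ Q) ⋄ R in which R does not
enter Q are symmetric in Q and R up to sign. Hence the Matsushima–Nijenhuis bracket is a graded Lie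
bracket (`listBracket_jacobi`). The cochains, which take arguments in V and values in g, form an
abelian subalgebra for it (`IsCochainOp.bracket_eq_zero`).

Let π = μ + L + R, and let H also denote the weight extended to W; both have degree 1. The pre-Lie
and representation axioms give [π, π] = 0, the cocycle condition gives [π, H] = 0, and [H, H] = 0
because H takes its values in V and ignores V. Since π preserves g, its double bracket with cochains
is again a cochain, so its triple brackets vanish (`isCochainOp_bracket`). For H this happens one
step later: triple brackets are cochains and fourfold ones vanish (`isCochainOp_bracket_bracket`).
So l_2 comes from π, l_3 from H, and nothing else is needed. Skew-symmetry follows from the Jacobi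
identity and the commutation of cochains. Bracketing [π, π], [π, H], [H, H] with three, four and
five cochains and expanding by the Leibniz rule (`leibnizSum_eq_zero`) gives the higher Jacobi
identities for n = 3, 4, 5; for other n every summand is zero.

To avoid calculations with permutations, an operation is a function of the list of its skew
arguments with values in the endomorphisms of W. Sums over unshuffles become recursive sums over
splittings of a list (`conv`), which are coassociative and graded cocommutative, so that identities
follow by induction on the list; `sum_unshuffles` translates between the two. That an operation
ignores g is detected algebraically: inserting the projection onto g multiplies by the number of
arguments in g (`killsG_of_circ_projG`).

The explicit l_3 is the expansion of the triple bracket with H (`skewThree_listOp`). For K of degree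
1, l_2(K, K) is twice the defect of K for weight zero and l_3(K, K, K) is -6 K H(K, K), so the
Maurer–Cartan equation is the Reynolds identity. -/

/-! ### Sums over signed splittings of a list -/

section Split

variable {α M N : Type*} [AddCommGroup M] [AddCommGroup N]

/-- The sum of `± Φ A B` over all the ways to split a list into two subsequences `A` and `B`, where
moving an entry `x` from the front past a list `A` costs the sign `s x A`. -/
def split (s : α → List α → ℤˣ) : (List α → List α → M) → List α → M
  | Φ, [] => Φ [] []
  | Φ, x :: l => split s (fun A B => Φ (x :: A) B) l + split s (fun A B => s x A • Φ A (x :: B)) l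

theorem split_congr (s : α → List α → ℤˣ) {l : List α} {Φ Ψ : List α → List α → M}
    (h : ∀ A B, A.length + B.length = l.length → Φ A B = Ψ A B) : split s Φ l = split s Ψ l := by
  induction l generalizing Φ Ψ with
  | nil => exact h _ _ rfl
  | cons x l ih =>
    simp only [split]
    rw [ih (Φ := fun A B => Φ (x :: A) B) (Ψ := fun A B => Ψ (x :: A) B)
        fun A B e => h _ _ (by simp; omega),
      ih (Φ := fun A B => s x A • Φ A (x :: B)) (Ψ := fun A B => s x A • Ψ A (x :: B))
        fun A B e => by rw [h _ _ (by simp; omega)]]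

theorem split_zero (s : α → List α → ℤˣ) (l : List α) :
    split s (fun _ _ => (0 : M)) l = 0 := by
  induction l with
  | nil => rfl
  | cons x l ih => simp [split, ih]

theorem split_eq_zero (s : α → List α → ℤˣ) {l : List α} {Φ : List α → List α → M}
    (h : ∀ A B, A.length + B.length = l.length → Φ A B = 0) : split s Φ l = 0 := by
  rw [split_congr s h, split_zero]

theorem split_add (s : α → List α → ℤˣ) (Φ Ψ : List α → List α → M) (l : List α) :
    split s (fun A B => Φ A B + Ψ A B) l = split s Φ l + split s Ψ l := by
  induction l generalizing Φ Ψ with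
  | nil => rfl
  | cons x l ih => simp only [split, smul_add, ih]; abel

theorem map_split (s : α → List α → ℤˣ) {F : Type*} [FunLike F M N] [AddMonoidHomClass F M N]
    (f : F) (Φ : List α → List α → M) (l : List α) :
    f (split s Φ l) = split s (fun A B => f (Φ A B)) l := by
  induction l generalizing Φ with
  | nil => rfl
  | cons x l ih => simp only [split, map_add, ih, Units.smul_def, map_zsmul]

end Split

/-- The signed sum over splittings in which all the entries of the list are odd. -/
def conv {α M : Type*} [AddCommGroup M] (Φ : List α → List α → M) (l : List α) : M :=
  split (fun _ A => (-1) ^ A.length) Φ l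

/-! ### Splittings with odd entries: a coassociative, graded cocommutative coproduct. -/

section Conv

variable {α M N : Type*} [AddCommGroup M] [AddCommGroup N]

theorem conv_cons (Φ : List α → List α → M) (x : α) (l : List α) :
    conv Φ (x :: l) = conv (fun A B => Φ (x :: A) B) l
      + conv (fun A B => (-1 : ℤ) ^ A.length • Φ A (x :: B)) l := by
  simp only [conv, split, Units.smul_def, Units.val_pow_eq_pow_val, Units.val_neg, Units.val_one]

theorem conv_nil (Φ : List α → List α → M) : conv Φ [] = Φ [] [] := rfl

theorem conv_congr {l : List α} {Φ Ψ : List α → List α → M}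
    (h : ∀ A B, A.length + B.length = l.length → Φ A B = Ψ A B) : conv Φ l = conv Ψ l :=
  split_congr _ h

theorem conv_zero (l : List α) : conv (fun _ _ => (0 : M)) l = 0 := split_zero _ l

theorem conv_add (Φ Ψ : List α → List α → M) (l : List α) :
    conv (fun A B => Φ A B + Ψ A B) l = conv Φ l + conv Ψ l :=
  split_add _ Φ Ψ l

theorem map_conv {F : Type*} [FunLike F M N] [AddMonoidHomClass F M N]
    (f : F) (Φ : List α → List α → M) (l : List α) :
    f (conv Φ l) = conv (fun A B => f (Φ A B)) l :=
  map_split _ f Φ l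

theorem conv_zsmul (k : ℤ) (Φ : List α → List α → M) (l : List α) :
    conv (fun A B => k • Φ A B) l = k • conv Φ l :=
  (map_split _ (DistribSMul.toAddMonoidHom M k) Φ l).symm

theorem conv_neg (Φ : List α → List α → M) (l : List α) :
    conv (fun A B => -Φ A B) l = -conv Φ l :=
  (map_split _ (negAddMonoidHom (α := M)) Φ l).symm

/-- Coassociativity of the splitting of a list. -/
theorem conv_assoc (Φ : List α → List α → List α → M) (l : List α) :
    conv (fun A B => conv (fun C D => Φ A C D) B) l
      = conv (fun A B => conv (fun C D => Φ C D B) A) l := by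
  induction l generalizing Φ with
  | nil => rfl
  | cons x l ih =>
    simp only [conv_cons, smul_add, conv_add]
    rw [ih, add_assoc]
    simp only [← conv_zsmul]
    rw [ih (fun A C D => (-1 : ℤ) ^ A.length • Φ A (x :: C) D),
      ih (fun A C D => (-1 : ℤ) ^ A.length • (-1 : ℤ) ^ C.length • Φ A C (x :: D))]
    -- What is left is the case where the head goes to the third sublist: it passes A and C in turn
    -- on one side, and their merged list on the other, so the signs agree by additivity of lengths.
    congr 2
    refine conv_congr fun A B _ => conv_congr fun C D h => ?_
    rw [← h, pow_add, mul_smul]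

/-- Cocommutativity of the splitting of a list. -/
theorem conv_comm (Φ : List α → List α → M) (l : List α) :
    conv Φ l = conv (fun A B => (-1 : ℤ) ^ (A.length * B.length) • Φ B A) l := by
  induction l generalizing Φ with
  | nil => simp [conv_nil]
  | cons x l ih =>
    simp only [conv_cons]
    rw [ih, add_comm, ih]
    congr 1 <;> refine conv_congr fun A B _ => ?_
    · rw [List.length_cons, add_mul, one_mul, pow_add, mul_smul]
    · rw [List.length_cons, mul_add, mul_one, pow_add, ← mul_smul, ← mul_assoc,
        mul_comm ((-1 : ℤ) ^ A.length), mul_assoc, ← pow_add, ← two_mul, pow_mul (-1) 2]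
      simp

end Conv

/-! ### Alternating multilinear functions of a list -/

section Multi

variable {W M N : Type*} [AddCommGroup W] [Module ℂ W] [AddCommGroup M] [Module ℂ M]
  [AddCommGroup N] [Module ℂ N]

/-- A function of a list of vectors is alternating and multilinear. -/
structure IsMulti (f : List W → M) : Prop where
  swap : ∀ l x y l', f (l ++ x :: y :: l') = -f (l ++ y :: x :: l')
  add : ∀ x y l, f ((x + y) :: l) = f (x :: l) + f (y :: l)
  smul : ∀ (c : ℂ) x l, f ((c • x) :: l) = c • f (x :: l)

theorem IsMulti.swap_head {f : List W → M} (hf : IsMulti f) (x y : W) (l : List W) :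
    f (x :: y :: l) = -f (y :: x :: l) :=
  hf.swap [] x y l

theorem IsMulti.cons {f : List W → M} (hf : IsMulti f) (x : W) :
    IsMulti fun l => f (x :: l) where
  swap l := hf.swap (x :: l)
  add y z l := by rw [hf.swap_head, hf.add, hf.swap_head x y, hf.swap_head x z, neg_add]
  smul c y l := by rw [hf.swap_head, hf.smul, hf.swap_head x y, smul_neg]

/-- The dependence of an alternating multilinear function on the first entry. -/
def IsMulti.head {f : List W → M} (hf : IsMulti f) (l : List W) : W →ₗ[ℂ] M where
  toFun x := f (x :: l)
  map_add' x y := hf.add x y l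
  map_smul' c x := hf.smul c x l

theorem IsMulti.head_apply {f : List W → M} (hf : IsMulti f) (l : List W) (x : W) :
    hf.head l x = f (x :: l) := rfl

theorem IsMulti.map {f : List W → M} (hf : IsMulti f) (φ : M →ₗ[ℂ] N) :
    IsMulti fun l => φ (f l) where
  swap l x y l' := by rw [hf.swap, map_neg]
  add x y l := by rw [hf.add, map_add]
  smul c x l := by rw [hf.smul, map_smul]

theorem isMulti_zero : IsMulti fun _ : List W => (0 : M) := ⟨by simp, by simp, by simp⟩

theorem IsMulti.add_fun {f g : List W → M} (hf : IsMulti f) (hg : IsMulti g) :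
    IsMulti fun l => f l + g l where
  swap l x y l' := by rw [hf.swap, hg.swap, neg_add]
  add x y l := by rw [hf.add, hg.add]; abel
  smul c x l := by rw [hf.smul, hg.smul, smul_add]

theorem IsMulti.zsmul {f : List W → M} (hf : IsMulti f) (k : ℤ) : IsMulti fun l => k • f l where
  swap l x y l' := by rw [hf.swap, smul_neg]
  add x y l := by rw [hf.add, smul_add]
  smul c x l := by rw [hf.smul, smul_comm]

/-- The shuffle product of alternating maps is alternating: two neighbouring entries either land in
the same factor, where that factor changes sign, or are separated, and then the two ways of
separating them carry opposite signs. -/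
theorem isMulti_conv {Φ : List W → List W → M} (h₁ : ∀ B, IsMulti fun A => Φ A B)
    (h₂ : ∀ A, IsMulti fun B => Φ A B) : IsMulti (conv Φ) where
  swap l x y l' := by
    induction l generalizing Φ with
    | nil =>
      simp only [List.nil_append, conv_cons, ← conv_add, ← conv_neg]
      refine conv_congr fun A B _ => ?_
      rw [(h₁ B).swap_head, (h₂ A).swap_head]
      simp only [List.length_cons, pow_succ]
      module
    | cons z l ih =>
      simp only [List.cons_append, conv_cons]
      rw [ih (fun B => (h₁ B).cons z) (fun A => h₂ (z :: A)),
        ih (Φ := fun A B => (-1 : ℤ) ^ A.length • Φ A (z :: B)) (fun B => ?_)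
          (fun A => ((h₂ A).cons z).zsmul _), neg_add]
      -- The extra factor (-1) to the length of A is harmless, because each axiom compares lists of
      -- equal length.
      constructor
      · intro l x y l'
        rw [(h₁ _).swap, smul_neg, List.length_append, List.length_append]; rfl
      · intro x y l
        rw [(h₁ _).add, smul_add]; rfl
      · intro c x l
        rw [(h₁ _).smul, smul_comm]; rfl
  add x y l := by
    simp only [conv_cons, ← conv_add]
    refine conv_congr fun A B _ => ?_
    rw [(h₁ B).add, (h₂ A).add, smul_add]
    abel
  smul c x l := by
    simp only [conv_cons]
    change _ = LinearMap.lsmul ℂ M c _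
    rw [map_add, map_conv, map_conv]
    congr 1 <;> refine conv_congr fun A B _ => ?_
    · exact (h₁ B).smul c x A
    · rw [(h₂ A).smul, LinearMap.lsmul_apply, smul_comm]

/-- The entry of a list with one element, and `0` on the other lists. -/
def listOne : List W → W
  | [x] => x
  | _ => 0

theorem isMulti_listOne : IsMulti (listOne : List W → W) where
  swap l x y l' := by
    have (x y : W) : listOne (l ++ x :: y :: l') = 0 := by
      rcases l with _ | ⟨a, _ | ⟨b, l⟩⟩ <;> rfl
    simp [this]
  add x y l := by cases l <;> simp [listOne]
  smul c x l := by cases l <;> simp [listOne]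

end Multi

/-! ### The Matsushima-Nijenhuis product of functions of a list -/

/-- The sign `(-1)^p`, as an integer. -/
def paritySign (p : ℤ) : ℤ := if Even p then 1 else -1

theorem neg_one_pow_eq_paritySign (n : ℕ) : (-1 : ℤ) ^ n = paritySign n := by
  rcases n.even_or_odd with h | h
  · simp [paritySign, h, h.neg_one_pow]
  · simp [paritySign, h, h.neg_one_pow, ← Nat.not_odd_iff_even]

theorem paritySign_add (p q : ℤ) : paritySign (p + q) = paritySign p * paritySign q := by
  by_cases hp : Even p <;> by_cases hq : Even q <;> simp [paritySign, Int.even_add, hp, hq]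

theorem paritySign_eq_or (p : ℤ) : paritySign p = 1 ∨ paritySign p = -1 := by
  by_cases hp : Even p <;> simp [paritySign, hp]

theorem paritySign_one : paritySign 1 = -1 := rfl

theorem paritySign_mul_self (p : ℤ) : paritySign p * paritySign p = 1 := by
  by_cases hp : Even p <;> simp [paritySign, hp]

section Circ

variable {W : Type*} [AddCommGroup W] [Module ℂ W]

/-- The full antisymmetrization of an operation with a distinguished last argument. -/
def outer (Q : List W → Module.End ℂ W) (l : List W) : W := conv (fun A B => Q A (listOne B)) l

/-- The product `P ⋄ Q` of two operations, given as functions of the list of their skew arguments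
with values in the endomorphisms. -/
def circ (P Q : List W → Module.End ℂ W) (l : List W) : Module.End ℂ W :=
  conv (fun A B => P (outer Q A :: B) + P B * Q A) l

infixl:70 " ⋄ " => circ

/-- An alternating multilinear operation with `p` skew arguments. -/
structure IsOp (p : ℤ) (f : List W → Module.End ℂ W) : Prop where
  multi : IsMulti f
  supp : ∀ l : List W, (l.length : ℤ) ≠ p → f l = 0

variable {P Q R : List W → Module.End ℂ W} {p q r : ℤ}

theorem IsMulti.apply (hP : IsMulti P) (w : W) : IsMulti fun l => P l w :=
  hP.map (LinearMap.applyₗ w)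

theorem IsMulti.outer (hQ : IsMulti Q) : IsMulti (outer Q) :=
  isMulti_conv (fun B => hQ.apply (listOne B)) (fun A => isMulti_listOne.map (Q A))

theorem outer_supp (hQ : IsOp q Q) {l : List W} (hl : (l.length : ℤ) ≠ q + 1) :
    outer Q l = 0 := by
  refine split_eq_zero _ fun A B h => ?_
  rcases B with _ | ⟨b, _ | ⟨c, B⟩⟩
  · simp [listOne]
  · rw [hQ.supp A (fun e => hl ?_), LinearMap.zero_apply]
    rw [← h, ← e]; simp
  · simp [listOne]

theorem isOp_zero : IsOp p (0 : List W → Module.End ℂ W) := ⟨isMulti_zero, fun _ _ => rfl⟩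

theorem IsOp.add (hP : IsOp p P) (hQ : IsOp p Q) : IsOp p (P + Q) :=
  ⟨hP.multi.add_fun hQ.multi, fun l h => by simp [hP.supp l h, hQ.supp l h]⟩

theorem IsOp.zsmul (hP : IsOp p P) (k : ℤ) : IsOp p (k • P) :=
  ⟨hP.multi.zsmul k, fun l h => by simp [hP.supp l h]⟩

theorem IsOp.neg (hP : IsOp p P) : IsOp p (-P) := by
  simpa using hP.zsmul (-1)

theorem IsOp.sub (hP : IsOp p P) (hQ : IsOp p Q) : IsOp p (P - Q) := by
  rw [sub_eq_add_neg]; exact hP.add hQ.neg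

theorem IsMulti.circ (hP : IsMulti P) (hQ : IsMulti Q) : IsMulti (P ⋄ Q) := by
  refine isMulti_conv (fun B => ?_) (fun A => ?_)
  · exact (hQ.outer.map (hP.head B)).add_fun (hQ.map (LinearMap.mulLeft ℂ (P B)))
  · exact (hP.cons _).add_fun (hP.map (LinearMap.mulRight ℂ (Q A)))

theorem IsOp.circ (hP : IsOp p P) (hQ : IsOp q Q) : IsOp (p + q) (P ⋄ Q) := by
  refine ⟨hP.multi.circ hQ.multi, fun l hl => split_eq_zero _ fun A B h => ?_⟩
  have h₁ : P (outer Q A :: B) = 0 := by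
    by_cases hA : (A.length : ℤ) = q + 1
    · refine hP.supp _ ?_
      simp only [List.length_cons]
      omega
    · rw [outer_supp hQ hA, ← hP.multi.head_apply, map_zero]
  have h₂ : P B * Q A = 0 := by
    by_cases hA : (A.length : ℤ) = q
    · rw [hP.supp B (by omega), zero_mul]
    · rw [hQ.supp A hA, mul_zero]
  rw [h₁, h₂, add_zero]

theorem add_circ (P P' Q : List W → Module.End ℂ W) : (P + P') ⋄ Q = P ⋄ Q + P' ⋄ Q := by
  funext l
  simp only [circ, Pi.add_apply, ← conv_add, add_mul]
  exact conv_congr fun A B _ => by abel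

theorem zsmul_circ (k : ℤ) (P Q : List W → Module.End ℂ W) : (k • P) ⋄ Q = k • (P ⋄ Q) := by
  funext l
  simp only [circ, Pi.smul_apply, ← conv_zsmul, smul_add, smul_mul_assoc]

theorem outer_add (P Q : List W → Module.End ℂ W) (l : List W) :
    outer (P + Q) l = outer P l + outer Q l := by
  simp only [outer, ← conv_add, Pi.add_apply, LinearMap.add_apply]

theorem outer_smul (c : ℂ) (P : List W → Module.End ℂ W) (l : List W) :
    outer (c • P) l = c • outer P l := by
  change _ = LinearMap.lsmul ℂ W c _
  rw [outer, outer, map_conv]; rfl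

theorem circ_add (hP : IsMulti P) (Q R : List W → Module.End ℂ W) :
    P ⋄ (Q + R) = P ⋄ Q + P ⋄ R := by
  funext l
  simp only [circ, Pi.add_apply, ← conv_add, mul_add, outer_add, hP.add]
  exact conv_congr fun A B _ => by abel

theorem circ_smul (hP : IsMulti P) (c : ℂ) (Q : List W → Module.End ℂ W) :
    P ⋄ (c • Q) = c • (P ⋄ Q) := by
  funext l
  change _ = LinearMap.lsmul ℂ _ c _
  rw [circ, circ, map_conv]
  refine conv_congr fun A B _ => ?_
  simp [outer_smul, hP.smul]

theorem smul_circ (c : ℂ) (P Q : List W → Module.End ℂ W) : (c • P) ⋄ Q = c • (P ⋄ Q) := by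
  funext l
  change _ = LinearMap.lsmul ℂ _ c _
  rw [circ, circ, map_conv]
  refine conv_congr fun A B _ => ?_
  simp

theorem circ_zsmul (hP : IsMulti P) (k : ℤ) (Q : List W → Module.End ℂ W) :
    P ⋄ (k • Q) = k • (P ⋄ Q) := by
  rw [← Int.cast_smul_eq_zsmul ℂ, circ_smul hP, Int.cast_smul_eq_zsmul]

theorem neg_circ (P Q : List W → Module.End ℂ W) : (-P) ⋄ Q = -(P ⋄ Q) := by
  simpa using zsmul_circ (-1) P Q

theorem circ_neg (hP : IsMulti P) (Q : List W → Module.End ℂ W) : P ⋄ (-Q) = -(P ⋄ Q) := by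
  simpa using circ_zsmul hP (-1) Q

theorem sub_circ (P P' Q : List W → Module.End ℂ W) : (P - P') ⋄ Q = P ⋄ Q - P' ⋄ Q := by
  simp only [sub_eq_add_neg, add_circ, neg_circ]

theorem circ_sub (hP : IsMulti P) (Q R : List W → Module.End ℂ W) :
    P ⋄ (Q - R) = P ⋄ Q - P ⋄ R := by
  simp only [sub_eq_add_neg, circ_add hP, circ_neg hP]

theorem zero_circ (Q : List W → Module.End ℂ W) : 0 ⋄ Q = 0 := by
  simpa using zsmul_circ 0 0 Q

theorem circ_zero (hP : IsMulti P) : P ⋄ 0 = 0 := by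
  simpa using circ_zsmul hP 0 0

/-- Only the splitting with empty second part survives, since `listOne` vanishes on longer lists. -/
theorem conv_listOne_cons {M : Type*} [AddCommGroup M] [Module ℂ M] (φ : List W → W →ₗ[ℂ] M)
    (z : W) (l : List W) :
    conv (fun A B => φ A (listOne (z :: B))) l = φ l z := by
  induction l generalizing φ with
  | nil => rfl
  | cons x l ih =>
    rw [conv_cons, ih fun A => φ (x :: A)]
    simp [listOne, conv_zero]

theorem outer_cons (Q : List W → Module.End ℂ W) (z : W) (l : List W) :
    outer Q (z :: l)
      = conv (fun A B => Q (z :: A) (listOne B)) l + (-1 : ℤ) ^ l.length • Q l z := by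
  rw [outer, conv_cons]
  congr 1
  exact conv_listOne_cons (fun A => (-1 : ℤ) ^ A.length • Q A) z l

/-- After full antisymmetrization the last argument is no longer distinguished: the terms with Q in
a skew argument of P and those with Q in the last argument are exactly the two parts of
`outer_cons`. -/
theorem outer_circ (P Q : List W → Module.End ℂ W) (l : List W) :
    outer (P ⋄ Q) l = conv (fun A B => outer P (outer Q A :: B)) l := by
  have h (E D : List W) : (P ⋄ Q) E (listOne D)
      = conv (fun A B => P (outer Q A :: B) (listOne D)) E
        + conv (fun A B => P B (Q A (listOne D))) E := by
    rw [← conv_add]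
    exact map_conv (LinearMap.applyₗ (R := ℂ) (listOne D)) _ E
  rw [outer, funext fun E => funext fun D => h E D, conv_add, ← conv_assoc]
  simp only [outer_cons, conv_add]
  congr 1
  have h' (A B : List W) : (-1 : ℤ) ^ B.length • P B (outer Q A)
      = conv (fun C D => (-1 : ℤ) ^ B.length • P B (Q C (listOne D))) A := by
    rw [outer, map_conv, conv_zsmul]
  rw [funext fun A => funext fun B => h' A B, ← conv_assoc, ← conv_assoc]
  refine conv_congr fun A E _ => ?_
  rw [conv_comm]
  refine conv_congr fun D B _ => ?_
  -- Only a D of length one contributes, and then the sign of the exchange with B cancels the sign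
  -- (-1) to the length of B.
  rcases D with _ | ⟨d, _ | ⟨e, D⟩⟩ <;> simp [listOne]

/-- The part of `(P ⋄ Q) ⋄ R` in which `Q` and `R` are inserted in different arguments of `P`. -/
def circTwo (P Q R : List W → Module.End ℂ W) (l : List W) : Module.End ℂ W :=
  conv (fun A B => conv (fun C D =>
    (-1 : ℤ) ^ C.length • (P (outer R A :: D) * Q C - P (outer R A :: outer Q C :: D))
      + P (outer Q C :: D) * R A) B) l

/-- In (P ⋄ Q) ⋄ R, either R enters an argument of Q, which assembles by coassociativity and
`outer_circ` to P ⋄ (Q ⋄ R), or Q and R enter different arguments of P. -/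
theorem circ_circ (hP : IsMulti P) (Q R : List W → Module.End ℂ W) :
    P ⋄ Q ⋄ R = P ⋄ (Q ⋄ R) + circTwo P Q R := by
  funext l
  have h₁ (z : W) (B : List W) : (P ⋄ Q) (z :: B)
      = conv (fun C D => P (outer Q (z :: C) :: D) + P D * Q (z :: C)
          + (-1 : ℤ) ^ C.length • (P (z :: D) * Q C - P (z :: outer Q C :: D))) B := by
    rw [circ, conv_cons, ← conv_add]
    refine conv_congr fun C D _ => ?_
    rw [hP.swap_head (outer Q C)]
    module
  have h₂ (A B : List W) : (P ⋄ Q) B * R A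
      = conv (fun C D => P (outer Q C :: D) * R A + P D * Q C * R A) B := by
    simp only [circ, ← add_mul]
    exact map_conv (LinearMap.mulRight ℂ (R A)) _ B
  have h₃ (E D : List W) : P (outer (Q ⋄ R) E :: D) + P D * (Q ⋄ R) E
      = conv (fun A C => P (outer Q (outer R A :: C) :: D)
          + P D * (Q (outer R A :: C) + Q C * R A)) E := by
    rw [outer_circ, ← hP.head_apply, map_conv, conv_add]
    congr 1
    exact map_conv (LinearMap.mulLeft ℂ (P D)) _ E
  rw [circ, Pi.add_apply, circ, circTwo]
  simp only [h₁, h₂, h₃, ← conv_add]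
  rw [conv_add, ← conv_assoc, ← conv_add]
  refine conv_congr fun A B _ => ?_
  rw [← conv_add]
  refine conv_congr fun C D _ => ?_
  rw [mul_add, mul_assoc]
  abel

/-- Q and R play the same role in this part, so exchanging them only exchanges two sublists. This is
where the degrees matter: the supports fix the lengths of the sublists, and with them the sign. -/
theorem circTwo_comm (hP : IsMulti P) (hQ : IsOp q Q) (hR : IsOp r R) :
    circTwo P R Q = paritySign (q * r) • circTwo P Q R := by
  funext l
  rw [circTwo, conv_assoc, Pi.smul_apply, circTwo, conv_assoc, ← conv_zsmul]
  refine conv_congr fun E D _ => ?_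
  rw [conv_comm, ← conv_zsmul]
  refine conv_congr fun A C _ => ?_
  simp only [neg_one_pow_eq_paritySign, Nat.cast_mul]
  -- An operation put in a skew argument consumes one entry more than its degree, through `outer`;
  -- one put in the last argument consumes exactly its degree. The three cases below differ only in
  -- this.
  have e₁ : (paritySign (A.length * C.length) * paritySign A.length) • (P (outer Q C :: D) * R A)
      = paritySign (q * r) • (P (outer Q C :: D) * R A) := by
    by_cases hA : (A.length : ℤ) = r
    · by_cases hC : (C.length : ℤ) = q + 1
      · rw [hA, hC]
        congr 1
        simp only [mul_add, paritySign_add, mul_one, mul_comm r q]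
        linear_combination paritySign (q * r) * paritySign_mul_self r
      · rw [outer_supp hQ hC, ← hP.head_apply, map_zero]; simp
    · rw [hR.supp A hA]; simp
  have e₂ : paritySign (A.length * C.length) • (P (outer R A :: D) * Q C)
      = (paritySign (q * r) * paritySign C.length) • (P (outer R A :: D) * Q C) := by
    by_cases hA : (A.length : ℤ) = r + 1
    · by_cases hC : (C.length : ℤ) = q
      · rw [hA, hC]
        congr 1
        simp only [add_mul, paritySign_add, one_mul, mul_comm r q]
      · rw [hQ.supp C hC]; simp
    · rw [outer_supp hR hA, ← hP.head_apply, map_zero]; simp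
  have e₃ : (paritySign (A.length * C.length) * paritySign A.length) •
        P (outer Q C :: outer R A :: D)
      = (paritySign (q * r) * paritySign C.length) • P (outer R A :: outer Q C :: D) := by
    rw [hP.swap_head (outer Q C)]
    by_cases hA : (A.length : ℤ) = r + 1
    · by_cases hC : (C.length : ℤ) = q + 1
      · rw [hA, hC, smul_neg, ← neg_smul]
        congr 1
        simp only [mul_add, add_mul, paritySign_add, mul_one, one_mul, paritySign_one, mul_comm r q]
        linear_combination (-paritySign (q * r) * paritySign q) * paritySign_mul_self r
      · rw [outer_supp hQ hC, ← (hP.cons _).head_apply, map_zero]; simp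
    · rw [outer_supp hR hA, ← hP.head_apply, map_zero]; simp
  simp only [smul_add, smul_sub, ← mul_smul, e₁, e₂, e₃]
  abel

/-- The graded right pre-Lie identity of the product `⋄`. -/
theorem circ_circ_comm (hP : IsMulti P) (hQ : IsOp q Q) (hR : IsOp r R) :
    P ⋄ R ⋄ Q - P ⋄ (R ⋄ Q) = paritySign (q * r) • (P ⋄ Q ⋄ R - P ⋄ (Q ⋄ R)) := by
  rw [circ_circ hP, circ_circ hP, circTwo_comm hP hQ hR]
  simp

/-- The Matsushima-Nijenhuis bracket of operations of degrees `p` and `q`. -/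
def listBracket (p q : ℤ) (P Q : List W → Module.End ℂ W) : List W → Module.End ℂ W :=
  P ⋄ Q - paritySign (p * q) • (Q ⋄ P)

theorem listBracket_comm (p q : ℤ) (P Q : List W → Module.End ℂ W) :
    listBracket p q P Q = -(paritySign (p * q) • listBracket q p Q P) := by
  rw [listBracket, listBracket, smul_sub, ← mul_smul, mul_comm q p, paritySign_mul_self]
  module

theorem IsOp.bracket (hP : IsOp p P) (hQ : IsOp q Q) : IsOp (p + q) (listBracket p q P Q) :=
  (hP.circ hQ).sub ((add_comm q p ▸ hQ.circ hP).zsmul _)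

/-- The graded Jacobi identity of the Matsushima-Nijenhuis bracket. -/
theorem listBracket_jacobi (hP : IsOp p P) (hQ : IsOp q Q) (hR : IsOp r R) :
    listBracket (p + q) r (listBracket p q P Q) R
      = listBracket p (q + r) P (listBracket q r Q R)
        + paritySign (q * r) • listBracket (p + r) q (listBracket p r P R) Q := by
  have h₁ := circ_circ_comm hP.multi hQ hR
  have h₂ := circ_circ_comm hQ.multi hP hR
  have h₃ := circ_circ_comm hR.multi hP hQ
  simp only [listBracket, sub_circ, circ_sub hP.multi, circ_sub hQ.multi, circ_sub hR.multi,
    zsmul_circ, circ_zsmul hP.multi, circ_zsmul hQ.multi, circ_zsmul hR.multi] at *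
  rw [add_mul, mul_add, add_mul, mul_comm r q]
  simp only [paritySign_add]
  -- The Jacobi identity is a signed sum of the three pre-Lie identities; the signs depend only on
  -- the parities of pq, pr and qr, which leaves eight cases.
  linear_combination (norm := skip) (-paritySign (q * r)) • h₁
    + (paritySign (p * q) * paritySign (p * r)) • h₂
    - (paritySign (p * q) * paritySign (p * r) * paritySign (q * r)) • h₃
  obtain a | a := paritySign_eq_or (p * q) <;> obtain b | b := paritySign_eq_or (p * r) <;>
    obtain c | c := paritySign_eq_or (q * r) <;> simp only [a, b, c] <;> module

end Circ

/-! ### Sums over unshuffles as sums over splittings -/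

section Unshuffle

/-- Some initial segment of the blocks has total size `c`. -/
def IsCut : List ℕ → ℕ → Prop
  | [], c => c = 0
  | m :: b, c => c = 0 ∨ (m ≤ c ∧ IsCut b (c - m))

/-- The position `p` is the first one of a nonempty block. -/
def StartsBlock : List ℕ → ℕ → Prop
  | [], _ => False
  | m :: b, p => (p = 0 ∧ 0 < m) ∨ (m ≤ p ∧ StartsBlock b (p - m))

/-- The sizes of the blocks after removing the position `p`, the first one of a block. -/
def removeStart : List ℕ → ℕ → List ℕ
  | [], _ => []
  | m :: b, p => if p = 0 ∧ 0 < m then (m - 1) :: b else m :: removeStart b (p - m)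

theorem isCut_zero (b : List ℕ) : IsCut b 0 := by cases b <;> simp [IsCut]

theorem mem_scanl_iff (b : List ℕ) (a c : ℕ) :
    c ∈ b.scanl (· + ·) a ↔ a ≤ c ∧ IsCut b (c - a) := by
  induction b generalizing a with
  | nil => simp only [List.scanl_nil, List.mem_singleton, IsCut]; omega
  | cons m b ih =>
    rw [List.scanl_cons, List.mem_cons, ih, IsCut, Nat.sub_add_eq]
    constructor
    · rintro (rfl | ⟨h, h'⟩)
      · simp
      · exact ⟨by omega, .inr ⟨by omega, h'⟩⟩
    · rintro ⟨h, h' | ⟨h', h''⟩⟩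
      · left; omega
      · exact .inr ⟨by omega, h''⟩

theorem startsBlock_iff (b : List ℕ) (p : ℕ) : StartsBlock b p ↔ p < b.sum ∧ IsCut b p := by
  induction b generalizing p with
  | nil => simp [StartsBlock]
  | cons m b ih =>
    rw [StartsBlock, IsCut, ih, List.sum_cons]
    constructor
    · rintro (⟨rfl, h⟩ | ⟨h, h', h''⟩)
      · exact ⟨by omega, .inl rfl⟩
      · exact ⟨by omega, .inr ⟨h, h''⟩⟩
    · rintro ⟨h, rfl | ⟨h', h''⟩⟩
      · rcases Nat.eq_zero_or_pos m with rfl | hm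
        · exact .inr ⟨le_rfl, by omega, isCut_zero b⟩
        · exact .inl ⟨rfl, hm⟩
      · exact .inr ⟨h', by omega, h''⟩

/-- Deleting position p keeps the cuts up to p and moves the later ones down by one. As p itself is
a cut, c = p is covered by the first alternative. -/
theorem isCut_removeStart {b : List ℕ} {p : ℕ} (h : StartsBlock b p) (c : ℕ) :
    IsCut (removeStart b p) c ↔ (c ≤ p ∧ IsCut b c) ∨ (p ≤ c ∧ IsCut b (c + 1)) := by
  induction b generalizing p c with
  | nil => exact h.elim
  | cons m b ih =>
    rw [removeStart]
    split_ifs with hp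
    · obtain ⟨rfl, hm⟩ := hp
      simp only [IsCut]
      have e : c - (m - 1) = c + 1 - m := by omega
      rw [e]
      constructor
      · rintro (rfl | ⟨h, h'⟩)
        · simp
        · exact .inr ⟨by omega, .inr ⟨by omega, h'⟩⟩
      · rintro (⟨h, -⟩ | ⟨-, h | ⟨h, h'⟩⟩)
        · left; omega
        · omega
        · exact .inr ⟨by omega, h'⟩
    · obtain hp' | ⟨hm, h⟩ := h
      · exact absurd hp' hp
      simp only [IsCut]
      rw [ih h]
      constructor
      · rintro (rfl | ⟨h₁, ⟨h₂, h₃⟩ | ⟨h₂, h₃⟩⟩)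
        · exact .inl ⟨by omega, .inl rfl⟩
        · exact .inl ⟨by omega, .inr ⟨h₁, h₃⟩⟩
        · refine .inr ⟨by omega, .inr ⟨by omega, ?_⟩⟩
          rwa [Nat.sub_add_comm h₁]
      · rintro (⟨h₁, rfl | ⟨h₂, h₃⟩⟩ | ⟨h₁, h₂ | ⟨h₂, h₃⟩⟩)
        · exact .inl rfl
        · exact .inr ⟨h₂, .inl ⟨by omega, h₃⟩⟩
        · omega
        · refine .inr ⟨by omega, .inr ⟨by omega, ?_⟩⟩
          rwa [← Nat.sub_add_comm (by omega)]

theorem sum_removeStart {b : List ℕ} {p : ℕ} (h : StartsBlock b p) :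
    (removeStart b p).sum + 1 = b.sum := by
  induction b generalizing p with
  | nil => exact h.elim
  | cons m b ih =>
    rw [removeStart]
    split_ifs with hp
    · simp only [List.sum_cons]; omega
    · obtain hp' | ⟨hm, h⟩ := h
      · exact absurd hp' hp
      rw [List.sum_cons, List.sum_cons, ← ih h]
      omega

/-- The permutation with `p ↦ 0` that acts as `τ` on the other positions and values. -/
def insertPerm {n : ℕ} (p : Fin (n + 1)) (τ : Equiv.Perm (Fin n)) : Equiv.Perm (Fin (n + 1)) :=
  Equiv.Perm.decomposeFin.symm (0, τ) * p.cycleRange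

theorem insertPerm_self {n : ℕ} (p : Fin (n + 1)) (τ : Equiv.Perm (Fin n)) :
    insertPerm p τ p = 0 := by
  simp [insertPerm]

theorem insertPerm_succAbove {n : ℕ} (p : Fin (n + 1)) (τ : Equiv.Perm (Fin n)) (i : Fin n) :
    insertPerm p τ (p.succAbove i) = (τ i).succ := by
  simp [insertPerm]

theorem sign_insertPerm {n : ℕ} (p : Fin (n + 1)) (τ : Equiv.Perm (Fin n)) :
    Equiv.Perm.sign (insertPerm p τ) = (-1) ^ (p : ℕ) * Equiv.Perm.sign τ := by
  rw [insertPerm, Equiv.Perm.sign_mul, Fin.sign_cycleRange, Equiv.Perm.decomposeFin.symm_sign]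
  simp [mul_comm]

theorem insertPerm_bijective (n : ℕ) :
    Function.Bijective fun x : Fin (n + 1) × Equiv.Perm (Fin n) => insertPerm x.1 x.2 := by
  rw [Fintype.bijective_iff_injective_and_card]
  refine ⟨fun ⟨p, τ⟩ ⟨q, υ⟩ h => ?_, by simp [Fintype.card_perm, Nat.factorial_succ]⟩
  replace h : insertPerm p τ = insertPerm q υ := h
  obtain rfl : p = q := (insertPerm q υ).injective <| by
    rw [insertPerm_self, ← h, insertPerm_self]
  refine Prod.ext rfl (Equiv.ext fun i => Fin.succ_injective _ ?_)
  rw [← insertPerm_succAbove p τ, h, insertPerm_succAbove]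

theorem isUnshuffle_iff (b : List ℕ) {n : ℕ} (σ : Equiv.Perm (Fin n)) :
    IsUnshuffle b σ ↔ ∀ s t : Fin n, s < t →
      (∀ c, (s : ℕ) < c → c ≤ (t : ℕ) → ¬IsCut b c) → σ s < σ t := by
  simp only [IsUnshuffle, mem_scanl_iff, Nat.zero_le, true_and, Nat.sub_zero]
  refine forall₃_congr fun s t _ => ?_
  refine imp_congr_left (forall_congr' fun c => ?_)
  tauto

theorem val_succAbove {n : ℕ} (p : Fin (n + 1)) (i : Fin n) :
    (p.succAbove i : ℕ) = if (i : ℕ) < p then (i : ℕ) else i + 1 := by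
  rw [Fin.succAbove]
  split_ifs <;> simp_all [Fin.lt_def]

/-- The smallest value of a permutation increasing on blocks has to stand first in its block, and
there it imposes no condition on the other entries. This is the recursion for unshuffles. -/
theorem isUnshuffle_insertPerm {b : List ℕ} {n : ℕ} (hb : b.sum = n + 1) (p : Fin (n + 1))
    (τ : Equiv.Perm (Fin n)) :
    IsUnshuffle b (insertPerm p τ) ↔ StartsBlock b p ∧ IsUnshuffle (removeStart b p) τ := by
  have lt (i j : Fin n) : p.succAbove i < p.succAbove j ↔ i < j :=
    Fin.succAbove_lt_succAbove_iff
  constructor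
  · intro h
    rw [isUnshuffle_iff] at h
    have hp : StartsBlock b p := by
      refine (startsBlock_iff _ _).2 ⟨by omega, ?_⟩
      -- Otherwise position p - 1 lies in the same block as p, and its value would be smaller than
      -- 0.
      by_contra hc
      have hp0 : (p : ℕ) ≠ 0 := fun e => hc (e ▸ isCut_zero b)
      have := h ⟨p - 1, by omega⟩ p (by rw [Fin.lt_def]; simp only; omega)
        (fun c h₁ h₂ => by
          obtain rfl : c = p := by simp only at h₁; omega
          exact hc)
      rw [insertPerm_self] at this
      exact absurd this (Fin.not_lt_zero _)
    refine ⟨hp, (isUnshuffle_iff _ _).2 fun i j hij hc => ?_⟩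
    have := h (p.succAbove i) (p.succAbove j) ((lt i j).2 hij) (fun c h₁ h₂ hcut => ?_)
    · simpa only [insertPerm_succAbove, Fin.succ_lt_succ_iff] using this
    · rw [val_succAbove] at h₁ h₂
      rw [Fin.lt_def] at hij
      by_cases hcp : c ≤ p
      · exact hc c (by split_ifs at h₁ <;> omega) (by split_ifs at h₂ <;> omega)
          ((isCut_removeStart hp c).2 (.inl ⟨hcp, hcut⟩))
      · refine hc (c - 1) (by split_ifs at h₁ <;> omega) (by split_ifs at h₂ <;> omega)
          ((isCut_removeStart hp _).2 (.inr ⟨by omega, ?_⟩))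
        rwa [Nat.sub_add_cancel (by omega)]
  · rintro ⟨hp, h⟩
    rw [isUnshuffle_iff] at h ⊢
    intro s t hst hc
    rcases Fin.eq_self_or_eq_succAbove p s with rfl | ⟨i, rfl⟩
    · rcases Fin.eq_self_or_eq_succAbove s t with rfl | ⟨j, rfl⟩
      · exact absurd hst (lt_irrefl _)
      · rw [insertPerm_self, insertPerm_succAbove]
        exact Fin.succ_pos _
    rcases Fin.eq_self_or_eq_succAbove p t with rfl | ⟨j, rfl⟩
    · exact absurd ((startsBlock_iff _ _).1 hp).2 (hc _ hst le_rfl)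
    rw [insertPerm_succAbove, insertPerm_succAbove, Fin.succ_lt_succ_iff]
    have hij := (lt i j).1 hst
    refine h i j hij fun c h₁ h₂ hcut => ?_
    simp only [val_succAbove] at hc
    rw [Fin.lt_def] at hij
    rcases (isCut_removeStart hp c).1 hcut with ⟨h₃, h₄⟩ | ⟨h₃, h₄⟩
    · exact hc c (by split_ifs <;> omega) (by split_ifs <;> omega) h₄
    · exact hc (c + 1) (by split_ifs <;> omega) (by split_ifs <;> omega) h₄

end Unshuffle

/-! ### Sums over unshuffles as recursive splittings into blocks. -/

section UnsplitSum

variable {α M N : Type*} [AddCommGroup M] [AddCommGroup N]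

theorem split_sum (s : α → List α → ℤˣ) {κ : Type*} (t : Finset κ) (Φ : κ → List α → List α → M)
    (l : List α) :
    split s (fun A B => ∑ k ∈ t, Φ k A B) l = ∑ k ∈ t, split s (Φ k) l := by
  classical
  induction t using Finset.induction_on with
  | empty => simp [split_zero]
  | insert k t hk ih => simp only [Finset.sum_insert hk, split_add, ih]

theorem split_units_smul (s : α → List α → ℤˣ) (k : ℤˣ) (Φ : List α → List α → M) (l : List α) :
    split s (fun A B => k • Φ A B) l = k • split s Φ l :=
  (map_split s (DistribSMul.toAddMonoidHom M k) Φ l).symm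

/-- The signed sum of `Φ` over the ways to reorder a list so that its order is preserved in each of
the consecutive blocks of the sizes `b`. -/
def splitBlocks (s : α → List α → ℤˣ) : List ℕ → (List α → M) → List α → M
  | [], Φ, l => if l.length = 0 then Φ [] else 0
  | m :: b, Φ, l =>
    split s (fun A B => if A.length = m then splitBlocks s b (fun r => Φ (A ++ r)) B else 0) l

theorem splitBlocks_units_smul (s : α → List α → ℤˣ) (b : List ℕ) (k : ℤˣ) (Φ : List α → M)
    (l : List α) : splitBlocks s b (fun r => k • Φ r) l = k • splitBlocks s b Φ l := by
  induction b generalizing Φ l with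
  | nil => simp only [splitBlocks]; split_ifs <;> simp
  | cons m b ih =>
    simp only [splitBlocks, ih, ← split_units_smul]
    refine split_congr _ fun A B _ => ?_
    split_ifs <;> simp

theorem insertIdx_append_add (A r : List α) (p : ℕ) (x : α) :
    (A ++ r).insertIdx (A.length + p) x = A ++ r.insertIdx p x := by
  induction A with
  | nil => simp
  | cons a A ih =>
    rw [List.length_cons, Nat.add_right_comm, List.cons_append, List.insertIdx_succ_cons, ih]
    rfl

-- The recursion of `splitBlocks` in the list, to be matched with that of the unshuffles: the head x
-- is the first entry of the block that receives it, and its sign is the cost of passing all the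
-- entries in the earlier blocks.
open Classical in
theorem splitBlocks_cons (s : α → List α → ℤˣ) (hs₀ : ∀ x, s x [] = 1)
    (hs : ∀ x A B, s x (A ++ B) = s x A * s x B) (b : List ℕ) (Φ : List α → M) (x : α)
    (l : List α) :
    splitBlocks s b Φ (x :: l) = ∑ p ∈ Finset.range b.sum, if StartsBlock b p then
      splitBlocks s (removeStart b p) (fun r => s x (r.take p) • Φ (r.insertIdx p x)) l else 0 := by
  induction b generalizing Φ l with
  | nil => simp [splitBlocks]
  | cons m b ih =>
    rw [List.sum_cons, Finset.sum_range_add]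
    simp only [splitBlocks, split]
    congr 1
    · rcases m with _ | m
      · simp [split_zero]
      · rw [Finset.sum_range_succ', Finset.sum_eq_zero, zero_add]
        · simp [StartsBlock, removeStart, splitBlocks, hs₀]
        · intro k hk
          rw [if_neg]
          simp only [StartsBlock, Finset.mem_range] at *
          omega
    · have h (A B : List α) : (s x A • if A.length = m then
          splitBlocks s b (fun r => Φ (A ++ r)) (x :: B) else 0)
          = ∑ p ∈ Finset.range b.sum, if A.length = m then if StartsBlock b p then
            splitBlocks s (removeStart b p)
              (fun r => s x ((A ++ r).take (m + p)) • Φ ((A ++ r).insertIdx (m + p) x)) B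
            else 0 else 0 := by
        split_ifs with hA
        · subst hA
          rw [ih, Finset.smul_sum]
          refine Finset.sum_congr rfl fun p _ => ?_
          split_ifs
          · simp only [List.take_length_add_append, hs, insertIdx_append_add, mul_smul,
              splitBlocks_units_smul]
          · exact smul_zero _
        · simp
      simp only [h, split_sum]
      refine Finset.sum_congr rfl fun p _ => ?_
      by_cases hp : StartsBlock b p
      · have hp' : StartsBlock (m :: b) (m + p) := .inr ⟨by omega, by simpa using hp⟩
        have hr : removeStart (m :: b) (m + p) = m :: removeStart b p := by
          rw [removeStart, if_neg (by omega), Nat.add_sub_cancel_left]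
        rw [if_pos hp', hr]
        simp only [if_pos hp, splitBlocks]
      · have hp' : ¬StartsBlock (m :: b) (m + p) := by
          rw [StartsBlock, Nat.add_sub_cancel_left]
          have := (startsBlock_iff b p).not.1 hp
          rintro (⟨h₁, h₂⟩ | ⟨-, h⟩)
          · omega
          · exact hp h
        simp [if_neg hp', hp, split_zero]

theorem ofFn_comp_insertPerm {n : ℕ} (w : Fin (n + 1) → α) (p : Fin (n + 1))
    (τ : Equiv.Perm (Fin n)) :
    List.ofFn (w ∘ insertPerm p τ) = (List.ofFn (Fin.tail w ∘ τ)).insertIdx p (w 0) := by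
  refine List.ext_getElem (by simp [List.length_insertIdx, Nat.le_of_lt_succ p.2]) fun i h₁ h₂ => ?_
  rw [List.length_ofFn] at h₁
  rw [List.getElem_insertIdx, List.getElem_ofFn]
  rcases Fin.eq_self_or_eq_succAbove p ⟨i, h₁⟩ with h | ⟨j, h⟩
  · obtain rfl : i = p := congrArg Fin.val h
    simp [insertPerm_self]
  · have hi : i = if (j : ℕ) < p then (j : ℕ) else j + 1 :=
      (congrArg Fin.val h).trans (val_succAbove p j)
    rw [h, Function.comp_apply, insertPerm_succAbove]
    split_ifs at hi
    · simp_all [Fin.tail]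
    · simp_all [Fin.tail, show ¬ (j : ℕ) + 1 < p by omega, show ¬ (j : ℕ) + 1 = p by omega]

theorem splitBlocks_nil (s : α → List α → ℤˣ) {b : List ℕ} (hb : b.sum = 0) (Φ : List α → M) :
    splitBlocks s b Φ [] = Φ [] := by
  induction b generalizing Φ with
  | nil => rfl
  | cons m b ih =>
    rw [List.sum_cons] at hb
    simp [splitBlocks, split, show m = 0 by omega, ih (show b.sum = 0 by omega)]

/-- A signed sum over unshuffles is a signed sum over splittings into blocks. -/
theorem sum_unshuffles (s : α → List α → ℤˣ) (hs₀ : ∀ x, s x [] = 1)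
    (hs : ∀ x A B, s x (A ++ B) = s x A * s x B)
    (χ : ∀ n : ℕ, (Fin n → α) → Equiv.Perm (Fin n) → ℤˣ)
    (hχ₀ : ∀ w σ, χ 0 w σ = 1)
    (hχ : ∀ n w p τ, χ (n + 1) w (insertPerm p τ)
      = s (w 0) ((List.ofFn (Fin.tail w ∘ τ)).take p) * χ n (Fin.tail w) τ)
    {b : List ℕ} {n : ℕ} (hb : b.sum = n) (w : Fin n → α) (Φ : List α → M) :
    ∑ σ ∈ unshuffles b n, χ n w σ • Φ (List.ofFn (w ∘ σ)) = splitBlocks s b Φ (List.ofFn w) := by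
  classical
  induction n generalizing b Φ with
  | zero =>
    have : unshuffles b 0 = Finset.univ :=
      Finset.filter_true_of_mem fun σ _ s => s.elim0
    rw [this, Fintype.sum_unique, hχ₀, one_smul, List.ofFn_zero, List.ofFn_zero,
      splitBlocks_nil s hb]
  | succ n ih =>
    -- Both sides are expanded over the position p of the first entry: for permutations through
    -- `insertPerm`, for lists through `splitBlocks_cons`.
    rw [List.ofFn_succ, splitBlocks_cons s hs₀ hs, unshuffles, Finset.sum_filter,
      ← (insertPerm_bijective n).sum_comp, Fintype.sum_prod_type, hb, ← Fin.sum_univ_eq_sum_range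
        (fun p => if StartsBlock b p then splitBlocks s (removeStart b p)
          (fun r => s (w 0) (r.take p) • Φ (r.insertIdx p (w 0))) _ else 0)]
    refine Finset.sum_congr rfl fun p _ => ?_
    simp only [isUnshuffle_insertPerm hb]
    split_ifs with hp
    · rw [← ih (by have := sum_removeStart hp; omega), unshuffles, Finset.sum_filter]
      · refine Finset.sum_congr rfl fun τ _ => ?_
        simp only [hp, true_and]
        split_ifs
        · rw [ofFn_comp_insertPerm, hχ, mul_comm, mul_smul]
          rfl
        · rfl
    · simp [hp]

end UnsplitSum

/-! ### The two kinds of signs of unshuffles -/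

section Signs

variable {α M : Type*} [AddCommGroup M]

/-- Splittings into blocks with the signs of odd entries. -/
abbrev convBlocks : List ℕ → (List α → M) → List α → M :=
  splitBlocks fun _ A => (-1) ^ A.length

theorem sum_unshuffles_sign {b : List ℕ} {n : ℕ} (hb : b.sum = n) (x : Fin n → α)
    (Φ : List α → M) :
    ∑ σ ∈ unshuffles b n, Equiv.Perm.sign σ • Φ (List.ofFn (x ∘ σ))
      = convBlocks b Φ (List.ofFn x) := by
  refine sum_unshuffles _ (by simp) (by simp [pow_add]) (fun _ _ σ => Equiv.Perm.sign σ)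
    (fun _ σ => by rw [Subsingleton.elim σ 1, map_one]) (fun n w p τ => ?_) hb x Φ
  rw [sign_insertPerm, List.length_take, List.length_ofFn, min_eq_left (Nat.le_of_lt_succ p.2)]

/-- The sign for moving a homogeneous element past a list of homogeneous elements. -/
def koszulPass {E : Type*} (x : ℤ × E) (A : List (ℤ × E)) : ℤˣ :=
  (A.map fun y => -Int.negOnePow (x.1 * y.1)).prod

/-- Since the value 0 stands at p, the inversions involving p are those with the positions before
it; each contributes -1 through the signature and a Koszul factor. -/
theorem koszulSign_insertPerm {n : ℕ} (d : Fin (n + 1) → ℤ) (p : Fin (n + 1))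
    (τ : Equiv.Perm (Fin n)) :
    koszulSign d (insertPerm p τ)
      = (∏ j : Fin n, if (j : ℕ) < p then -Int.negOnePow (d 0 * Fin.tail d (τ j)) else 1)
        * koszulSign (Fin.tail d) τ := by
  have hlt (j : Fin n) : p.succAbove j < p ↔ (j : ℕ) < p := by
    rw [Fin.lt_def, val_succAbove]; split_ifs <;> omega
  have hp : (-1 : ℤˣ) ^ (p : ℕ) = ∏ j : Fin n, if (j : ℕ) < p then -1 else 1 := by
    rw [← Finset.prod_filter, Finset.prod_const]
    congr 1
    have := Fin.card_filter_val_lt (n := n) (m := p)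
    rw [this]
    omega
  rw [koszulSign, koszulSign, sign_insertPerm, Fin.prod_univ_succAbove _ p,
    Fin.prod_univ_succAbove _ p, hp]
  simp only [Fin.prod_univ_succAbove _ p, insertPerm_self, insertPerm_succAbove,
    Fin.not_lt_zero, and_false, if_false, Finset.prod_const_one, one_mul, lt_irrefl,
    hlt, Fin.succ_pos, and_true, Finset.prod_mul_distrib, Fin.succ_lt_succ_iff,
    Fin.succAbove_lt_succAbove_iff]
  have hd : (∏ j : Fin n, if (j : ℕ) < p then -Int.negOnePow (d 0 * Fin.tail d (τ j)) else 1)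
      = (∏ j : Fin n, if (j : ℕ) < p then -1 else 1)
        * ∏ j : Fin n, if (j : ℕ) < p then Int.negOnePow (d (τ j).succ * d 0) else 1 := by
    rw [← Finset.prod_mul_distrib]
    refine Finset.prod_congr rfl fun j _ => ?_
    split_ifs
    · rw [mul_comm (d 0), neg_one_mul]; rfl
    · rw [mul_one]
  rw [hd, mul_assoc, mul_assoc, mul_left_comm (Equiv.Perm.sign τ)]
  rfl

theorem sum_unshuffles_koszulSign {E : Type*} {b : List ℕ} {n : ℕ} (hb : b.sum = n)
    (d : Fin n → ℤ) (x : Fin n → E) (Φ : List (ℤ × E) → M) :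
    ∑ σ ∈ unshuffles b n, koszulSign d σ • Φ (List.ofFn fun i => (d (σ i), x (σ i)))
      = splitBlocks koszulPass b Φ (List.ofFn fun i => (d i, x i)) := by
  refine sum_unshuffles koszulPass (by simp [koszulPass]) (by simp [koszulPass])
    (fun _ w σ => koszulSign (fun i => (w i).1) σ) (fun w σ => ?_) (fun n w p τ => ?_) hb
    (fun i => (d i, x i)) Φ
  · simp [koszulSign, Subsingleton.elim σ 1]
  · rw [koszulSign_insertPerm, koszulPass, List.map_take, List.map_ofFn, List.prod_take_ofFn,
      Finset.prod_filter]
    rfl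

theorem conv_ite_nil (Φ : List α → M) (l : List α) :
    conv (fun A B => if B.length = 0 then Φ A else 0) l = Φ l := by
  induction l generalizing Φ with
  | nil => rfl
  | cons x l ih => rw [conv_cons, ih fun A => Φ (x :: A)]; simp [conv_zero]

theorem convBlocks_singleton (m : ℕ) (Φ : List α → M) (l : List α) :
    convBlocks [m] Φ l = if l.length = m then Φ l else 0 := by
  rw [← conv_ite_nil fun l : List α => if l.length = m then Φ l else 0]
  refine conv_congr fun A B _ => ?_
  simp only [splitBlocks]
  split_ifs with h₁ h₂
  · simp
  · rfl
  · rfl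
  · rfl

theorem convBlocks_cons (m : ℕ) (b : List ℕ) (Φ : List α → M) (l : List α) :
    convBlocks (m :: b) Φ l
      = conv (fun A B => if A.length = m then convBlocks b (fun r => Φ (A ++ r)) B else 0) l :=
  rfl

theorem ofFn_block {n : ℕ} (x : Fin n → α) (k m : ℕ) (h : k + m ≤ n) :
    List.ofFn (block x k m h) = ((List.ofFn x).drop k).take m := by
  refine List.ext_getElem (by simp; omega) fun i h₁ h₂ => ?_
  simp [block]

theorem listOne_ofFn {W : Type*} [AddCommGroup W] [Module ℂ W] {n : ℕ} (x : Fin n → W) (k : ℕ)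
    (h : k < n) : x ⟨k, h⟩ = listOne (((List.ofFn x).drop k).take 1) := by
  rw [← ofFn_block x k 1 h, List.ofFn_succ, List.ofFn_zero]
  rfl

theorem ofFn_comp_cast {m n : ℕ} (h : m = n) (x : Fin n → α) :
    List.ofFn (x ∘ Fin.cast h) = List.ofFn x := by
  subst h; rfl

end Signs

/-! ### Operations on tuples and on lists -/

section Represents

variable {W : Type*} [AddCommGroup W] [Module ℂ W]

/-- The function `f` of a list is the operation `F` on lists of length `p`. -/
def Represents {p : ℕ} (f : List W → Module.End ℂ W) (F : Operation W p) : Prop :=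
  ∀ x y, F x y = f (List.ofFn x) y

variable {p q : ℕ} {f f' : List W → Module.End ℂ W} {P : Operation W p} {Q : Operation W q}

/-- The unshuffles with blocks q, 1, p - 1 are two nested splittings, the inner one being the
antisymmetrization in `outer`. The block sizes need not be imposed, as the supports and `listOne`
discard the other splittings. -/
theorem represents_diamondSkew (hf : IsOp p f) (hf' : IsOp q f') (hP : Represents f P)
    (hQ : Represents f' Q) (x : Fin (p + q) → W) (y : W) :
    diamondSkew P Q x y = conv (fun A B => f (outer f' A :: B) y) (List.ofFn x) := by
  rcases p with _ | p
  · rw [diamondSkew]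
    refine (split_eq_zero _ fun A B _ => ?_).symm
    rw [hf.supp _ (by simp; omega), LinearMap.zero_apply]
  rw [diamondSkew]
  have h (A B : List W) : f (outer f' A :: B) y
      = conv (fun C D => f (f' C (listOne D) :: B) y) A := by
    rw [outer, ← hf.multi.head_apply, map_conv]
    exact map_conv (LinearMap.applyₗ y) _ A
  have key := sum_unshuffles_sign (b := [q, 1, p]) (n := p + 1 + q) (by simp; omega) x
    fun l => f (f' (l.take q) (listOne ((l.drop q).take 1)) :: (l.drop (q + 1)).take p) y
  refine Eq.trans (Finset.sum_congr rfl fun σ _ => ?_) (key.trans ?_)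
  · rw [hP _ _, hQ _ _, List.ofFn_cons]
    simp only [ofFn_block, List.drop_zero]
    rw [← listOne_ofFn (x ∘ σ) q (by omega)]
    rfl
  · simp only [h]
    rw [← conv_assoc, convBlocks_cons]
    refine conv_congr fun A E hE => ?_
    split_ifs with hA
    · rw [convBlocks_cons]
      refine conv_congr fun C D hD => ?_
      split_ifs with hC
      · rw [convBlocks_singleton, List.length_ofFn] at *
        rw [if_pos (by omega)]
        simp [List.drop_append, hA, hC,
          List.drop_eq_nil_of_le (show A.length ≤ q + 1 by omega),
          List.take_of_length_le (show D.length ≤ p by omega)]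
      · rw [show listOne C = 0 from ?_, map_zero, ← hf.multi.head_apply, map_zero]
        · rfl
        · rcases C with _ | ⟨c, _ | ⟨c', C⟩⟩ <;> simp [listOne] at *
    · rw [hf'.supp A (by simpa using hA)]
      refine (split_eq_zero _ fun C D _ => ?_).symm
      rw [LinearMap.zero_apply, ← hf.multi.head_apply, map_zero]
      rfl

theorem represents_diamondLast (hf : IsOp p f) (hP : Represents f P)
    (hQ : Represents f' Q) (x : Fin (p + q) → W) (y : W) :
    diamondLast P Q x y = conv (fun A B => f A (f' B y)) (List.ofFn x) := by
  have key := sum_unshuffles_sign (b := [p, q]) (n := p + q) (by simp) x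
    fun l => f (l.take p) (f' ((l.drop p).take q) y)
  refine Eq.trans (Finset.sum_congr rfl fun σ _ => ?_) (key.trans ?_)
  · rw [hP _ _, hQ _ _]
    simp only [ofFn_block, List.drop_zero]
  · rw [convBlocks_cons]
    refine conv_congr fun A B h => ?_
    rw [List.length_ofFn] at h
    split_ifs with hA
    · rw [convBlocks_singleton, if_pos (by omega)]
      simp [hA, List.take_of_length_le (show B.length ≤ q by omega)]
    · rw [hf.supp A (by simpa using hA)]
      rfl

/-- The sign (-1)^{pq} in front of the second sum is the cost of moving the arguments of Q before
those of P, so `circ` needs no sign. -/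
theorem represents_diamond (hf : IsOp p f) (hf' : IsOp q f') (hP : Represents f P)
    (hQ : Represents f' Q) : Represents (f ⋄ f') (diamond P Q) := by
  intro x y
  rw [diamond, represents_diamondSkew hf hf' hP hQ, represents_diamondLast hf hP hQ,
    conv_comm fun A B => f A (f' B y),
    ← conv_zsmul, ← conv_add, circ]
  refine Eq.trans ?_ (map_conv (LinearMap.applyₗ (R := ℂ) y) _ _).symm
  refine conv_congr fun A B h => ?_
  rw [LinearMap.applyₗ_apply_apply, LinearMap.add_apply, Module.End.mul_apply]
  congr 1
  by_cases hA : (A.length : ℤ) = q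
  · rw [List.length_ofFn] at h
    rw [show A.length = q by omega, show B.length = p by omega, mul_comm q, ← mul_smul, ← mul_pow]
    simp
  · rw [hf'.supp A hA]
    simp

theorem represents_mnBracket (hf : IsOp p f) (hf' : IsOp q f') (hP : Represents f P)
    (hQ : Represents f' Q) : Represents (listBracket p q f f') (mnBracket P Q) := by
  intro x y
  rw [mnBracket, represents_diamond hf hf' hP hQ, represents_diamond hf' hf hQ hP, ofFn_comp_cast,
    neg_one_pow_eq_paritySign]
  simp [listBracket]

end Represents

/-! ### Operations on `g × V` with arguments in `V` and values in `g` -/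

section Abelian

variable {g V : Type*} [AddCommGroup g] [Module ℂ g] [AddCommGroup V] [Module ℂ V]

/-- The operation takes its values in `g`. -/
def MapsToG (f : List (g × V) → Module.End ℂ (g × V)) : Prop := ∀ l y, (f l y).2 = 0

/-- The operation vanishes as soon as one of its arguments is in `g`. -/
structure KillsG (f : List (g × V) → Module.End ℂ (g × V)) : Prop where
  head : ∀ x l, x.2 = 0 → f (x :: l) = 0
  last : ∀ l y, y.2 = 0 → f l y = 0

/-- The operations `∧^p V ⊗ V → g`, as operations on `g × V`. -/
structure IsCochainOp (p : ℤ) (f : List (g × V) → Module.End ℂ (g × V)) : Prop where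
  isOp : IsOp p f
  maps : MapsToG f
  kills : KillsG f

variable {f P Q R T : List (g × V) → Module.End ℂ (g × V)} {p q r : ℤ}

variable (g V) in
/-- The projection onto `g`, as an operation of degree `0`. -/
def projG : List (g × V) → Module.End ℂ (g × V)
  | [] => LinearMap.inl ℂ g V ∘ₗ LinearMap.fst ℂ g V
  | _ :: _ => 0

theorem isOp_projG : IsOp 0 (projG g V) where
  multi := ⟨fun l x y l' => by cases l <;> simp [projG], by simp [projG], by simp [projG]⟩
  supp l hl := by
    cases l with
    | nil => simp at hl
    | cons x l => rfl

theorem mapsToG_projG : MapsToG (projG g V) := by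
  intro l y
  cases l <;> simp [projG]

theorem MapsToG.outer (hP : MapsToG P) (l : List (g × V)) : (outer P l).2 = 0 := by
  refine (map_conv (LinearMap.snd ℂ g V) _ l).trans (split_eq_zero _ fun A B _ => ?_)
  exact hP _ _

theorem MapsToG.circ (hP : MapsToG P) (Q : List (g × V) → Module.End ℂ (g × V)) :
    MapsToG (P ⋄ Q) := by
  intro l y
  refine (map_conv (LinearMap.snd ℂ g V ∘ₗ LinearMap.applyₗ y) _ l).trans
    (split_eq_zero _ fun A B _ => ?_)
  simp [hP _ _]

/-- Every term feeds a value in g to an operation that vanishes on g. This is why cochains commute.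
-/
theorem KillsG.circ_eq_zero (hP : KillsG P) (hQ : MapsToG Q) : P ⋄ Q = 0 := by
  funext l
  refine split_eq_zero _ fun A B _ => ?_
  rw [hP.head _ _ (hQ.outer A), zero_add]
  exact LinearMap.ext fun y => hP.last _ _ (hQ _ _)

theorem conv_cons_eq_zero {α M : Type*} [AddCommGroup M] {Φ : List α → List α → M} {x : α}
    (h₁ : ∀ A B, Φ (x :: A) B = 0) (h₂ : ∀ A B, Φ A (x :: B) = 0) (l : List α) :
    conv Φ (x :: l) = 0 := by
  simp [conv_cons, h₁, h₂, conv_zero]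

theorem KillsG.outer (hP : KillsG P) {x : g × V} (hx : x.2 = 0)
    (l : List (g × V)) : outer P (x :: l) = 0 := by
  rw [outer_cons, hP.last _ _ hx, smul_zero, add_zero]
  refine split_eq_zero _ fun A B _ => ?_
  rw [hP.head _ _ hx]; rfl

theorem conv_ite_nil_left {α M : Type*} [AddCommGroup M] (Φ : List α → M) (l : List α) :
    conv (fun A B => if A.length = 0 then Φ B else 0) l = Φ l := by
  rw [conv_comm, ← conv_ite_nil Φ]
  refine conv_congr fun A B _ => ?_
  split_ifs with h <;> simp [h]

/-- A Leibniz rule: inserting the projection onto g acts on one argument at a time. On arguments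
each in g or in V it therefore multiplies by the number of those in g. -/
theorem circ_projG_cons (hf : IsMulti f) (x : g × V) (l : List (g × V)) :
    (f ⋄ projG g V) (x :: l) = f ((x.1, 0) :: l) + ((fun l => f (x :: l)) ⋄ projG g V) l := by
  have h₁ (x : g × V) : outer (projG g V) [x] = (x.1, 0) := by
    simp [outer, conv_cons, conv_nil, listOne, projG]
  have h₂ (A : List (g × V)) (hA : A.length ≠ 1) : outer (projG g V) A = 0 :=
    outer_supp isOp_projG (by simpa using hA)
  have h₀ (B : List (g × V)) : f (x :: 0 :: B) = 0 := by
    rw [← (hf.cons x).head_apply, map_zero]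
  rw [circ, conv_cons]
  congr 1
  · rw [← conv_ite_nil_left (fun l => f ((x.1, 0) :: l))]
    refine conv_congr fun A B _ => ?_
    rcases A with _ | ⟨a, A⟩
    · simp [h₁, projG]
    · rw [h₂ _ (by simp), ← hf.head_apply, map_zero]
      simp [projG]
  · refine conv_congr fun A B _ => ?_
    rcases A with _ | ⟨a, _ | ⟨b, A⟩⟩
    · rw [h₂ [] (by simp), ← hf.head_apply, map_zero]
      simp [h₀]
    · rw [h₁, hf.swap_head]
      simp [projG]
    · rw [h₂ _ (by simp), ← hf.head_apply, map_zero]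
      simp [h₀, projG]

theorem eq_split_head (hf : IsMulti f) (x : g × V) (l : List (g × V)) :
    f (x :: l) = f ((x.1, 0) :: l) + f ((0, x.2) :: l) := by
  rw [← hf.add]; simp

theorem circ_projG_nil (f : List (g × V) → Module.End ℂ (g × V)) (hf : IsMulti f) (y : g × V) :
    (f ⋄ projG g V) [] y = f [] (y.1, 0) := by
  have h : outer (projG g V) [] = 0 := outer_supp isOp_projG (by simp)
  rw [circ, conv_nil, h, ← hf.head_apply, map_zero]
  simp [projG]

/-- Insertion of the projection has only nonnegative integer eigenvalues, so -(k + 1) is not one of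
them. In the induction, a head in g raises k by one and a head in V leaves it unchanged. -/
theorem eq_zero_of_circ_projG (hf : IsMulti f) (k : ℕ)
    (h : ∀ l, (f ⋄ projG g V) l + (k + 1 : ℂ) • f l = 0) (l : List (g × V)) : f l = 0 := by
  induction l generalizing f k with
  | nil =>
    have hk (n : ℕ) : (n + 1 : ℂ) ≠ 0 := Nat.cast_add_one_ne_zero n
    have h₁ (y : g × V) : f [] (y.1, 0) + (k + 1 : ℂ) • f [] y = 0 := by
      rw [← circ_projG_nil f hf]
      exact DFunLike.congr_fun (h []) y
    have h₂ (y : g × V) : f [] (y.1, 0) = 0 := by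
      have := h₁ (y.1, 0)
      have e : ((k + 1 : ℕ) + 1 : ℂ) • f [] (y.1, 0) = 0 := by
        rw [← this]; push_cast; module
      exact (smul_eq_zero.1 e).resolve_left (hk _)
    refine LinearMap.ext fun y => ?_
    have := h₁ y
    rw [h₂, zero_add] at this
    exact (smul_eq_zero.1 this).resolve_left (hk _)
  | cons x l ih =>
    rw [eq_split_head hf, ih (hf.cons (x.1, 0)) (k + 1), ih (hf.cons (0, x.2)) k, add_zero]
    · intro l
      have := h ((0, x.2) :: l)
      rw [circ_projG_cons hf, Prod.mk_zero_zero, ← hf.head_apply, map_zero, zero_add] at this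
      exact this
    · intro l
      have := h ((x.1, 0) :: l)
      rw [circ_projG_cons hf] at this
      rw [← this]
      push_cast
      module

/-- An alternating multilinear operation that is killed by the projection onto `g` vanishes as
soon as one of its arguments is in `g`. -/
theorem killsG_of_circ_projG (hf : IsMulti f) (h : f ⋄ projG g V = 0) : KillsG f := by
  -- With x in g fixed, the remaining operation would be an eigenvector for -1, whence the choice k
  -- = 0.
  have head (f : List (g × V) → Module.End ℂ (g × V)) (hf : IsMulti f)
      (h : ∀ l, (f ⋄ projG g V) l = 0) (x l) (hx : x.2 = 0) : f (x :: l) = 0 := by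
    refine eq_zero_of_circ_projG (hf.cons x) 0 (fun l => ?_) l
    have := h (x :: l)
    rw [circ_projG_cons hf, show (x.1, (0 : V)) = x from Prod.ext rfl hx.symm] at this
    rw [← this]
    push_cast
    module
  refine ⟨head f hf (congrFun h), fun l y hy => ?_⟩
  replace h := congrFun h
  induction l generalizing f with
  | nil =>
    have := DFunLike.congr_fun (h []) y
    rwa [circ_projG_nil f hf, show (y.1, (0 : V)) = y from Prod.ext rfl hy.symm] at this
  | cons x l ih =>
    rw [eq_split_head hf, head f hf h _ _ rfl, zero_add]
    refine ih (hf.cons (0, x.2)) fun l => ?_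
    have := h ((0, x.2) :: l)
    rwa [circ_projG_cons hf, Prod.mk_zero_zero, ← hf.head_apply, map_zero, zero_add] at this

theorem IsCochainOp.circ_eq_zero (hP : IsCochainOp p P) (hQ : MapsToG Q) : P ⋄ Q = 0 :=
  hP.kills.circ_eq_zero hQ

theorem IsCochainOp.bracket_eq_zero (hP : IsCochainOp p P) (hQ : IsCochainOp q Q) (a b : ℤ) :
    listBracket a b P Q = 0 := by
  rw [listBracket, hP.circ_eq_zero hQ.maps, hQ.circ_eq_zero hP.maps, smul_zero, sub_zero]

/-- In the pre-Lie identity the associator with P and S exchanged is zero, because R vanishes on the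
values of S and of S ⋄ P. -/
theorem circ_circ_of_killsG (hR : KillsG R) (hR' : IsOp r R) {s : ℤ}
    {S : List (g × V) → Module.End ℂ (g × V)} (hP : IsOp p P) (hS : IsOp s S) (hS' : MapsToG S) :
    R ⋄ P ⋄ S = R ⋄ (P ⋄ S) := by
  have h := circ_circ_comm hR'.multi hS hP
  rw [hR.circ_eq_zero hS', hR.circ_eq_zero (hS'.circ P), zero_circ, sub_zero, smul_zero] at h
  exact sub_eq_zero.1 h

/-- By the criterion with the projection, it is enough that R ⋄ (P ⋄ proj) = 0; no argument has to
be followed through the unshuffles. -/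
theorem KillsG.circ (hR : KillsG R) (hR' : IsOp r R) (hP : IsOp p P)
    (h : MapsToG (P ⋄ projG g V)) : KillsG (R ⋄ P) := by
  refine killsG_of_circ_projG (hR'.multi.circ hP.multi) ?_
  rw [circ_circ_of_killsG hR hR' hP isOp_projG mapsToG_projG, hR.circ_eq_zero h]

theorem IsCochainOp.circ (hR : IsCochainOp r R) (hP : IsOp p P)
    (h : MapsToG (P ⋄ projG g V)) : IsCochainOp (r + p) (R ⋄ P) :=
  ⟨hR.isOp.circ hP, hR.maps.circ P, hR.kills.circ hR.isOp hP h⟩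

theorem MapsToG.add (hP : MapsToG P) (hQ : MapsToG Q) : MapsToG (P + Q) := fun l y => by
  simp [hP l y, hQ l y]

theorem MapsToG.zsmul (hP : MapsToG P) (k : ℤ) : MapsToG (k • P) := fun l y => by
  simp [hP l y]

theorem IsCochainOp.add (hP : IsCochainOp p P) (hQ : IsCochainOp p Q) : IsCochainOp p (P + Q) :=
  ⟨hP.isOp.add hQ.isOp, hP.maps.add hQ.maps,
    fun x l hx => by simp [hP.kills.head x l hx, hQ.kills.head x l hx],
    fun l y hy => by simp [hP.kills.last l y hy, hQ.kills.last l y hy]⟩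

theorem IsCochainOp.zsmul (hP : IsCochainOp p P) (k : ℤ) : IsCochainOp p (k • P) :=
  ⟨hP.isOp.zsmul k, hP.maps.zsmul k, fun x l hx => by simp [hP.kills.head x l hx],
    fun l y hy => by simp [hP.kills.last l y hy]⟩

theorem IsCochainOp.neg (hP : IsCochainOp p P) : IsCochainOp p (-P) := by
  simpa using hP.zsmul (-1)

theorem IsCochainOp.sub (hP : IsCochainOp p P) (hQ : IsCochainOp p Q) : IsCochainOp p (P - Q) := by
  rw [sub_eq_add_neg]; exact hP.add hQ.neg

/-- Inserting two operations with values in `g` in an operation of degree `1`. -/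
theorem circ_circ_apply (hT : IsOp 1 T) (hP : IsCochainOp p P) (hQ : MapsToG Q)
    (l : List (g × V)) :
    (T ⋄ P ⋄ Q) l = conv (fun A B => paritySign p • (T [outer Q A] * P B)
      + T [outer P B] * Q A) l := by
  rw [circ_circ hT.multi, hP.circ_eq_zero hQ, circ_zero hT.multi, zero_add, circTwo]
  refine conv_congr fun A B _ => ?_
  rw [← conv_ite_nil fun B => paritySign p • (T [outer Q A] * P B) + T [outer P B] * Q A]
  refine conv_congr fun C D _ => ?_
  -- T has a single skew argument, so one of P, Q goes there and the other in the last argument, and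
  -- no entry D is left over.
  have h₁ : T (outer Q A :: outer P C :: D) = 0 := hT.supp _ (by simp; omega)
  rw [h₁, sub_zero]
  split_ifs with hD
  · obtain rfl := List.length_eq_zero_iff.1 hD
    by_cases hC : (C.length : ℤ) = p
    · rw [neg_one_pow_eq_paritySign, hC]
    · simp [hP.isOp.supp C hC]
  · rw [hT.supp (_ :: D) (by simpa using hD), hT.supp (_ :: D) (by simpa using hD)]
    simp

/-- Both arguments of T are occupied, so every remaining argument is one of P or Q, which ignore g.
Nothing is required of T beyond its degree. -/
theorem killsG_circ_circ (hT : IsOp 1 T) (hP : IsCochainOp p P) (hQ : IsCochainOp q Q) :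
    KillsG (T ⋄ P ⋄ Q) := by
  have h₀ : T [0] = 0 := by rw [← hT.multi.head_apply, map_zero]
  constructor
  · intro x l hx
    rw [circ_circ_apply hT hP hQ.maps]
    refine conv_cons_eq_zero (fun A B => ?_) (fun A B => ?_) l
    · simp [hQ.kills.outer hx, hQ.kills.head _ _ hx, h₀]
    · simp [hP.kills.outer hx, hP.kills.head _ _ hx, h₀]
  · intro l y hy
    rw [circ_circ_apply hT hP hQ.maps]
    refine (map_conv (LinearMap.applyₗ (R := ℂ) y) _ _).trans (split_eq_zero _ fun A B _ => ?_)
    simp [hQ.kills.last _ _ hy, hP.kills.last _ _ hy]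

/-- The double bracket of an operation with two cochains. -/
theorem bracket_bracket (hT : IsOp 1 T) (hP : IsCochainOp p P) (hQ : IsCochainOp q Q) :
    listBracket (1 + p) q (listBracket 1 p T P) Q
      = T ⋄ P ⋄ Q - paritySign p • (P ⋄ (T ⋄ Q)) - paritySign ((1 + p) * q) • (Q ⋄ (T ⋄ P)) := by
  rw [listBracket, listBracket, one_mul, sub_circ, zsmul_circ,
    circ_circ_of_killsG hP.kills hP.isOp hT hQ.isOp hQ.maps, circ_sub hQ.isOp.multi,
    circ_zsmul hQ.isOp.multi, hQ.circ_eq_zero (hP.maps.circ T), smul_zero, sub_zero]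

/-- The triple bracket of an operation with three cochains. -/
theorem bracket_bracket_bracket (hT : IsOp 1 T) (hP : IsCochainOp p P) (hQ : IsCochainOp q Q)
    (hR : IsCochainOp r R) :
    listBracket (1 + p + q) r (listBracket (1 + p) q (listBracket 1 p T P) Q) R
      = -(paritySign p • (P ⋄ (T ⋄ Q ⋄ R)) + paritySign ((1 + p) * q) • (Q ⋄ (T ⋄ P ⋄ R))
        + paritySign ((1 + p + q) * r) • (R ⋄ (T ⋄ P ⋄ Q))) := by
  rw [bracket_bracket hT hP hQ, listBracket, sub_circ, sub_circ, zsmul_circ, zsmul_circ,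
    (killsG_circ_circ hT hP hQ).circ_eq_zero hR.maps,
    circ_circ_of_killsG hP.kills hP.isOp (hT.circ hQ.isOp) hR.isOp hR.maps,
    circ_circ_of_killsG hQ.kills hQ.isOp (hT.circ hP.isOp) hR.isOp hR.maps,
    circ_sub hR.isOp.multi, circ_sub hR.isOp.multi, circ_zsmul hR.isOp.multi,
    circ_zsmul hR.isOp.multi, hR.circ_eq_zero (hP.maps.circ _), hR.circ_eq_zero (hQ.maps.circ _)]
  module

/-- The operation preserves `g`. -/
def PreservesG (T : List (g × V) → Module.End ℂ (g × V)) : Prop :=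
  ∀ x y, x.2 = 0 → y.2 = 0 → (T [x] y).2 = 0

theorem mapsToG_circ_circ (hT : IsOp 1 T) (hT' : PreservesG T) (hP : IsCochainOp p P)
    (hQ : MapsToG Q) : MapsToG (T ⋄ P ⋄ Q) := by
  intro l y
  rw [circ_circ_apply hT hP hQ]
  refine (map_conv (LinearMap.snd ℂ g V ∘ₗ LinearMap.applyₗ y) _ l).trans
    (split_eq_zero _ fun A B _ => ?_)
  simp [hT' _ _ (hQ.outer A) (hP.maps B y), hT' _ _ (hP.maps.outer B) (hQ A y)]

/-- That T preserves g is used twice: for the values of T ⋄ P ⋄ Q, and, with the projection in place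
of a cochain, to see that P ⋄ (T ⋄ Q) and Q ⋄ (T ⋄ P) ignore g. -/
theorem isCochainOp_bracket (hT : IsOp 1 T) (hT' : PreservesG T) (hP : IsCochainOp p P)
    (hQ : IsCochainOp q Q) :
    IsCochainOp (1 + p + q) (listBracket (1 + p) q (listBracket 1 p T P) Q) := by
  rw [bracket_bracket hT hP hQ]
  refine (IsCochainOp.sub ⟨(hT.circ hP.isOp).circ hQ.isOp, mapsToG_circ_circ hT hT' hP hQ.maps,
    killsG_circ_circ hT hP hQ⟩ (IsCochainOp.zsmul ?_ _)).sub (IsCochainOp.zsmul ?_ _)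
  · rw [add_comm 1 p, add_assoc]
    exact hP.circ (hT.circ hQ.isOp) (mapsToG_circ_circ hT hT' hQ mapsToG_projG)
  · rw [add_comm]
    exact hQ.circ (hT.circ hP.isOp) (mapsToG_circ_circ hT hT' hP mapsToG_projG)

theorem isCochainOp_circ_circ_circ (hT : IsOp 1 T) (hP : IsCochainOp p P) (hQ : IsCochainOp q Q)
    (hR : IsCochainOp r R) : IsCochainOp (p + (1 + q + r)) (P ⋄ (T ⋄ Q ⋄ R)) := by
  refine hP.circ ((hT.circ hQ.isOp).circ hR.isOp) ?_
  rw [(killsG_circ_circ hT hQ hR).circ_eq_zero mapsToG_projG]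
  exact fun _ _ => rfl

/-- Each surviving term has a cochain on the outside, hence values in g, and an inner operation that
already ignores g. So T need not preserve g, which is what the weight requires. -/
theorem isCochainOp_bracket_bracket (hT : IsOp 1 T) (hP : IsCochainOp p P)
    (hQ : IsCochainOp q Q) (hR : IsCochainOp r R) :
    IsCochainOp (1 + p + q + r)
      (listBracket (1 + p + q) r (listBracket (1 + p) q (listBracket 1 p T P) Q) R) := by
  rw [bracket_bracket_bracket hT hP hQ hR]
  have h₁ := isCochainOp_circ_circ_circ hT hP hQ hR
  have h₂ := isCochainOp_circ_circ_circ hT hQ hP hR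
  have h₃ := isCochainOp_circ_circ_circ hT hR hP hQ
  rw [show p + (1 + q + r) = 1 + p + q + r by ring] at h₁
  rw [show q + (1 + p + r) = 1 + p + q + r by ring] at h₂
  rw [show r + (1 + p + q) = 1 + p + q + r by ring] at h₃
  exact (((h₁.zsmul _).add (h₂.zsmul _)).add (h₃.zsmul _)).neg

end Abelian

/-! ### Derived brackets and their higher Jacobi identities -/

section Derived

variable {W : Type*} [AddCommGroup W] [Module ℂ W]

/-- The iterated bracket `[… [[T, P₁], P₂], …]`. -/
def iterBracket (x : ℤ) (T : List W → Module.End ℂ W) :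
    List (ℤ × (List W → Module.End ℂ W)) → (List W → Module.End ℂ W)
  | [] => T
  | (p, P) :: L => iterBracket (x + p) (listBracket x p T P) L

/-- The expansion of the iterated bracket of `[S, T]` by the Leibniz rule. -/
def leibnizSum (x y : ℤ) (S T : List W → Module.End ℂ W) :
    List (ℤ × (List W → Module.End ℂ W)) → (List W → Module.End ℂ W)
  | [] => listBracket x y S T
  | (p, P) :: L => leibnizSum x (y + p) S (listBracket y p T P) L
      + paritySign (y * p) • leibnizSum (x + p) y (listBracket x p S P) T L

variable {S T P Q R : List W → Module.End ℂ W} {x y p q r : ℤ}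

theorem listBracket_zero_left (a b : ℤ) (hP : IsMulti P) : listBracket a b 0 P = 0 := by
  simp [listBracket, zero_circ, circ_zero hP]

theorem listBracket_zero_right (a b : ℤ) (hP : IsMulti P) : listBracket a b P 0 = 0 := by
  simp [listBracket, zero_circ, circ_zero hP]

theorem listBracket_add_left (a b : ℤ) (hP : IsMulti P) (S T : List W → Module.End ℂ W) :
    listBracket a b (S + T) P = listBracket a b S P + listBracket a b T P := by
  simp only [listBracket, add_circ, circ_add hP, smul_add]; abel

theorem listBracket_zsmul_left (a b k : ℤ) (hP : IsMulti P) (S : List W → Module.End ℂ W) :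
    listBracket a b (k • S) P = k • listBracket a b S P := by
  simp only [listBracket, zsmul_circ, circ_zsmul hP, smul_sub, smul_comm k]

theorem listBracket_zsmul_right (a b k : ℤ) (hP : IsMulti P) (S : List W → Module.End ℂ W) :
    listBracket a b P (k • S) = k • listBracket a b P S := by
  simp only [listBracket, zsmul_circ, circ_zsmul hP, smul_sub, smul_comm k]

theorem iterBracket_zero (L : List (ℤ × (List W → Module.End ℂ W)))
    (hL : ∀ u ∈ L, IsOp u.1 u.2) : iterBracket x 0 L = 0 := by
  induction L generalizing x with
  | nil => rfl
  | cons u L ih =>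
    rw [iterBracket, listBracket_zero_left _ _ (hL u (by simp)).multi]
    exact ih fun v hv => hL v (by simp [hv])

theorem iterBracket_add (L : List (ℤ × (List W → Module.End ℂ W)))
    (hL : ∀ u ∈ L, IsOp u.1 u.2) (S T : List W → Module.End ℂ W) :
    iterBracket x (S + T) L = iterBracket x S L + iterBracket x T L := by
  induction L generalizing x S T with
  | nil => rfl
  | cons u L ih =>
    simp only [iterBracket, listBracket_add_left _ _ (hL u (by simp)).multi]
    exact ih (fun v hv => hL v (by simp [hv])) _ _

theorem iterBracket_zsmul (L : List (ℤ × (List W → Module.End ℂ W)))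
    (hL : ∀ u ∈ L, IsOp u.1 u.2) (k : ℤ) (S : List W → Module.End ℂ W) :
    iterBracket x (k • S) L = k • iterBracket x S L := by
  induction L generalizing x S with
  | nil => rfl
  | cons u L ih =>
    simp only [iterBracket, listBracket_zsmul_left _ _ _ (hL u (by simp)).multi]
    exact ih (fun v hv => hL v (by simp [hv])) _

theorem iterBracket_listBracket (hS : IsOp x S) (hT : IsOp y T)
    (L : List (ℤ × (List W → Module.End ℂ W))) (hL : ∀ u ∈ L, IsOp u.1 u.2) :
    iterBracket (x + y) (listBracket x y S T) L = leibnizSum x y S T L := by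
  induction L generalizing x y S T with
  | nil => rfl
  | cons u L ih =>
    obtain ⟨p, P⟩ := u
    have hP : IsOp p P := hL (p, P) (by simp)
    have hL' : ∀ u ∈ L, IsOp u.1 u.2 := fun v hv => hL v (by simp [hv])
    rw [iterBracket, listBracket_jacobi hS hT hP, iterBracket_add L hL', iterBracket_zsmul L hL',
      leibnizSum, ← ih hS (hT.bracket hP) hL', ← ih (hS.bracket hP) hT hL',
      show x + (y + p) = x + y + p by ring, show x + p + y = x + y + p by ring]

theorem leibnizSum_eq_zero (hS : IsOp x S) (hT : IsOp y T) (h : listBracket x y S T = 0)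
    (L : List (ℤ × (List W → Module.End ℂ W))) (hL : ∀ u ∈ L, IsOp u.1 u.2) :
    leibnizSum x y S T L = 0 := by
  rw [← iterBracket_listBracket hS hT L hL, h, iterBracket_zero L hL]

/-- Bracketing with commuting operations. -/
theorem listBracket_right_comm (hT : IsOp x T) (hP : IsOp p P) (hQ : IsOp q Q)
    (h : listBracket p q P Q = 0) :
    listBracket (x + p) q (listBracket x p T P) Q
      = paritySign (p * q) • listBracket (x + q) p (listBracket x q T Q) P := by
  rw [listBracket_jacobi hT hP hQ, h, listBracket_zero_right _ _ hT.multi, zero_add]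

end Derived

theorem coe_negOnePow (n : ℤ) : ((Int.negOnePow n : ℤˣ) : ℤ) = paritySign n := by
  rcases n.even_or_odd with h | h
  · simp [Int.negOnePow_even _ h, paritySign, h]
  · simp [Int.negOnePow_odd _ h, paritySign, ← Int.not_odd_iff_even, h]

section Jacobi

variable {g V : Type*} [AddCommGroup g] [Module ℂ g] [AddCommGroup V] [Module ℂ V]

/-- The binary derived bracket, with the sign that makes it graded skew-symmetric, of operations
of degrees `x - 1` and `y - 1`. -/
def skewTwo (T : List (g × V) → Module.End ℂ (g × V)) (x y : ℤ)
    (P Q : List (g × V) → Module.End ℂ (g × V)) : List (g × V) → Module.End ℂ (g × V) :=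
  paritySign (x - 1) • listBracket (1 + (x - 1)) (y - 1) (listBracket 1 (x - 1) T P) Q

/-- The ternary derived bracket, with the sign that makes it graded skew-symmetric, of operations
of degrees `x - 1`, `y - 1` and `z - 1`. -/
def skewThree (T : List (g × V) → Module.End ℂ (g × V)) (x y z : ℤ)
    (P Q R : List (g × V) → Module.End ℂ (g × V)) : List (g × V) → Module.End ℂ (g × V) :=
  paritySign (y - 1) • listBracket (1 + (x - 1) + (y - 1)) (z - 1)
    (listBracket (1 + (x - 1)) (y - 1) (listBracket 1 (x - 1) T P) Q) R

variable {P Q R S U π H : List (g × V) → Module.End ℂ (g × V)} {p q r s u : ℤ}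

/-- Expand the bracket of [π, π] = 0 with P, Q, R. Terms giving all three cochains to one π vanish;
the others are brackets of [[π, X], Y] with [π, Z]. -/
theorem skewTwo_jacobi (hπ : IsOp 1 π) (hG : PreservesG π) (h : listBracket 1 1 π π = 0)
    (hP : IsCochainOp p P) (hQ : IsCochainOp q Q) (hR : IsCochainOp r R) :
    splitBlocks koszulPass [2, 1]
      (fun | [(x, X), (y, Y), (z, Z)] => skewTwo π (x + y) z (skewTwo π x y X Y) Z
           | _ => 0) [(p + 1, P), (q + 1, Q), (r + 1, R)] = 0 := by
  have key := leibnizSum_eq_zero hπ hπ h [(p, P), (q, Q), (r, R)]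
    (by simp [hP.isOp, hQ.isOp, hR.isOp])
  have hPQ := isCochainOp_bracket hπ hG hP hQ
  have hPR := isCochainOp_bracket hπ hG hP hR
  have hQR := isCochainOp_bracket hπ hG hQ hR
  -- The cochains [[π, X], Y] and Z commute, so the nested bracket can be rewritten with Z bracketed
  -- first, in the form produced by the Leibniz expansion.
  have nested {x y z : ℤ} {X Y Z : List (g × V) → Module.End ℂ (g × V)} (hX : IsCochainOp x X)
      (hY : IsCochainOp y Y) (hZ : IsCochainOp z Z) :
      skewTwo π (x + 1 + (y + 1)) (z + 1) (skewTwo π (x + 1) (y + 1) X Y) Z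
        = (paritySign (1 + x + y) * paritySign x * paritySign ((1 + x + y) * z)) •
          listBracket (1 + z) (1 + x + y) (listBracket 1 z π Z)
            (listBracket (1 + x) y (listBracket 1 x π X) Y) := by
    have hXY := isCochainOp_bracket hπ hG hX hY
    have := listBracket_right_comm hπ hXY.isOp hZ.isOp (hXY.bracket_eq_zero hZ _ _)
    rw [skewTwo, skewTwo, listBracket_zsmul_right _ _ _ hπ.multi,
      listBracket_zsmul_left _ _ _ hZ.isOp.multi, show x + 1 + (y + 1) - 1 = 1 + x + y by ring]
    simp only [add_sub_cancel_right, this, mul_smul]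
  simp only [leibnizSum, hPQ.bracket_eq_zero hR, listBracket_zero_left _ _ hπ.multi,
    listBracket_zero_right _ _ hπ.multi] at key
  rw [listBracket_comm (1 + q + r), listBracket_comm (1 + p + r), listBracket_comm (1 + p + q)]
    at key
  simp only [splitBlocks, split, koszulPass, Units.smul_def, List.length_cons, List.length_nil,
    List.map_cons, List.map_nil, List.prod_cons, List.prod_nil, Units.val_neg, coe_negOnePow,
    Units.val_mul, Units.val_one, nested hP hQ hR, nested hP hR hQ, nested hQ hR hP,
    List.cons_append, List.nil_append, Nat.reduceAdd, Nat.reduceEqDiff, if_true, if_false,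
    smul_zero, zero_add, add_zero, mul_one]
  -- The two copies of π are interchangeable, so every term of the expansion occurs twice.
  linear_combination (norm := skip) (-(1 / 2 : ℂ) * paritySign q) • key
  by_cases hp : Even p <;> by_cases hq : Even q <;> by_cases hr : Even r <;>
    simp only [paritySign, Int.even_add, Int.even_mul, Int.not_even_one, hp, hq, hr] <;>
    norm_num <;> module

/-- In the expansion of [π, H] = 0 over four cochains, π can take at most two and H at most three.
The splittings 2 + 2 and 1 + 3 remain; they are l_3 after l_2 and l_2 after l_3. -/
theorem skewTwo_skewThree_jacobi (hπ : IsOp 1 π) (hG : PreservesG π) (hH : IsOp 1 H)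
    (h : listBracket 1 1 π H = 0) (hP : IsCochainOp p P) (hQ : IsCochainOp q Q)
    (hR : IsCochainOp r R) (hS : IsCochainOp s S) :
    splitBlocks koszulPass [2, 2]
        (fun | [(x, X), (y, Y), (z, Z), (t, T)] =>
              skewThree H (x + y) z t (skewTwo π x y X Y) Z T
             | _ => 0) [(p + 1, P), (q + 1, Q), (r + 1, R), (s + 1, S)]
      - splitBlocks koszulPass [3, 1]
        (fun | [(x, X), (y, Y), (z, Z), (t, T)] =>
              skewTwo π (x + y + z - 1) t (skewThree H x y z X Y Z) T
             | _ => 0) [(p + 1, P), (q + 1, Q), (r + 1, R), (s + 1, S)] = 0 := by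
  have key := leibnizSum_eq_zero hπ hH h [(p, P), (q, Q), (r, R), (s, S)]
    (by simp [hP.isOp, hQ.isOp, hR.isOp, hS.isOp])
  have π₃ {x y z : ℤ} {X Y Z : List (g × V) → Module.End ℂ (g × V)} (hX : IsCochainOp x X)
      (hY : IsCochainOp y Y) (hZ : IsCochainOp z Z) :
      listBracket (1 + x + y) z (listBracket (1 + x) y (listBracket 1 x π X) Y) Z = 0 :=
    (isCochainOp_bracket hπ hG hX hY).bracket_eq_zero hZ _ _
  have H₄ : listBracket (1 + p + q + r) s (listBracket (1 + p + q) r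
      (listBracket (1 + p) q (listBracket 1 p H P) Q) R) S = 0 :=
    (isCochainOp_bracket_bracket hH hP hQ hR).bracket_eq_zero hS _ _
  have nested₁ {x y z t : ℤ} {X Y Z T : List (g × V) → Module.End ℂ (g × V)}
      (hX : IsCochainOp x X) (hY : IsCochainOp y Y) (hZ : IsCochainOp z Z)
      (hT : IsCochainOp t T) :
      skewThree H (x + 1 + (y + 1)) (z + 1) (t + 1) (skewTwo π (x + 1) (y + 1) X Y) Z T
        = (-(paritySign z * paritySign x * paritySign ((1 + x + y) * z)
            * paritySign ((1 + x + y) * t) * paritySign ((1 + z + t) * (1 + x + y)))) •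
          listBracket (1 + x + y) (1 + z + t) (listBracket (1 + x) y (listBracket 1 x π X) Y)
            (listBracket (1 + z) t (listBracket 1 z H Z) T) := by
    have hXY := isCochainOp_bracket hπ hG hX hY
    have h₁ := listBracket_right_comm hH hXY.isOp hZ.isOp (hXY.bracket_eq_zero hZ _ _)
    have h₂ := listBracket_right_comm (hH.bracket hZ.isOp) hXY.isOp hT.isOp
      (hXY.bracket_eq_zero hT _ _)
    rw [skewThree, skewTwo, listBracket_zsmul_right _ _ _ hH.multi,
      listBracket_zsmul_left _ _ _ hZ.isOp.multi, listBracket_zsmul_left _ _ _ hT.isOp.multi,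
      show x + 1 + (y + 1) - 1 = 1 + x + y by ring]
    simp only [add_sub_cancel_right]
    rw [h₁, listBracket_zsmul_left _ _ _ hT.isOp.multi,
      show 1 + (1 + x + y) + z = 1 + z + (1 + x + y) by ring, h₂,
      listBracket_comm (1 + z + t)]
    module
  have nested₂ {x y z t : ℤ} {X Y Z T : List (g × V) → Module.End ℂ (g × V)}
      (hX : IsCochainOp x X) (hY : IsCochainOp y Y) (hZ : IsCochainOp z Z)
      (hT : IsCochainOp t T) :
      skewTwo π (x + 1 + (y + 1) + (z + 1) - 1) (t + 1)
          (skewThree H (x + 1) (y + 1) (z + 1) X Y Z) T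
        = (paritySign (1 + x + y + z) * paritySign y * paritySign ((1 + x + y + z) * t)) •
          listBracket (1 + t) (1 + x + y + z) (listBracket 1 t π T)
            (listBracket (1 + x + y) z (listBracket (1 + x) y (listBracket 1 x H X) Y) Z) := by
    have hXY := isCochainOp_bracket_bracket hH hX hY hZ
    have := listBracket_right_comm hπ hXY.isOp hT.isOp (hXY.bracket_eq_zero hT _ _)
    rw [skewThree, skewTwo, listBracket_zsmul_right _ _ _ hπ.multi,
      listBracket_zsmul_left _ _ _ hT.isOp.multi,
      show x + 1 + (y + 1) + (z + 1) - 1 - 1 = 1 + x + y + z by ring]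
    simp only [add_sub_cancel_right, this, mul_smul]
  simp only [leibnizSum, π₃ hP hQ hR, π₃ hP hQ hS, π₃ hP hR hS, π₃ hQ hR hS, H₄,
    listBracket_zero_left _ _ hS.isOp.multi,
    listBracket_zero_left _ _ hH.multi, listBracket_zero_right _ _ hπ.multi,
    listBracket_zero_left _ _ (hH.bracket hP.isOp).multi,
    listBracket_zero_left _ _ (hH.bracket hQ.isOp).multi,
    listBracket_zero_left _ _ (hH.bracket hR.isOp).multi,
    listBracket_zero_left _ _ (hH.bracket hS.isOp).multi,
    smul_zero, zero_add, add_zero] at key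
  simp only [splitBlocks, split, koszulPass, Units.smul_def, List.length_cons, List.length_nil,
    List.map_cons, List.map_nil, List.prod_cons, List.prod_nil, Units.val_neg, coe_negOnePow,
    Units.val_mul, Units.val_one, nested₁ hP hQ hR hS, nested₁ hP hR hQ hS, nested₁ hP hS hQ hR,
    nested₁ hQ hR hP hS, nested₁ hQ hS hP hR, nested₁ hR hS hP hQ, nested₂ hP hQ hR hS,
    nested₂ hP hQ hS hR, nested₂ hP hR hS hQ, nested₂ hQ hR hS hP,
    List.cons_append, List.nil_append, Nat.reduceAdd, Nat.reduceEqDiff, if_true, if_false,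
    smul_zero, zero_add, add_zero, mul_one]
  linear_combination (norm := skip) (paritySign p * paritySign r) • key
  by_cases hp : Even p <;> by_cases hq : Even q <;> by_cases hr : Even r <;>
    by_cases hs : Even s <;>
    simp only [paritySign, Int.even_add, Int.even_mul, Int.not_even_one, hp, hq, hr, hs] <;>
    norm_num <;> module

end Jacobi

/-! ### The Jacobi identity of the ternary bracket with itself. -/

section Jacobi

variable {g V : Type*} [AddCommGroup g] [Module ℂ g] [AddCommGroup V] [Module ℂ V]
variable {P Q R S U π H : List (g × V) → Module.End ℂ (g × V)} {p q r s u : ℤ}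

theorem skewThree_skewThree (hH : IsOp 1 H) {x y z t w : ℤ}
    {X Y Z T W : List (g × V) → Module.End ℂ (g × V)}
    (hX : IsCochainOp x X) (hY : IsCochainOp y Y) (hZ : IsCochainOp z Z)
    (hT : IsCochainOp t T) (hW : IsCochainOp w W) :
    skewThree H (x + 1 + (y + 1) + (z + 1) - 1) (t + 1) (w + 1)
        (skewThree H (x + 1) (y + 1) (z + 1) X Y Z) T W
      = (paritySign y * paritySign t * paritySign ((1 + x + y + z) * t)
          * paritySign ((1 + x + y + z) * w)) •
        listBracket (1 + t + w) (1 + x + y + z)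
          (listBracket (1 + t) w (listBracket 1 t H T) W)
          (listBracket (1 + x + y) z (listBracket (1 + x) y (listBracket 1 x H X) Y) Z) := by
  have hXYZ := isCochainOp_bracket_bracket hH hX hY hZ
  have h₁ := listBracket_right_comm hH hXYZ.isOp hT.isOp (hXYZ.bracket_eq_zero hT _ _)
  have h₂ := listBracket_right_comm (hH.bracket hT.isOp) hXYZ.isOp hW.isOp
    (hXYZ.bracket_eq_zero hW _ _)
  rw [skewThree, skewThree, listBracket_zsmul_right _ _ _ hH.multi,
    listBracket_zsmul_left _ _ _ hT.isOp.multi, listBracket_zsmul_left _ _ _ hW.isOp.multi,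
    show x + 1 + (y + 1) + (z + 1) - 1 - 1 = 1 + x + y + z by ring]
  simp only [add_sub_cancel_right]
  rw [h₁, listBracket_zsmul_left _ _ _ hW.isOp.multi,
    show 1 + (1 + x + y + z) + t = 1 + t + (1 + x + y + z) by ring, h₂]
  module

-- In the expansion of [H, H] = 0 over five cochains, one copy of H takes three of them and the
-- other two. The ten choices occur twice each, whence the factor 1/2 below.
set_option maxHeartbeats 4000000 in
theorem skewThree_jacobi (hH : IsOp 1 H) (h : listBracket 1 1 H H = 0)
    (hP : IsCochainOp p P) (hQ : IsCochainOp q Q) (hR : IsCochainOp r R) (hS : IsCochainOp s S)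
    (hU : IsCochainOp u U) :
    splitBlocks koszulPass [3, 2]
        (fun | [(x, X), (y, Y), (z, Z), (t, T), (w, W)] =>
              skewThree H (x + y + z - 1) t w (skewThree H x y z X Y Z) T W
             | _ => 0) [(p + 1, P), (q + 1, Q), (r + 1, R), (s + 1, S), (u + 1, U)] = 0 := by
  have key := leibnizSum_eq_zero hH hH h [(p, P), (q, Q), (r, R), (s, S), (u, U)]
    (by simp [hP.isOp, hQ.isOp, hR.isOp, hS.isOp, hU.isOp])
  have H₄ {x y z t : ℤ} {X Y Z T : List (g × V) → Module.End ℂ (g × V)}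
      (hX : IsCochainOp x X) (hY : IsCochainOp y Y) (hZ : IsCochainOp z Z)
      (hT : IsCochainOp t T) :
      listBracket (1 + x + y + z) t (listBracket (1 + x + y) z
        (listBracket (1 + x) y (listBracket 1 x H X) Y) Z) T = 0 :=
    (isCochainOp_bracket_bracket hH hX hY hZ).bracket_eq_zero hT _ _
  simp only [leibnizSum, H₄ hP hQ hR hS, H₄ hP hQ hR hU, H₄ hP hQ hS hU, H₄ hP hR hS hU,
    H₄ hQ hR hS hU, listBracket_zero_left _ _ hU.isOp.multi,
    listBracket_zero_left _ _ hH.multi, listBracket_zero_right _ _ hH.multi,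
    listBracket_zero_left _ _ (hH.bracket hP.isOp).multi,
    listBracket_zero_left _ _ (hH.bracket hQ.isOp).multi,
    listBracket_zero_left _ _ (hH.bracket hR.isOp).multi,
    listBracket_zero_left _ _ (hH.bracket hS.isOp).multi,
    listBracket_zero_left _ _ (hH.bracket hU.isOp).multi,
    listBracket_zero_right _ _ (hH.bracket hP.isOp).multi,
    listBracket_zero_right _ _ (hH.bracket hQ.isOp).multi,
    listBracket_zero_right _ _ (hH.bracket hR.isOp).multi,
    listBracket_zero_right _ _ (hH.bracket hS.isOp).multi,
    listBracket_zero_right _ _ (hH.bracket hU.isOp).multi,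
    smul_zero, zero_add, add_zero] at key
  rw [listBracket_comm (1 + p + q + r), listBracket_comm (1 + p + q + s),
    listBracket_comm (1 + p + q + u), listBracket_comm (1 + p + r + s),
    listBracket_comm (1 + p + r + u), listBracket_comm (1 + p + s + u),
    listBracket_comm (1 + q + r + s), listBracket_comm (1 + q + r + u),
    listBracket_comm (1 + q + s + u), listBracket_comm (1 + r + s + u)] at key
  simp only [splitBlocks, split, koszulPass, Units.smul_def, List.length_cons, List.length_nil,
    List.map_cons, List.map_nil, List.prod_cons, List.prod_nil, Units.val_neg, coe_negOnePow,
    Units.val_mul, Units.val_one,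
    skewThree_skewThree hH hP hQ hR hS hU, skewThree_skewThree hH hP hQ hS hR hU,
    skewThree_skewThree hH hP hQ hU hR hS, skewThree_skewThree hH hP hR hS hQ hU,
    skewThree_skewThree hH hP hR hU hQ hS, skewThree_skewThree hH hP hS hU hQ hR,
    skewThree_skewThree hH hQ hR hS hP hU, skewThree_skewThree hH hQ hR hU hP hS,
    skewThree_skewThree hH hQ hS hU hP hR, skewThree_skewThree hH hR hS hU hP hQ,
    List.cons_append, List.nil_append, Nat.reduceAdd, Nat.reduceEqDiff, if_true, if_false,
    smul_zero, zero_add, add_zero, mul_one]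
  -- The ten brackets become atoms, so that the 32 parity cases are only linear algebra over the
  -- signs.
  generalize listBracket (1 + p + q) (1 + r + s + u)
    (listBracket (1 + p) q (listBracket 1 p H P) Q) _ = t0 at key ⊢
  generalize listBracket (1 + p + r) (1 + q + s + u)
    (listBracket (1 + p) r (listBracket 1 p H P) R) _ = t1 at key ⊢
  generalize listBracket (1 + p + s) (1 + q + r + u)
    (listBracket (1 + p) s (listBracket 1 p H P) S) _ = t2 at key ⊢
  generalize listBracket (1 + p + u) (1 + q + r + s)
    (listBracket (1 + p) u (listBracket 1 p H P) U) _ = t3 at key ⊢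
  generalize listBracket (1 + q + r) (1 + p + s + u)
    (listBracket (1 + q) r (listBracket 1 q H Q) R) _ = t4 at key ⊢
  generalize listBracket (1 + q + s) (1 + p + r + u)
    (listBracket (1 + q) s (listBracket 1 q H Q) S) _ = t5 at key ⊢
  generalize listBracket (1 + q + u) (1 + p + r + s)
    (listBracket (1 + q) u (listBracket 1 q H Q) U) _ = t6 at key ⊢
  generalize listBracket (1 + r + s) (1 + p + q + u)
    (listBracket (1 + r) s (listBracket 1 r H R) S) _ = t7 at key ⊢
  generalize listBracket (1 + r + u) (1 + p + q + s)
    (listBracket (1 + r) u (listBracket 1 r H R) U) _ = t8 at key ⊢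
  generalize listBracket (1 + s + u) (1 + p + q + r)
    (listBracket (1 + s) u (listBracket 1 s H S) U) _ = t9 at key ⊢
  linear_combination (norm := skip) ((1 / 2 : ℂ) * (paritySign q * paritySign s : ℤ)) • key
  clear key
  by_cases hp : Even p <;> by_cases hq : Even q <;> by_cases hr : Even r <;>
    by_cases hs : Even s <;> by_cases hu : Even u <;>
    simp only [paritySign, Int.even_add, Int.even_mul, Int.not_even_one, hp, hq, hr, hs, hu] <;>
    norm_num <;> module

end Jacobi

/-! ### Cochains as functions of a list -/

section MultiLemmas

variable {W M : Type*} [AddCommGroup W] [Module ℂ W] [AddCommGroup M] [Module ℂ M]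
  {f : List W → M}

theorem IsMulti.add_append (hf : IsMulti f) (l : List W) (x y : W) (l' : List W) :
    f (l ++ (x + y) :: l') = f (l ++ x :: l') + f (l ++ y :: l') := by
  induction l generalizing f with
  | nil => exact hf.add x y l'
  | cons z l ih => exact ih (hf.cons z)

theorem IsMulti.smul_append (hf : IsMulti f) (l : List W) (c : ℂ) (x : W) (l' : List W) :
    f (l ++ (c • x) :: l') = c • f (l ++ x :: l') := by
  induction l generalizing f with
  | nil => exact hf.smul c x l'
  | cons z l ih => exact ih (hf.cons z)

theorem IsMulti.eq_zero_of_repeat (hf : IsMulti f) (l : List W) (x : W) (l' l'' : List W) :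
    f (l ++ x :: (l' ++ x :: l'')) = 0 := by
  induction l' generalizing l with
  | nil =>
    have h := hf.swap l x x l''
    have h₂ : (2 : ℂ) • f (l ++ x :: ([] ++ x :: l'')) = 0 := by
      rw [List.nil_append, two_smul]
      nth_rewrite 1 [h]
      exact neg_add_cancel _
    exact (smul_eq_zero.1 h₂).resolve_left two_ne_zero
  | cons y l' ih =>
    have h := ih (l ++ [y])
    rw [List.cons_append, hf.swap]
    simpa using h

theorem ofFn_update {α : Type*} {n : ℕ} (u : Fin n → α) (i : Fin n) (z : α) :
    List.ofFn (Function.update u i z)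
      = (List.ofFn u).take i ++ z :: (List.ofFn u).drop (i + 1) := by
  have h := List.set_eq_take_append_cons_drop (l := List.ofFn u) (i := i) (a := z)
  rw [if_pos (by simp)] at h
  rw [← h]
  refine List.ext_getElem (by simp) fun k h₁ h₂ => ?_
  rw [List.getElem_set]
  simp [Function.update_apply, Fin.ext_iff, eq_comm]

theorem eq_take_append_cons_drop {α : Type*} (l : List α) {i : ℕ} (h : i < l.length) :
    l = l.take i ++ l[i] :: l.drop (i + 1) := by
  rw [List.cons_getElem_drop_succ, List.take_append_drop]

/-- The alternating map given by an alternating multilinear function of a list. -/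
def IsMulti.toAlternatingMap (hf : IsMulti f) (n : ℕ) : W [⋀^Fin n]→ₗ[ℂ] M where
  toFun u := f (List.ofFn u)
  map_update_add' := by
    intro inst u i x y
    obtain rfl : inst = instDecidableEqFin n := Subsingleton.elim _ _
    simp only [ofFn_update, hf.add_append]
  map_update_smul' := by
    intro inst u i c x
    obtain rfl : inst = instDecidableEqFin n := Subsingleton.elim _ _
    simp only [ofFn_update, hf.smul_append]
  map_eq_zero_of_eq' := by
    intro v i j h hij
    wlog hlt : i < j generalizing i j
    · exact this j i h.symm hij.symm (lt_of_le_of_ne (not_lt.1 hlt) hij.symm)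
    rw [Fin.lt_def] at hlt
    have h₁ := eq_take_append_cons_drop (List.ofFn v) (i := i) (by simp)
    have h₂ := eq_take_append_cons_drop ((List.ofFn v).drop (i + 1)) (i := j - (i + 1))
      (by simp; omega)
    rw [List.getElem_drop] at h₂
    simp only [List.getElem_ofFn, Nat.add_sub_of_le hlt, Fin.eta] at h₁ h₂
    rw [h₂, ← h] at h₁
    change f (List.ofFn v) = 0
    rw [h₁]
    exact hf.eq_zero_of_repeat _ _ _ _

end MultiLemmas

/-! ### Cochains as alternating operations on `g × V`. -/

section Lift

variable {g V : Type*} [LeftPreLieRing g] [LeftPreLieAlgebra ℂ g] [AddCommGroup V] [Module ℂ V]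

/-- A cochain as a function of a list of elements of `g × V`. -/
def Cochain.listOp {m : ℕ} (P : Cochain g V m) (l : List (g × V)) : Module.End ℂ (g × V) :=
  if h : m = l.length then
    LinearMap.inl ℂ g V ∘ₗ (P fun i => (l.get (i.cast h)).2) ∘ₗ LinearMap.snd ℂ g V
  else 0

theorem Cochain.listOp_of_ne {m : ℕ} (P : Cochain g V m) {l : List (g × V)} (h : m ≠ l.length) :
    P.listOp l = 0 :=
  dif_neg h

theorem Cochain.listOp_apply {m : ℕ} (P : Cochain g V m) (x : Fin m → g × V) (y : g × V) :
    P.listOp (List.ofFn x) y = (P (fun i => (x i).2) y.2, 0) := by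
  rw [listOp, dif_pos (by simp)]
  simp

theorem Cochain.represents_lift {m : ℕ} (P : Cochain g V m) : Represents P.listOp P.lift :=
  fun x y => (P.listOp_apply x y).symm

theorem exists_ofFn {α : Type*} {m : ℕ} {l : List α} (h : l.length = m) :
    ∃ x : Fin m → α, l = List.ofFn x := by
  subst h
  exact ⟨l.get, (List.ofFn_get l).symm⟩

theorem Cochain.listOp_cons {m : ℕ} (P : Cochain g V (m + 1)) (x : g × V) (l : List (g × V)) :
    P.listOp (x :: l) = Cochain.listOp (AlternatingMap.curryLeft P x.2) l := by
  by_cases h : l.length = m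
  · obtain ⟨u, rfl⟩ := exists_ofFn h
    refine LinearMap.ext fun y => ?_
    rw [← List.ofFn_cons, Cochain.listOp_apply, Cochain.listOp_apply,
      AlternatingMap.curryLeft_apply_apply]
    congr 3
    funext i
    refine Fin.cases rfl (fun i => rfl) i
  · rw [P.listOp_of_ne (by simp; omega), Cochain.listOp_of_ne _ (Ne.symm h)]

theorem Cochain.listOp_add {m : ℕ} (P Q : Cochain g V m) (l : List (g × V)) :
    Cochain.listOp (P + Q) l = P.listOp l + Q.listOp l := by
  by_cases h : m = l.length
  · simp [listOp, dif_pos h, LinearMap.add_comp, LinearMap.comp_add]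
  · simp [listOp, dif_neg h]

theorem Cochain.listOp_smul {m : ℕ} (c : ℂ) (P : Cochain g V m) (l : List (g × V)) :
    Cochain.listOp (c • P) l = c • P.listOp l := by
  by_cases h : m = l.length
  · simp [listOp, dif_pos h, LinearMap.smul_comp, LinearMap.comp_smul]
  · simp [listOp, dif_neg h]

theorem Cochain.listOp_zero {m : ℕ} (l : List (g × V)) :
    Cochain.listOp (0 : Cochain g V m) l = 0 := by
  by_cases h : m = l.length
  · simp [listOp, dif_pos h]
  · simp [listOp, dif_neg h]

theorem Cochain.isMulti_listOp {m : ℕ} (P : Cochain g V m) : IsMulti P.listOp where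
  swap l x y l' := by
    induction l generalizing m with
    | nil =>
      rcases m with _ | _ | m
      · rw [P.listOp_of_ne (by simp), P.listOp_of_ne (by simp), neg_zero]
      · rw [P.listOp_of_ne (by simp), P.listOp_of_ne (by simp), neg_zero]
      · simp only [List.nil_append, Cochain.listOp_cons]
        rw [eq_neg_iff_add_eq_zero, ← Cochain.listOp_add]
        have h := AlternatingMap.curryLeft_same P (x.2 + y.2)
        simp only [map_add, AlternatingMap.curryLeft_add, LinearMap.add_apply,
          AlternatingMap.curryLeft_same, zero_add, add_zero] at h
        rw [add_comm] at h
        rw [h, Cochain.listOp_zero]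
    | cons z l ih =>
      rcases m with _ | m
      · rw [P.listOp_of_ne (by simp), P.listOp_of_ne (by simp), neg_zero]
      · simp only [List.cons_append, Cochain.listOp_cons, ih]
  add x y l := by
    rcases m with _ | m
    · simp only [P.listOp_of_ne (l := _ :: l) (by simp), add_zero]
    · simp only [Cochain.listOp_cons, Prod.snd_add, map_add, Cochain.listOp_add]
  smul c x l := by
    rcases m with _ | m
    · simp only [P.listOp_of_ne (l := _ :: l) (by simp), smul_zero]
    · simp only [Cochain.listOp_cons, Prod.smul_snd, map_smul, Cochain.listOp_smul]

theorem Cochain.isCochainOp_listOp {m : ℕ} (P : Cochain g V m) : IsCochainOp m P.listOp where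
  isOp := ⟨P.isMulti_listOp, fun l h => P.listOp_of_ne fun e => h (e ▸ rfl)⟩
  maps l y := by
    by_cases h : m = l.length
    · simp [listOp, dif_pos h]
    · simp [listOp, dif_neg h]
  kills := by
    constructor
    · intro x l hx
      rcases m with _ | m
      · exact P.listOp_of_ne (by simp)
      · rw [Cochain.listOp_cons, hx, map_zero, Cochain.listOp_zero]
    · intro l y hy
      by_cases h : m = l.length
      · simp [listOp, dif_pos h, hy]
      · simp [listOp, dif_neg h]

theorem KillsG.apply_eq {f : List (g × V) → Module.End ℂ (g × V)} (hf : KillsG f)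
    (hf' : IsMulti f) (l : List (g × V)) (y : g × V) :
    f l y = f (l.map fun x => (0, x.2)) (0, y.2) := by
  induction l generalizing f with
  | nil =>
    have : y = (y.1, 0) + (0, y.2) := by simp
    rw [this, map_add, hf.last _ _ rfl]
    simp
  | cons x l ih =>
    rw [eq_split_head hf', hf.head _ _ rfl, zero_add, List.map_cons]
    refine ih (f := fun l => f ((0, x.2) :: l)) ⟨fun z l hz => ?_, fun l y hy => hf.last _ _ hy⟩
      (hf'.cons _)
    rw [hf'.swap_head, hf.head _ _ hz, neg_zero]

/-- An operation that ignores g and takes values in g is determined by its restriction to V followed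
by the projection onto g. Thus the derived brackets of cochains come from actual cochains. -/
theorem exists_listOp_eq {n : ℕ} {f : List (g × V) → Module.End ℂ (g × V)}
    (hf : IsCochainOp n f) : ∃ P : Cochain g V n, P.listOp = f := by
  let φ : Module.End ℂ (g × V) →ₗ[ℂ] (V →ₗ[ℂ] g) :=
    { toFun := fun e => LinearMap.fst ℂ g V ∘ₗ e ∘ₗ LinearMap.inr ℂ g V
      map_add' := fun a b => by ext; simp
      map_smul' := fun c a => by ext; simp }
  let P₀ : (g × V) [⋀^Fin n]→ₗ[ℂ] (V →ₗ[ℂ] g) := (hf.isOp.multi.map φ).toAlternatingMap n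
  refine ⟨P₀.compLinearMap (LinearMap.inr ℂ g V), funext fun l => ?_⟩
  by_cases h : l.length = n
  · obtain ⟨u, rfl⟩ := exists_ofFn h
    refine LinearMap.ext fun y => ?_
    rw [Cochain.listOp_apply, hf.kills.apply_eq hf.isOp.multi, List.map_ofFn]
    exact Prod.ext rfl (hf.maps _ _).symm
  · rw [hf.isOp.supp l (by exact_mod_cast h), Cochain.listOp_of_ne _ (Ne.symm h)]

theorem Cochain.listOp_injective {m : ℕ} {P Q : Cochain g V m} (h : P.listOp = Q.listOp) :
    P = Q := by
  refine AlternatingMap.ext fun u => LinearMap.ext fun v => ?_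
  have := DFunLike.congr_fun (congrFun h (List.ofFn fun i => ((0 : g), u i))) ((0 : g), v)
  rw [Cochain.listOp_apply, Cochain.listOp_apply] at this
  exact congrArg Prod.fst this

/-! ### The total space of cochains as a space of functions of a list -/

variable (g V) in
/-- The linear map that sends a cochain to the corresponding function of a list. -/
noncomputable def toListOp : CochainSpace g V →ₗ[ℂ] List (g × V) → Module.End ℂ (g × V) :=
  DirectSum.toModule ℂ ℕ _ fun m =>
    { toFun := fun P : Cochain g V m => P.listOp
      map_add' := fun P Q => funext (Cochain.listOp_add P Q)
      map_smul' := fun c P => funext (Cochain.listOp_smul c P) }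

theorem toListOp_toSpace {m : ℕ} (P : Cochain g V m) : toListOp g V P.toSpace = P.listOp := by
  rw [toListOp, Cochain.toSpace, DirectSum.toModule_lof]; rfl

theorem toListOp_apply (x : CochainSpace g V) (l : List (g × V)) :
    toListOp g V x l = Cochain.listOp (x l.length) l := by
  induction x using DirectSum.induction_on with
  | zero => rw [map_zero, DirectSum.zero_apply, Cochain.listOp_zero]; rfl
  | of m P =>
    change toListOp g V P.toSpace l = _
    rw [toListOp_toSpace]
    by_cases h : m = l.length
    · subst h
      rw [DirectSum.of_eq_same]
    · rw [DirectSum.of_eq_of_ne _ _ _ (Ne.symm h), P.listOp_of_ne h, Cochain.listOp_zero]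
  | add x y hx hy => rw [map_add, Pi.add_apply, hx, hy, DirectSum.add_apply, Cochain.listOp_add]

theorem listOp_eq_ite (x : CochainSpace g V) (m : ℕ) (l : List (g × V)) :
    Cochain.listOp (x m) l = if l.length = m then toListOp g V x l else 0 := by
  split_ifs with h
  · subst h; rw [toListOp_apply]
  · exact Cochain.listOp_of_ne _ (Ne.symm h)

theorem toListOp_injective : Function.Injective (toListOp g V) := by
  intro x y h
  refine DFinsupp.ext fun m => Cochain.listOp_injective (funext fun l => ?_)
  rw [listOp_eq_ite, listOp_eq_ite, h]

/-- Integer degrees make this uniform: for d ≤ 0 no list has length d - 1, so both sides say that x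
is zero. -/
theorem mem_cochainGrading_iff {x : CochainSpace g V} {d : ℤ} :
    x ∈ cochainGrading g V d ↔ IsCochainOp (d - 1) (toListOp g V x) := by
  constructor
  · intro h
    have : x = 0 ∨ ∃ m : ℕ, (m : ℤ) + 1 = d ∧ x = Cochain.toSpace (x m) := by
      by_cases hd : ∃ m : ℕ, (m : ℤ) + 1 = d
      · obtain ⟨m, hm⟩ := hd
        refine .inr ⟨m, hm, DFinsupp.ext fun k => ?_⟩
        by_cases hk : k = m
        · subst hk
          exact (DirectSum.of_eq_same _ _).symm
        · rw [h k (by omega)]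
          exact (DirectSum.of_eq_of_ne _ _ _ hk).symm
      · refine .inl (DFinsupp.ext fun k => h k fun hk => hd ⟨k, hk⟩)
    obtain rfl | ⟨m, rfl, hx⟩ := this
    · rw [map_zero]
      exact ⟨isOp_zero, fun _ _ => rfl, fun _ _ _ => rfl, fun _ _ _ => rfl⟩
    · rw [hx, toListOp_toSpace, add_sub_cancel_right]
      exact Cochain.isCochainOp_listOp _
  · intro h m hm
    refine Cochain.listOp_injective (funext fun l => ?_)
    rw [listOp_eq_ite, Cochain.listOp_zero]
    split_ifs with hl
    · exact h.isOp.supp l (by omega)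
    · rfl

end Lift

/-! ### Binary operations -/

section BinaryOp

variable {W : Type*} [AddCommGroup W] [Module ℂ W]

/-- A bilinear operation, as a function of the list of its skew arguments. -/
def binaryOp (B : W →ₗ[ℂ] Module.End ℂ W) (l : List W) : Module.End ℂ W := B (listOne l)

theorem isOp_binaryOp (B : W →ₗ[ℂ] Module.End ℂ W) : IsOp 1 (binaryOp B) where
  multi := isMulti_listOne.map B
  supp l h := by
    rcases l with _ | ⟨x, _ | ⟨y, l⟩⟩
    · simp [binaryOp, listOne]
    · simp at h
    · simp [binaryOp, listOne]

theorem binaryOp_circ_apply (B C : W →ₗ[ℂ] Module.End ℂ W) (x y z : W) :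
    (binaryOp B ⋄ binaryOp C) [x, y] z
      = B (C x y - C y x) z + B y (C x z) - B x (C y z) := by
  simp [circ, outer, conv_cons, conv_nil, binaryOp, listOne]
  abel

theorem IsOp.ext_two {P Q : List W → Module.End ℂ W} (hP : IsOp 2 P) (hQ : IsOp 2 Q)
    (h : ∀ x y z, P [x, y] z = Q [x, y] z) : P = Q := by
  funext l
  rcases l with _ | ⟨x, _ | ⟨y, _ | ⟨z, l⟩⟩⟩
  · rw [hP.supp _ (by simp), hQ.supp _ (by simp)]
  · rw [hP.supp _ (by simp), hQ.supp _ (by simp)]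
  · exact LinearMap.ext (h x y)
  · rw [hP.supp _ (by simp; omega), hQ.supp _ (by simp; omega)]

theorem binaryOp_bracket_eq_zero {B C : W →ₗ[ℂ] Module.End ℂ W}
    (h : ∀ x y z, B (C x y - C y x) z + B y (C x z) - B x (C y z)
      + (C (B x y - B y x) z + C y (B x z) - C x (B y z)) = 0) :
    listBracket 1 1 (binaryOp B) (binaryOp C) = 0 := by
  refine IsOp.ext_two ((isOp_binaryOp B).bracket (isOp_binaryOp C)) isOp_zero fun x y z => ?_
  rw [listBracket, mul_one, paritySign_one, neg_one_zsmul, sub_neg_eq_add, Pi.add_apply,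
    LinearMap.add_apply, binaryOp_circ_apply, binaryOp_circ_apply]
  exact h x y z

end BinaryOp

/-! ### The three commutation relations of the semidirect product and the weight. -/

section Semidirect

variable {g V : Type*} [LeftPreLieRing g] [LeftPreLieAlgebra ℂ g] [AddCommGroup V] [Module ℂ V]

/-- The product of the semidirect product `g ⊕ V`. -/
def PreLieRep.product (ρ : PreLieRep g V) : g × V →ₗ[ℂ] Module.End ℂ (g × V) :=
  LinearMap.mk₂ ℂ (fun x y => (x.1 * y.1, ρ.L x.1 y.2 + ρ.R y.1 x.2))
    (fun x x' y => by ext <;> simp [add_mul]; abel)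
    (fun c x y => by ext <;> simp [smul_mul_assoc])
    (fun x y y' => by ext <;> simp [mul_add]; abel)
    (fun c x y => by ext <;> simp [mul_smul_comm])

theorem PreLieRep.product_apply (ρ : PreLieRep g V) (x y : g × V) :
    ρ.product x y = (x.1 * y.1, ρ.L x.1 y.2 + ρ.R y.1 x.2) := rfl

/-- A bilinear map `g × g → V`, as a bilinear operation on `g ⊕ V`. -/
def weightProduct (H : g →ₗ[ℂ] g →ₗ[ℂ] V) : g × V →ₗ[ℂ] Module.End ℂ (g × V) :=
  LinearMap.mk₂ ℂ (fun x y => (0, H x.1 y.1)) (fun x x' y => by ext <;> simp)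
    (fun c x y => by ext <;> simp) (fun x y y' => by ext <;> simp) (fun c x y => by ext <;> simp)

theorem weightProduct_apply (H : g →ₗ[ℂ] g →ₗ[ℂ] V) (x y : g × V) :
    weightProduct H x y = (0, H x.1 y.1) := rfl

theorem PreLieRep.represents_semidirect (ρ : PreLieRep g V) :
    Represents (binaryOp ρ.product) ρ.semidirect :=
  fun _ _ => rfl

theorem PreLieRep.preservesG_product (ρ : PreLieRep g V) : PreservesG (binaryOp ρ.product) := by
  intro x y hx hy
  simp [binaryOp, listOne, product_apply, hx, hy]

/-- The bracket is twice the pre-Lie identity of g ⊕ V. Its g-component is the identity of g; its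
V-component is linear in the V-parts and splits into `left_left` for the last argument and two
instances of `left_right`. -/
theorem PreLieRep.product_bracket_product (ρ : PreLieRep g V) :
    listBracket 1 1 (binaryOp ρ.product) (binaryOp ρ.product) = 0 := by
  refine binaryOp_bracket_eq_zero fun x y z => ?_
  have h : ρ.product (ρ.product x y - ρ.product y x) z + ρ.product y (ρ.product x z)
      - ρ.product x (ρ.product y z) = 0 := by
    have h₁ := LeftPreLieRing.assoc_symm' x.1 y.1 z.1
    have h₂ := ρ.left_left x.1 y.1 z.2
    have h₃ := ρ.left_right x.1 z.1 y.2
    have h₄ := ρ.left_right y.1 z.1 x.2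
    ext
    · simp only [associator] at h₁
      simp only [product_apply, Prod.fst_add, Prod.fst_sub, Prod.fst_zero, sub_mul]
      rw [← sub_eq_zero] at h₁
      rw [← h₁]
      abel
    · simp only [product_apply, Prod.snd_add, Prod.snd_sub, Prod.snd_zero, map_sub, map_add,
        LinearMap.sub_apply]
      rw [← sub_eq_zero] at h₂ h₃ h₄
      linear_combination (norm := module) h₄ - h₂ - h₃
  rw [h, add_zero]

theorem PreLieRep.IsTwoCocycle.product_bracket_weight {ρ : PreLieRep g V}
    {H : g →ₗ[ℂ] g →ₗ[ℂ] V} (hH : ρ.IsTwoCocycle H) :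
    listBracket 1 1 (binaryOp ρ.product) (binaryOp (weightProduct H)) = 0 := by
  refine binaryOp_bracket_eq_zero fun x y z => ?_
  have h := hH x.1 y.1 z.1
  ext
  · simp [product_apply, weightProduct_apply]
  · simp only [product_apply, weightProduct_apply, Prod.snd_add, Prod.snd_sub, Prod.snd_zero,
      map_sub, map_zero, LinearMap.sub_apply, LinearMap.zero_apply, zero_add, add_zero] at h ⊢
    linear_combination (norm := module) -h

/-- The values of the weight lie in V, and the weight reads only g-components, so it cannot be
composed with itself. -/
theorem weight_bracket_weight (H : g →ₗ[ℂ] g →ₗ[ℂ] V) :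
    listBracket 1 1 (binaryOp (weightProduct H)) (binaryOp (weightProduct H)) = 0 := by
  refine binaryOp_bracket_eq_zero fun x y z => ?_
  ext <;> simp [weightProduct_apply]

end Semidirect

/-! ### Multilinear maps on the total space of cochains -/

section MultilinearMaps

variable {g V : Type*} [LeftPreLieRing g] [LeftPreLieAlgebra ℂ g] [AddCommGroup V] [Module ℂ V]

theorem exists_toListOp_eq {n : ℤ} {f : List (g × V) → Module.End ℂ (g × V)}
    (hf : IsCochainOp n f) : ∃ x : CochainSpace g V, toListOp g V x = f := by
  obtain h | h := le_or_gt 0 n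
  · lift n to ℕ using h
    obtain ⟨P, hP⟩ := exists_listOp_eq hf
    exact ⟨P.toSpace, by rw [toListOp_toSpace, hP]⟩
  · refine ⟨0, funext fun l => ?_⟩
    rw [map_zero, hf.isOp.supp l (by omega)]
    rfl

theorem eq_zero_or_exists_toSpace {x : CochainSpace g V} {d : ℤ} (h : x ∈ cochainGrading g V d) :
    x = 0 ∨ ∃ m : ℕ, (m : ℤ) + 1 = d ∧ ∃ P : Cochain g V m, x = P.toSpace := by
  by_cases hd : ∃ m : ℕ, (m : ℤ) + 1 = d
  · obtain ⟨m, hm⟩ := hd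
    refine .inr ⟨m, hm, x m, DFinsupp.ext fun k => ?_⟩
    by_cases hk : k = m
    · subst hk
      exact (DirectSum.of_eq_same _ _).symm
    · rw [h k (by omega)]
      exact (DirectSum.of_eq_of_ne _ _ _ hk).symm
  · exact .inl (DFinsupp.ext fun k => h k fun hk => hd ⟨k, hk⟩)

theorem toSpace_mem_cochainGrading {m : ℕ} (P : Cochain g V m) :
    P.toSpace ∈ cochainGrading g V (m + 1) :=
  mem_cochainGrading_iff.2 (by
    rw [add_sub_cancel_right, toListOp_toSpace]; exact P.isCochainOp_listOp)

/-- A family of operations on homogeneous cochains, linear in each argument, is given by a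
multilinear map on the total space. -/
theorem exists_multilinearMap {k : ℕ}
    (F : (Fin k → ℤ) → (Fin k → List (g × V) → Module.End ℂ (g × V)) →
      List (g × V) → Module.End ℂ (g × V)) (e : (Fin k → ℤ) → ℤ)
    (hF : ∀ d X, (∀ i, IsCochainOp (d i - 1) (X i)) → IsCochainOp (e d - 1) (F d X))
    (hadd : ∀ d X, (∀ i, IsCochainOp (d i - 1) (X i)) → ∀ i Y Z, IsCochainOp (d i - 1) Y →
      IsCochainOp (d i - 1) Z → F d (Function.update X i (Y + Z))
        = F d (Function.update X i Y) + F d (Function.update X i Z))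
    (hsmul : ∀ d X, (∀ i, IsCochainOp (d i - 1) (X i)) → ∀ i (c : ℂ) Y, IsCochainOp (d i - 1) Y →
      F d (Function.update X i (c • Y)) = c • F d (Function.update X i Y)) :
    ∃ l : MultilinearMap ℂ (fun _ : Fin k => CochainSpace g V) (CochainSpace g V),
      ∀ d x, (∀ i, x i ∈ cochainGrading g V (d i)) →
        toListOp g V (l x) = F d fun i => toListOp g V (x i) := by
  have hX (p : Fin k → ℕ) (x : ∀ i, Cochain g V (p i)) (i : Fin k) :
      IsCochainOp ((p i + 1 : ℤ) - 1) (x i).listOp := by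
    rw [add_sub_cancel_right]; exact (x i).isCochainOp_listOp
  have hup (p : Fin k → ℕ) (x : ∀ i, Cochain g V (p i)) (i : Fin k) (y : Cochain g V (p i)) :
      (fun j => (Function.update x i y j).listOp)
        = Function.update (fun j => (x j).listOp) i y.listOp := by
    funext j
    by_cases h : j = i
    · subst h; simp
    · simp [h]
  -- Preimages are unique because `toListOp` is injective, so these choices inherit additivity and
  -- homogeneity from F.
  choose G hG using fun (p : Fin k → ℕ) (x : ∀ i, Cochain g V (p i)) =>
    exists_toListOp_eq (hF (fun i => p i + 1) _ (hX p x))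
  let M (p : Fin k → ℕ) : MultilinearMap ℂ (fun i => Cochain g V (p i)) (CochainSpace g V) :=
    { toFun := G p
      map_update_add' := by
        intro inst x i a b
        obtain rfl : inst = instDecidableEqFin k := Subsingleton.elim _ _
        refine toListOp_injective ?_
        rw [map_add, hG, hG, hG, hup, hup, hup, ← hadd _ _ (hX p x) i _ _
          (by simpa using a.isCochainOp_listOp) (by simpa using b.isCochainOp_listOp)]
        congr 2
        exact funext (Cochain.listOp_add a b)
      map_update_smul' := by
        intro inst x i c a
        obtain rfl : inst = instDecidableEqFin k := Subsingleton.elim _ _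
        refine toListOp_injective ?_
        rw [map_smul, hG, hG, hup, hup, ← hsmul _ _ (hX p x) i _ _
          (by simpa using a.isCochainOp_listOp)]
        congr 2
        exact funext (Cochain.listOp_smul c a) }
  refine ⟨MultilinearMap.fromDirectSumEquiv M, fun d x hx => ?_⟩
  -- Zero is homogeneous of every degree, so its declared degree need not be that of any component.
  -- This case uses homogeneity of F with the scalar 0.
  by_cases h0 : ∃ i, x i = 0
  · obtain ⟨i, hi⟩ := h0
    rw [MultilinearMap.map_coord_zero _ i hi, map_zero]
    have h := hsmul d _ (fun j => mem_cochainGrading_iff.1 (hx j)) i 0 _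
      (mem_cochainGrading_iff.1 (hx i))
    rw [zero_smul, zero_smul, Function.update_eq_self_iff.2 (by rw [hi, map_zero])] at h
    exact h.symm
  · have h (i : Fin k) := (eq_zero_or_exists_toSpace (hx i)).resolve_left fun e => h0 ⟨i, e⟩
    choose p hp P hP using h
    obtain rfl : (fun i => (p i : ℤ) + 1) = d := funext hp
    obtain rfl : x = fun i => (P i).toSpace := funext hP
    simp only [toListOp_toSpace]
    rw [← hG]
    have h := MultilinearMap.fromDirectSumEquiv_lof (R := ℂ) (ι := Fin k) (κ := fun _ => ℕ)
      (M := fun _ m => Cochain g V m) (M' := CochainSpace g V) M p P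
    exact congrArg (toListOp g V) h

end MultilinearMaps

/-! ### The decomposition of the space of cochains by degree. -/

section Internal

variable {g V : Type*} [LeftPreLieRing g] [LeftPreLieAlgebra ℂ g] [AddCommGroup V] [Module ℂ V]

theorem coeAddMonoidHom_cochainGrading_apply (x : ⨁ d, cochainGrading g V d) (m : ℕ) :
    DirectSum.coeAddMonoidHom (cochainGrading g V) x m = (x (m + 1) : CochainSpace g V) m := by
  induction x using DirectSum.induction_on with
  | zero => simp
  | of d y =>
    rw [DirectSum.coeAddMonoidHom_of]
    by_cases h : (m : ℤ) + 1 = d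
    · subst h; rw [DirectSum.of_eq_same]
    · rw [DirectSum.of_eq_of_ne _ _ _ h, y.2 m h]; rfl
  | add x y hx hy => simp only [map_add, DirectSum.add_apply, hx, hy, Submodule.coe_add]

theorem isInternal_cochainGrading : DirectSum.IsInternal (cochainGrading g V) := by
  constructor
  · refine fun x y h => DFinsupp.ext fun d => Subtype.ext (DFinsupp.ext fun m => ?_)
    by_cases hd : (m : ℤ) + 1 = d
    · subst hd
      exact (coeAddMonoidHom_cochainGrading_apply x m).symm.trans
        ((by rw [h] : _ = _).trans (coeAddMonoidHom_cochainGrading_apply y m))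
    · exact ((x d).2 m hd).trans ((y d).2 m hd).symm
  · intro x
    induction x using DirectSum.induction_on with
    | zero => exact ⟨0, map_zero _⟩
    | of m P =>
      exact ⟨DirectSum.of (fun d => cochainGrading g V d) (m + 1)
        ⟨Cochain.toSpace P, toSpace_mem_cochainGrading P⟩, DirectSum.coeAddMonoidHom_of _ _ _⟩
    | add x y hx hy =>
      obtain ⟨⟨x', rfl⟩, ⟨y', rfl⟩⟩ := And.intro hx hy
      exact ⟨x' + y', map_add _ _ _⟩

end Internal

/-! ### The L-infinity algebra of cochains -/

section Linear

variable {W : Type*} [AddCommGroup W] [Module ℂ W] {P Q : List W → Module.End ℂ W}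

theorem listBracket_add_right (a b : ℤ) (hP : IsMulti P) (S T : List W → Module.End ℂ W) :
    listBracket a b P (S + T) = listBracket a b P S + listBracket a b P T := by
  simp only [listBracket, add_circ, circ_add hP, smul_add]; abel

theorem listBracket_smul_left (a b : ℤ) (c : ℂ) (hP : IsMulti P) (S : List W → Module.End ℂ W) :
    listBracket a b (c • S) P = c • listBracket a b S P := by
  simp only [listBracket, smul_circ, circ_smul hP, smul_sub, smul_comm c]

theorem listBracket_smul_right (a b : ℤ) (c : ℂ) (hP : IsMulti P) (S : List W → Module.End ℂ W) :
    listBracket a b P (c • S) = c • listBracket a b P S := by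
  simp only [listBracket, smul_circ, circ_smul hP, smul_sub, smul_comm c]

end Linear

/-! ### Assembly of the brackets, their symmetry and the Jacobi identities. -/

section LInfinity

variable {g V : Type*} [LeftPreLieRing g] [LeftPreLieAlgebra ℂ g] [AddCommGroup V] [Module ℂ V]
variable {π H : List (g × V) → Module.End ℂ (g × V)}

theorem exists_skewTwo (hπ : IsOp 1 π) (hG : PreservesG π) :
    ∃ l : MultilinearMap ℂ (fun _ : Fin 2 => CochainSpace g V) (CochainSpace g V),
      ∀ (d : Fin 2 → ℤ) (x : Fin 2 → CochainSpace g V), (∀ i, x i ∈ cochainGrading g V (d i)) → toListOp g V (l x)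
        = skewTwo π (d 0) (d 1) (toListOp g V (x 0)) (toListOp g V (x 1)) := by
  refine exists_multilinearMap (fun d X => skewTwo π (d 0) (d 1) (X 0) (X 1))
    (fun d => d 0 + d 1) (fun d X hX => ?_) (fun d X hX i Y Z hY hZ => ?_)
    fun d X hX i c Y hY => ?_
  · have h := (isCochainOp_bracket hπ hG (hX 0) (hX 1)).zsmul (paritySign (d 0 - 1))
    rwa [show 1 + (d 0 - 1) + (d 1 - 1) = d 0 + d 1 - 1 by ring] at h
  · have h := hπ.bracket (hX 0).isOp
    have h₁ := (hX 1).isOp.multi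
    fin_cases i
    · simp [skewTwo, listBracket_add_right _ _ hπ.multi, listBracket_add_left _ _ h₁]
    · simp [skewTwo, listBracket_add_right _ _ h.multi]
  · have h := hπ.bracket (hX 0).isOp
    have h₁ := (hX 1).isOp.multi
    fin_cases i
    · simp [skewTwo, listBracket_smul_right _ _ _ hπ.multi, listBracket_smul_left _ _ _ h₁]
    · simp [skewTwo, listBracket_smul_right _ _ _ h.multi]

theorem exists_skewThree (hH : IsOp 1 H) :
    ∃ l : MultilinearMap ℂ (fun _ : Fin 3 => CochainSpace g V) (CochainSpace g V),
      ∀ (d : Fin 3 → ℤ) (x : Fin 3 → CochainSpace g V), (∀ i, x i ∈ cochainGrading g V (d i)) → toListOp g V (l x)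
        = skewThree H (d 0) (d 1) (d 2) (toListOp g V (x 0)) (toListOp g V (x 1))
            (toListOp g V (x 2)) := by
  refine exists_multilinearMap (fun d X => skewThree H (d 0) (d 1) (d 2) (X 0) (X 1) (X 2))
    (fun d => d 0 + d 1 + d 2 - 1) (fun d X hX => ?_) (fun d X hX i Y Z hY hZ => ?_)
    fun d X hX i c Y hY => ?_
  · have h := (isCochainOp_bracket_bracket hH (hX 0) (hX 1) (hX 2)).zsmul (paritySign (d 1 - 1))
    rwa [show 1 + (d 0 - 1) + (d 1 - 1) + (d 2 - 1) = d 0 + d 1 + d 2 - 1 - 1 by ring] at h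
  · have h := hH.bracket (hX 0).isOp
    have h' := h.bracket (hX 1).isOp
    have h₁ := (hX 1).isOp.multi
    have h₂ := (hX 2).isOp.multi
    fin_cases i
    · simp [skewThree, listBracket_add_right _ _ hH.multi, listBracket_add_left _ _ h₁,
        listBracket_add_left _ _ h₂]
    · simp [skewThree, listBracket_add_right _ _ h.multi, listBracket_add_left _ _ h₂]
    · simp [skewThree, -add_sub_cancel, listBracket_add_right _ _ h'.multi]
  · have h := hH.bracket (hX 0).isOp
    have h' := h.bracket (hX 1).isOp
    have h₁ := (hX 1).isOp.multi
    have h₂ := (hX 2).isOp.multi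
    fin_cases i
    · simp [skewThree, listBracket_smul_right _ _ _ hH.multi, listBracket_smul_left _ _ _ h₁,
        listBracket_smul_left _ _ _ h₂]
    · simp [skewThree, listBracket_smul_right _ _ _ h.multi, listBracket_smul_left _ _ _ h₂]
    · simp [skewThree, -add_sub_cancel, listBracket_smul_right _ _ _ h'.multi]

/-- Commuting cochains may be exchanged with the sign of their operation degrees p - 1 and q - 1.
The prefactor (-1)^{p-1} converts it into the graded-skew sign for the degrees p and q. -/
theorem skewTwo_comm (hπ : IsOp 1 π) {P Q : List (g × V) → Module.End ℂ (g × V)} {p q : ℤ}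
    (hP : IsCochainOp (p - 1) P) (hQ : IsCochainOp (q - 1) Q) :
    skewTwo π q p Q P = -(paritySign (p * q) • skewTwo π p q P Q) := by
  rw [skewTwo, skewTwo, listBracket_right_comm hπ hQ.isOp hP.isOp (hQ.bracket_eq_zero hP _ _),
    ← mul_smul, ← mul_smul, ← neg_smul]
  congr 1
  obtain ⟨p, rfl⟩ : ∃ p', p = p' + 1 := ⟨p - 1, by ring⟩
  obtain ⟨q, rfl⟩ : ∃ q', q = q' + 1 := ⟨q - 1, by ring⟩
  simp only [add_sub_cancel_right, add_mul, mul_add, paritySign_add, mul_one, one_mul,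
    paritySign_one, mul_comm q p]
  rcases paritySign_eq_or p with h | h <;> rcases paritySign_eq_or q with h' | h' <;>
    rw [h, h'] <;> ring

theorem skewThree_comm_left (hH : IsOp 1 H) {P Q R : List (g × V) → Module.End ℂ (g × V)}
    {p q r : ℤ} (hP : IsCochainOp (p - 1) P) (hQ : IsCochainOp (q - 1) Q)
    (hR : IsCochainOp (r - 1) R) :
    skewThree H q p r Q P R = -(paritySign (p * q) • skewThree H p q r P Q R) := by
  rw [skewThree, skewThree, listBracket_right_comm hH hQ.isOp hP.isOp (hQ.bracket_eq_zero hP _ _),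
    listBracket_zsmul_left _ _ _ hR.isOp.multi, add_right_comm 1 (q - 1) (p - 1),
    ← mul_smul, ← mul_smul, ← neg_smul]
  congr 1
  obtain ⟨p, rfl⟩ : ∃ p', p = p' + 1 := ⟨p - 1, by ring⟩
  obtain ⟨q, rfl⟩ : ∃ q', q = q' + 1 := ⟨q - 1, by ring⟩
  simp only [add_sub_cancel_right, add_mul, mul_add, paritySign_add, mul_one, one_mul,
    paritySign_one, mul_comm q p]
  rcases paritySign_eq_or p with h | h <;> rcases paritySign_eq_or q with h' | h' <;>
    rw [h, h'] <;> ring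

theorem skewThree_comm_right (hH : IsOp 1 H) {P Q R : List (g × V) → Module.End ℂ (g × V)}
    {p q r : ℤ} (hP : IsCochainOp (p - 1) P) (hQ : IsCochainOp (q - 1) Q)
    (hR : IsCochainOp (r - 1) R) :
    skewThree H p r q P R Q = -(paritySign (q * r) • skewThree H p q r P Q R) := by
  rw [skewThree, skewThree, listBracket_right_comm (hH.bracket hP.isOp) hR.isOp hQ.isOp
      (hR.bracket_eq_zero hQ _ _),
    ← mul_smul, ← mul_smul, ← neg_smul]
  congr 1
  obtain ⟨r, rfl⟩ : ∃ p', r = p' + 1 := ⟨r - 1, by ring⟩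
  obtain ⟨q, rfl⟩ : ∃ q', q = q' + 1 := ⟨q - 1, by ring⟩
  simp only [add_sub_cancel_right, add_mul, mul_add, paritySign_add, mul_one, one_mul,
    paritySign_one, mul_comm r q]
  rcases paritySign_eq_or r with h | h <;> rcases paritySign_eq_or q with h' | h' <;>
    rw [h, h'] <;> ring

theorem perm_fin_two (σ : Equiv.Perm (Fin 2)) : σ = 1 ∨ σ = Equiv.swap 0 1 := by
  revert σ; decide

theorem perm_fin_three (σ : Equiv.Perm (Fin 3)) :
    σ = 1 ∨ σ = Equiv.swap 0 1 ∨ σ = Equiv.swap 1 2 ∨ σ = Equiv.swap 0 2 ∨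
      σ = Equiv.swap 0 1 * Equiv.swap 1 2 ∨ σ = Equiv.swap 1 2 * Equiv.swap 0 1 := by
  revert σ; decide

theorem skewTwo_koszulSign (hπ : IsOp 1 π) (d : Fin 2 → ℤ)
    (X : Fin 2 → List (g × V) → Module.End ℂ (g × V)) (hX : ∀ i, IsCochainOp (d i - 1) (X i))
    (σ : Equiv.Perm (Fin 2)) :
    skewTwo π (d (σ 0)) (d (σ 1)) (X (σ 0)) (X (σ 1))
      = (koszulSign d σ : ℤ) • skewTwo π (d 0) (d 1) (X 0) (X 1) := by
  obtain rfl | rfl := perm_fin_two σ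
  · simp [koszulSign, Fin.prod_univ_two, -zsmul_eq_mul]
  · simp [koszulSign, Fin.prod_univ_two, -zsmul_eq_mul, coe_negOnePow, mul_comm (d 1),
      skewTwo_comm hπ (hX 0) (hX 1)]

theorem skewThree_koszulSign (hH : IsOp 1 H) (d : Fin 3 → ℤ)
    (X : Fin 3 → List (g × V) → Module.End ℂ (g × V)) (hX : ∀ i, IsCochainOp (d i - 1) (X i))
    (σ : Equiv.Perm (Fin 3)) :
    skewThree H (d (σ 0)) (d (σ 1)) (d (σ 2)) (X (σ 0)) (X (σ 1)) (X (σ 2))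
      = (koszulSign d σ : ℤ) • skewThree H (d 0) (d 1) (d 2) (X 0) (X 1) (X 2) := by
  have e₁ := skewThree_comm_left hH (hX 0) (hX 1) (hX 2)
  have e₂ := skewThree_comm_right hH (hX 0) (hX 1) (hX 2)
  have e₃ := skewThree_comm_right hH (hX 1) (hX 0) (hX 2)
  have e₄ := skewThree_comm_left hH (hX 0) (hX 2) (hX 1)
  have e₅ := skewThree_comm_right hH (hX 2) (hX 0) (hX 1)
  obtain rfl | rfl | rfl | rfl | rfl | rfl := perm_fin_three σ <;>
    simp [koszulSign, Fin.prod_univ_three, -zsmul_eq_mul, coe_negOnePow, Equiv.swap_apply_def,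
      mul_comm (d 1) (d 0), mul_comm (d 2)]
  · rw [e₁]
  · rw [e₂]
  · rw [e₅, e₄, e₂]
    module
  · rw [e₃, e₁]
    module
  · rw [e₄, e₂]
    module

/-- The family of operations with the given binary and ternary ones, the others being zero. -/
def binaryTernary {E : Type*} [AddCommGroup E] [Module ℂ E]
    (l₂ : MultilinearMap ℂ (fun _ : Fin 2 => E) E) (l₃ : MultilinearMap ℂ (fun _ : Fin 3 => E) E) :
    (k : ℕ) → MultilinearMap ℂ (fun _ : Fin k => E) E
  | 2 => l₂
  | 3 => l₃
  | _ => 0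

theorem binaryTernary_eq_zero {E : Type*} [AddCommGroup E] [Module ℂ E]
    (l₂ : MultilinearMap ℂ (fun _ : Fin 2 => E) E) (l₃ : MultilinearMap ℂ (fun _ : Fin 3 => E) E)
    {k : ℕ} (h₂ : k ≠ 2) (h₃ : k ≠ 3) : binaryTernary l₂ l₃ k = 0 := by
  rcases k with _ | _ | _ | _ | k
  · rfl
  · rfl
  · exact absurd rfl h₂
  · exact absurd rfl h₃
  · rfl

theorem binaryTernary_comp_eq_zero {E : Type*} [AddCommGroup E] [Module ℂ E]
    (l₂ : MultilinearMap ℂ (fun _ : Fin 2 => E) E) (l₃ : MultilinearMap ℂ (fun _ : Fin 3 => E) E)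
    {i m : ℕ} (h : i ≠ 2 ∧ i ≠ 3 ∨ m + 1 ≠ 2 ∧ m + 1 ≠ 3) (x : Fin i → E) (y : Fin m → E) :
    binaryTernary l₂ l₃ (m + 1) (Fin.cons (binaryTernary l₂ l₃ i x) y) = 0 := by
  obtain h | h := h
  · rw [binaryTernary_eq_zero _ _ h.1 h.2]
    exact MultilinearMap.map_coord_zero _ 0 rfl
  · rw [binaryTernary_eq_zero _ _ h.1 h.2]
    rfl

theorem binaryTernary_summand_eq_zero {E : Type*} [AddCommGroup E] [Module ℂ E]
    (l₂ : MultilinearMap ℂ (fun _ : Fin 2 => E) E) (l₃ : MultilinearMap ℂ (fun _ : Fin 3 => E) E)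
    {n i : ℕ} (d : Fin n → ℤ) (x : Fin n → E) (h : 0 + i ≤ n) (h' : i + (n - i) ≤ n)
    (hi : i ≠ 2 ∧ i ≠ 3 ∨ n - i + 1 ≠ 2 ∧ n - i + 1 ≠ 3) :
    (if i = 0 then 0 else ((-1 : ℤ) ^ i) • ∑ σ ∈ unshuffles [i, n - i] n, koszulSign d σ •
      binaryTernary l₂ l₃ (n - i + 1) (Fin.cons (binaryTernary l₂ l₃ i (block (x ∘ σ) 0 i h))
        (block (x ∘ σ) i (n - i) h'))) = 0 := by
  split_ifs
  · rfl
  · rw [Finset.sum_eq_zero fun σ _ => ?_, smul_zero]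
    rw [binaryTernary_comp_eq_zero _ _ hi, smul_zero]

/-- The map `l` is the binary derived bracket of `π` on homogeneous cochains. -/
def IsSkewTwo (π : List (g × V) → Module.End ℂ (g × V))
    (l : MultilinearMap ℂ (fun _ : Fin 2 => CochainSpace g V) (CochainSpace g V)) : Prop :=
  ∀ (d : Fin 2 → ℤ) (x : Fin 2 → CochainSpace g V), (∀ i, x i ∈ cochainGrading g V (d i)) →
    toListOp g V (l x) = skewTwo π (d 0) (d 1) (toListOp g V (x 0)) (toListOp g V (x 1))

/-- The map `l` is the ternary derived bracket of `H` on homogeneous cochains. -/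
def IsSkewThree (H : List (g × V) → Module.End ℂ (g × V))
    (l : MultilinearMap ℂ (fun _ : Fin 3 => CochainSpace g V) (CochainSpace g V)) : Prop :=
  ∀ (d : Fin 3 → ℤ) (x : Fin 3 → CochainSpace g V), (∀ i, x i ∈ cochainGrading g V (d i)) →
    toListOp g V (l x) = skewThree H (d 0) (d 1) (d 2) (toListOp g V (x 0)) (toListOp g V (x 1))
      (toListOp g V (x 2))

variable {l₂ : MultilinearMap ℂ (fun _ : Fin 2 => CochainSpace g V) (CochainSpace g V)}
  {l₃ : MultilinearMap ℂ (fun _ : Fin 3 => CochainSpace g V) (CochainSpace g V)}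

theorem IsSkewTwo.mem (hl₂ : IsSkewTwo π l₂) (hπ : IsOp 1 π) (hG : PreservesG π) {d : Fin 2 → ℤ}
    {x : Fin 2 → CochainSpace g V} (hx : ∀ i, x i ∈ cochainGrading g V (d i)) :
    l₂ x ∈ cochainGrading g V (d 0 + d 1) := by
  have hX i := mem_cochainGrading_iff.1 (hx i)
  rw [mem_cochainGrading_iff, hl₂ d x hx]
  have h := (isCochainOp_bracket hπ hG (hX 0) (hX 1)).zsmul (paritySign (d 0 - 1))
  rwa [show 1 + (d 0 - 1) + (d 1 - 1) = d 0 + d 1 - 1 by ring] at h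

theorem IsSkewThree.mem (hl₃ : IsSkewThree H l₃) (hH : IsOp 1 H) {d : Fin 3 → ℤ}
    {x : Fin 3 → CochainSpace g V} (hx : ∀ i, x i ∈ cochainGrading g V (d i)) :
    l₃ x ∈ cochainGrading g V (d 0 + d 1 + d 2 - 1) := by
  have hX i := mem_cochainGrading_iff.1 (hx i)
  rw [mem_cochainGrading_iff, hl₃ d x hx]
  have h := (isCochainOp_bracket_bracket hH (hX 0) (hX 1) (hX 2)).zsmul (paritySign (d 1 - 1))
  rwa [show 1 + (d 0 - 1) + (d 1 - 1) + (d 2 - 1) = d 0 + d 1 + d 2 - 1 - 1 by ring] at h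

theorem IsSkewTwo.jacobi (hl₂ : IsSkewTwo π l₂) (hπ : IsOp 1 π) (hG : PreservesG π)
    (h : listBracket 1 1 π π = 0) (d : Fin 3 → ℤ) (x : Fin 3 → CochainSpace g V)
    (hx : ∀ i, x i ∈ cochainGrading g V (d i)) :
    ∑ σ ∈ unshuffles [2, 1] 3, koszulSign d σ •
      l₂ (Fin.cons (l₂ (block (x ∘ σ) 0 2 (by omega))) (block (x ∘ σ) 2 1 (by omega))) = 0 := by
  have hX i := mem_cochainGrading_iff.1 (hx i)
  have key := skewTwo_jacobi hπ hG h (hX 0) (hX 1) (hX 2)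
  simp only [sub_add_cancel] at key
  refine toListOp_injective ?_
  rw [map_sum, map_zero]
  refine Eq.trans (Finset.sum_congr rfl fun σ _ => ?_)
    ((sum_unshuffles_koszulSign (b := [2, 1]) rfl d (fun i => toListOp g V (x i)) _).trans key)
  have hd : ∀ i, block (x ∘ σ) 0 2 (by omega) i ∈ cochainGrading g V (![d (σ 0), d (σ 1)] i) :=
    Fin.forall_fin_two.2 ⟨hx _, hx _⟩
  rw [Units.smul_def, map_zsmul, Units.smul_def,
    hl₂ ![d (σ 0) + d (σ 1), d (σ 2)] _ (Fin.forall_fin_two.2 ⟨hl₂.mem hπ hG hd, hx _⟩)]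
  exact congrArg (fun X => _ • skewTwo π _ _ X _) (hl₂ _ _ hd)

theorem IsSkewTwo.jacobi_isSkewThree (hl₂ : IsSkewTwo π l₂) (hl₃ : IsSkewThree H l₃)
    (hπ : IsOp 1 π) (hG : PreservesG π) (hH : IsOp 1 H) (h : listBracket 1 1 π H = 0)
    (d : Fin 4 → ℤ) (x : Fin 4 → CochainSpace g V) (hx : ∀ i, x i ∈ cochainGrading g V (d i)) :
    ∑ σ ∈ unshuffles [2, 2] 4, koszulSign d σ •
        l₃ (Fin.cons (l₂ (block (x ∘ σ) 0 2 (by omega))) (block (x ∘ σ) 2 2 (by omega)))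
      - ∑ σ ∈ unshuffles [3, 1] 4, koszulSign d σ •
        l₂ (Fin.cons (l₃ (block (x ∘ σ) 0 3 (by omega))) (block (x ∘ σ) 3 1 (by omega))) = 0 := by
  have hX i := mem_cochainGrading_iff.1 (hx i)
  have key := skewTwo_skewThree_jacobi hπ hG hH h (hX 0) (hX 1) (hX 2) (hX 3)
  simp only [sub_add_cancel] at key
  refine toListOp_injective ?_
  rw [map_sub, map_sum, map_sum, map_zero]
  refine Eq.trans (congrArg₂ (· - ·) (Finset.sum_congr rfl fun σ _ => ?_)
    (Finset.sum_congr rfl fun σ _ => ?_)) ((congrArg₂ (· - ·)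
      (sum_unshuffles_koszulSign (b := [2, 2]) rfl d (fun i => toListOp g V (x i)) _)
      (sum_unshuffles_koszulSign (b := [3, 1]) rfl d (fun i => toListOp g V (x i)) _)).trans key)
  · have hd : ∀ i, block (x ∘ σ) 0 2 (by omega) i ∈ cochainGrading g V (![d (σ 0), d (σ 1)] i) :=
      Fin.forall_fin_two.2 ⟨hx _, hx _⟩
    rw [Units.smul_def, map_zsmul, Units.smul_def, hl₃ ![d (σ 0) + d (σ 1), d (σ 2), d (σ 3)] _
      (Fin.forall_fin_succ.2 ⟨hl₂.mem hπ hG hd, Fin.forall_fin_two.2 ⟨hx _, hx _⟩⟩)]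
    exact congrArg (fun X => _ • skewThree H _ _ _ X _ _) (hl₂ _ _ hd)
  · have hd : ∀ i, block (x ∘ σ) 0 3 (by omega) i
        ∈ cochainGrading g V (![d (σ 0), d (σ 1), d (σ 2)] i) :=
      Fin.forall_fin_succ.2 ⟨hx _, Fin.forall_fin_two.2 ⟨hx _, hx _⟩⟩
    rw [Units.smul_def, map_zsmul, Units.smul_def,
      hl₂ ![d (σ 0) + d (σ 1) + d (σ 2) - 1, d (σ 3)] _
        (Fin.forall_fin_two.2 ⟨hl₃.mem hH hd, hx _⟩)]
    exact congrArg (fun X => _ • skewTwo π _ _ X _) (hl₃ _ _ hd)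

theorem IsSkewThree.jacobi (hl₃ : IsSkewThree H l₃) (hH : IsOp 1 H)
    (h : listBracket 1 1 H H = 0) (d : Fin 5 → ℤ) (x : Fin 5 → CochainSpace g V)
    (hx : ∀ i, x i ∈ cochainGrading g V (d i)) :
    ∑ σ ∈ unshuffles [3, 2] 5, koszulSign d σ •
      l₃ (Fin.cons (l₃ (block (x ∘ σ) 0 3 (by omega))) (block (x ∘ σ) 3 2 (by omega))) = 0 := by
  have hX i := mem_cochainGrading_iff.1 (hx i)
  have key := skewThree_jacobi hH h (hX 0) (hX 1) (hX 2) (hX 3) (hX 4)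
  simp only [sub_add_cancel] at key
  refine toListOp_injective ?_
  rw [map_sum, map_zero]
  refine Eq.trans (Finset.sum_congr rfl fun σ _ => ?_)
    ((sum_unshuffles_koszulSign (b := [3, 2]) rfl d (fun i => toListOp g V (x i)) _).trans key)
  have hd : ∀ i, block (x ∘ σ) 0 3 (by omega) i
      ∈ cochainGrading g V (![d (σ 0), d (σ 1), d (σ 2)] i) :=
    Fin.forall_fin_succ.2 ⟨hx _, Fin.forall_fin_two.2 ⟨hx _, hx _⟩⟩
  rw [Units.smul_def, map_zsmul, Units.smul_def,
    hl₃ ![d (σ 0) + d (σ 1) + d (σ 2) - 1, d (σ 3), d (σ 4)] _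
      (Fin.forall_fin_succ.2 ⟨hl₃.mem hH hd, Fin.forall_fin_two.2 ⟨hx _, hx _⟩⟩)]
  exact congrArg (fun X => _ • skewThree H _ _ _ X _ _) (hl₃ _ _ hd)

theorem binaryTernary_mem (hl₂ : IsSkewTwo π l₂) (hl₃ : IsSkewThree H l₃) (hπ : IsOp 1 π)
    (hG : PreservesG π) (hH : IsOp 1 H) (k : ℕ) (d : Fin k → ℤ) (x : Fin k → CochainSpace g V)
    (hx : ∀ i, x i ∈ cochainGrading g V (d i)) :
    binaryTernary (E := CochainSpace g V) l₂ l₃ k x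
      ∈ cochainGrading g V ((∑ i, d i) + (2 - (k : ℤ))) := by
  rcases k with _ | _ | _ | _ | k
  · exact zero_mem _
  · exact zero_mem _
  · have h := hl₂.mem hπ hG hx
    rw [show d 0 + d 1 = (∑ i, d i) + (2 - ((0 + 1 + 1 : ℕ) : ℤ)) by simp [Fin.sum_univ_two]] at h
    exact h
  · have h := hl₃.mem hH hx
    rw [show d 0 + d 1 + d 2 - 1 = (∑ i, d i) + (2 - ((0 + 1 + 1 + 1 : ℕ) : ℤ)) by
      simp [Fin.sum_univ_three]; ring] at h
    exact h
  · exact zero_mem _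

theorem binaryTernary_skew (hl₂ : IsSkewTwo π l₂) (hl₃ : IsSkewThree H l₃) (hπ : IsOp 1 π)
    (hH : IsOp 1 H) (k : ℕ) (d : Fin k → ℤ) (x : Fin k → CochainSpace g V)
    (hx : ∀ i, x i ∈ cochainGrading g V (d i)) (σ : Equiv.Perm (Fin k)) :
    binaryTernary (E := CochainSpace g V) l₂ l₃ k (x ∘ σ)
      = koszulSign d σ • binaryTernary (E := CochainSpace g V) l₂ l₃ k x := by
  have hX i := mem_cochainGrading_iff.1 (hx i)
  rcases k with _ | _ | _ | _ | k
  · exact (smul_zero _).symm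
  · exact (smul_zero _).symm
  · refine toListOp_injective ?_
    rw [Units.smul_def, map_zsmul]
    exact (hl₂ (d ∘ σ) (x ∘ σ) fun i => hx _).trans
      ((skewTwo_koszulSign hπ d _ hX σ).trans (congrArg _ (hl₂ d x hx).symm))
  · refine toListOp_injective ?_
    rw [Units.smul_def, map_zsmul]
    exact (hl₃ (d ∘ σ) (x ∘ σ) fun i => hx _).trans
      ((skewThree_koszulSign hH d _ hX σ).trans (congrArg _ (hl₃ d x hx).symm))
  · exact (smul_zero _).symm

/-- A summand can be nonzero only if i and j are both 2 or 3, and then n = i + j - 1 is 3, 4 or 5.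
Each value of n uses one of the three commutation relations. -/
theorem binaryTernary_jacobi (hl₂ : IsSkewTwo π l₂) (hl₃ : IsSkewThree H l₃) (hπ : IsOp 1 π)
    (hG : PreservesG π) (hH : IsOp 1 H) (hππ : listBracket 1 1 π π = 0)
    (hπH : listBracket 1 1 π H = 0) (hHH : listBracket 1 1 H H = 0) (n : ℕ) (d : Fin n → ℤ)
    (x : Fin n → CochainSpace g V) (hx : ∀ i, x i ∈ cochainGrading g V (d i)) :
    ∑ i : Fin (n + 1), (if (i : ℕ) = 0 then 0 else ((-1 : ℤ) ^ (i : ℕ)) •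
      ∑ σ ∈ unshuffles [(i : ℕ), n - i] n, koszulSign d σ •
        binaryTernary (E := CochainSpace g V) l₂ l₃ (n - i + 1)
          (Fin.cons (binaryTernary (E := CochainSpace g V) l₂ l₃ i
            (block (x ∘ σ) 0 i (by omega))) (block (x ∘ σ) i (n - i) (by omega)))) = 0 := by
  have vanish (i : Fin (n + 1)) := binaryTernary_summand_eq_zero l₂ l₃ d x (i := i)
    (by have := i.2; omega) (by have := i.2; omega)
  by_cases h₃ : n = 3
  · subst h₃
    rw [Fintype.sum_eq_single (2 : Fin 4) fun i hi => vanish i (by omega)]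
    exact (congrArg ((-1 : ℤ) ^ 2 • ·) (hl₂.jacobi hπ hG hππ d x hx)).trans (smul_zero _)
  by_cases h₄ : n = 4
  · subst h₄
    rw [Fintype.sum_eq_add (2 : Fin 5) 3 (by decide) fun i hi => vanish i (by omega)]
    have aux {a b : CochainSpace g V} (h : a - b = 0) : (-1 : ℤ) ^ 2 • a + (-1 : ℤ) ^ 3 • b = 0 := by
      rw [← h]; module
    exact aux (hl₂.jacobi_isSkewThree hl₃ hπ hG hH hπH d x hx)
  by_cases h₅ : n = 5
  · subst h₅
    rw [Fintype.sum_eq_single (3 : Fin 6) fun i hi => vanish i (by omega)]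
    exact (congrArg ((-1 : ℤ) ^ 3 • ·) (hl₃.jacobi hH hHH d x hx)).trans (smul_zero _)
  exact Finset.sum_eq_zero fun i _ => vanish i (by omega)

/-- The L-infinity algebra whose brackets are the derived brackets of `π` and `H`. -/
def derivedStructure (hl₂ : IsSkewTwo π l₂) (hl₃ : IsSkewThree H l₃) (hπ : IsOp 1 π)
    (hG : PreservesG π) (hH : IsOp 1 H) (hππ : listBracket 1 1 π π = 0)
    (hπH : listBracket 1 1 π H = 0) (hHH : listBracket 1 1 H H = 0) :
    LInftyStructure (E := CochainSpace g V) (cochainGrading g V) where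
  isInternal := isInternal_cochainGrading
  l := binaryTernary (E := CochainSpace g V) l₂ l₃
  degree k _ := binaryTernary_mem hl₂ hl₃ hπ hG hH k
  skew k _ := binaryTernary_skew hl₂ hl₃ hπ hH k
  jacobi n _ := binaryTernary_jacobi hl₂ hl₃ hπ hG hH hππ hπH hHH n

theorem exists_lInftyStructure (hπ : IsOp 1 π) (hG : PreservesG π) (hH : IsOp 1 H)
    (hππ : listBracket 1 1 π π = 0) (hπH : listBracket 1 1 π H = 0)
    (hHH : listBracket 1 1 H H = 0) :
    ∃ A : LInftyStructure (E := CochainSpace g V) (cochainGrading g V),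
      A.l 1 = 0 ∧ (∀ k, 4 ≤ k → A.l k = 0) ∧ IsSkewTwo π (A.l 2) ∧ IsSkewThree H (A.l 3) := by
  obtain ⟨l₂, hl₂⟩ := exists_skewTwo hπ hG
  obtain ⟨l₃, hl₃⟩ := exists_skewThree hH
  refine ⟨derivedStructure hl₂ hl₃ hπ hG hH hππ hπH hHH, rfl, fun k hk => ?_, hl₂, hl₃⟩
  rcases k with _ | _ | _ | _ | k
  · omega
  · omega
  · omega
  · omega
  · rfl

end LInfinity

/-! ### The explicit ternary bracket -/

section BlockSums

variable {α M : Type*} [AddCommGroup M]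

theorem conv_conv_comm (X : List α → List α → List α → List α → M) (l l' : List α) :
    conv (fun A B => conv (fun C D => X A B C D) l') l
      = conv (fun C D => conv (fun A B => X A B C D) l) l' := by
  induction l' generalizing X with
  | nil => rfl
  | cons x l' ih =>
    simp only [conv_cons, conv_add]
    rw [ih, ih fun A B C D => (-1 : ℤ) ^ C.length • X A B C (x :: D)]
    simp only [conv_zsmul]

theorem convBlocks_eq_conv {m : ℕ} {b : List ℕ} {Φ : List α → M} {Ψ : List α → List α → M}
    {l : List α} (h : ∀ A B, A.length = m → m + B.length = l.length →
      convBlocks b (fun r => Φ (A ++ r)) B = Ψ A B)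
    (h₀ : ∀ A B, A.length ≠ m → Ψ A B = 0) : convBlocks (m :: b) Φ l = conv Ψ l := by
  rw [convBlocks_cons]
  refine conv_congr fun A B hl => ?_
  split_ifs with hA
  · exact h A B hA (by omega)
  · exact (h₀ A B hA).symm

theorem conv_eq_zero {Φ : List α → List α → M} (h : ∀ A B, Φ A B = 0) (l : List α) :
    conv Φ l = 0 :=
  split_eq_zero _ fun A B _ => h A B

theorem listOne_of_ne {W : Type*} [AddCommGroup W] {l : List W} (h : l.length ≠ 1) :
    listOne l = 0 := by
  rcases l with _ | ⟨c, _ | ⟨c', l⟩⟩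
  · rfl
  · exact absurd rfl h
  · rfl

omit [AddCommGroup M] in
theorem take_drop_eq {X Y Z L : List α} {k n : ℕ} (hL : L = X ++ (Y ++ Z)) (hX : X.length = k)
    (hY : Y.length = n) : (L.drop k).take n = Y := by
  subst hL hX hY
  simp

end BlockSums

/-! ### Insertion of two operations in a bilinear one. -/

section WeightCirc

variable {W M : Type*} [AddCommGroup W] [Module ℂ W] [AddCommGroup M] [Module ℂ M]

theorem map_outer (φ : W →ₗ[ℂ] M) (Q : List W → Module.End ℂ W) (l : List W) :
    φ (outer Q l) = conv (fun A B => φ (Q A (listOne B))) l :=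
  map_conv φ _ l

/-- The operation obtained by inserting `Q` and `R` in a bilinear operation. -/
def pairing (β : W →ₗ[ℂ] Module.End ℂ W) (Q R : List W → Module.End ℂ W) (l : List W) :
    Module.End ℂ W :=
  conv (fun A B => β (outer Q A) * R B) l

theorem map_pairing (φ : W →ₗ[ℂ] M) (β : W →ₗ[ℂ] Module.End ℂ W) (Q R : List W → Module.End ℂ W)
    (l : List W) (y : W) :
    φ (pairing β Q R l y)
      = conv (fun A B => conv (fun C D => φ (β (Q C (listOne D)) (R B y))) A) l := by
  refine (map_conv (φ ∘ₗ LinearMap.applyₗ y) _ l).trans (conv_congr fun A B _ => ?_)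
  exact map_outer (φ ∘ₗ LinearMap.applyₗ (R B y) ∘ₗ β) Q A

variable {P Q R : List W → Module.End ℂ W}

/-- Coassociativity flattens the nested splittings into five consecutive blocks: the arguments of Q
and its last one, those of R and its last one, and the rest. This is the shape of the unshuffles in
`insertSkew`. -/
theorem conv_outer_pairing (hP : IsMulti P) (β : W →ₗ[ℂ] Module.End ℂ W) (y : W) (l : List W) :
    conv (fun A B => P (outer (pairing β Q R) A :: B) y) l
      = conv (fun A r => conv (fun B r => conv (fun C r => conv (fun D E =>
          P (β (Q A (listOne B)) (R C (listOne D)) :: E) y) r) r) r) l := by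
  have h (A B : List W) : P (outer (pairing β Q R) A :: B) y
      = conv (fun E D => conv (fun G K => conv (fun M N =>
          P (β (Q M (listOne N)) (R K (listOne D)) :: B) y) G) E) A := by
    rw [← hP.head_apply]
    refine (map_outer (LinearMap.applyₗ y ∘ₗ hP.head B) _ A).trans (conv_congr fun E D _ => ?_)
    exact map_pairing (LinearMap.applyₗ y ∘ₗ hP.head B) β Q R E _
  simp only [h]
  rw [← conv_assoc]
  have h₁ (E r : List W) :
      conv (fun D B => conv (fun G K => conv (fun M N =>
        P (β (Q M (listOne N)) (R K (listOne D)) :: B) y) G) E) r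
      = conv (fun G K => conv (fun M N => conv (fun D B =>
        P (β (Q M (listOne N)) (R K (listOne D)) :: B) y) r) G) E := by
    rw [conv_conv_comm]
    exact conv_congr fun G K _ => conv_conv_comm _ _ _
  simp only [h₁]
  rw [← conv_assoc]
  have h₂ (G r : List W) :
      conv (fun K r => conv (fun M N => conv (fun D B =>
        P (β (Q M (listOne N)) (R K (listOne D)) :: B) y) r) G) r
      = conv (fun M N => conv (fun K r => conv (fun D B =>
        P (β (Q M (listOne N)) (R K (listOne D)) :: B) y) r) r) G :=
    conv_conv_comm _ _ _
  simp only [h₂]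
  rw [← conv_assoc]

theorem conv_pairing (P : List W → Module.End ℂ W) (β : W →ₗ[ℂ] Module.End ℂ W) (y : W)
    (l : List W) :
    conv (fun A B => P A (pairing β Q R B y)) l
      = conv (fun A r => conv (fun B r => conv (fun C D =>
          P A (β (Q B (listOne C)) (R D y))) r) r) l :=
  conv_congr fun A B _ => by rw [map_pairing, ← conv_assoc]

end WeightCirc

/-! ### The explicit insertions as sums over splittings. -/

section Insert

variable {g V : Type*} [LeftPreLieRing g] [LeftPreLieAlgebra ℂ g] [AddCommGroup V] [Module ℂ V]
variable {a b c : ℕ}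

theorem Cochain.listOp_zero_cons {m : ℕ} (P : Cochain g V m) (l : List (g × V)) :
    P.listOp (0 :: l) = 0 := by
  rw [← P.isMulti_listOp.head_apply, map_zero]

theorem insertSkew_eq_conv (H : g →ₗ[ℂ] g →ₗ[ℂ] V) (P : Cochain g V a) (Q : Cochain g V b)
    (R : Cochain g V c) (x : Fin (a + b + c + 1) → g × V) (y : g × V) :
    ((insertSkew H P Q R (fun i => (x i).2) y.2, 0) : g × V)
      = conv (fun A B => P.listOp (outer (pairing (weightProduct H) Q.listOp R.listOp) A :: B) y)
          (List.ofFn x) := by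
  rcases a with _ | a
  · refine (conv_eq_zero (fun A B => ?_) _).symm
    rw [P.listOp_of_ne (by simp), LinearMap.zero_apply]
  rw [conv_outer_pairing P.isMulti_listOp]
  have key := sum_unshuffles_sign (b := [b, 1, c, 1, a]) (n := a + 1 + b + c + 1)
    (by simp; omega) x fun l => P.listOp (weightProduct H
      (Q.listOp ((l.drop 0).take b) (listOne ((l.drop b).take 1)))
      (R.listOp ((l.drop (b + 1)).take c) (listOne ((l.drop (b + 1 + c)).take 1)))
        :: (l.drop (b + 1 + c + 1)).take a) y
  refine Eq.trans ?_ (key.trans ?_)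
  · rw [insertSkew]
    refine (map_sum (LinearMap.inl ℂ g V) _ _).trans (Finset.sum_congr rfl fun σ _ => ?_)
    rw [Units.smul_def, map_zsmul, Units.smul_def]
    congr 1
    rw [← ofFn_block (x ∘ σ) 0 b (by omega), ← ofFn_block (x ∘ σ) (b + 1) c (by omega),
      ← ofFn_block (x ∘ σ) (b + 1 + c + 1) a (by omega), ← listOne_ofFn (x ∘ σ) b (by omega),
      ← listOne_ofFn (x ∘ σ) (b + 1 + c) (by omega), Cochain.listOp_apply, Cochain.listOp_apply,
      ← List.ofFn_cons, Cochain.listOp_apply]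
    refine congrArg (fun z => ((P z y.2, 0) : g × V)) (funext fun i => ?_)
    exact Fin.cases rfl (fun _ => rfl) i
  · refine convBlocks_eq_conv (fun A r hA hr => convBlocks_eq_conv (fun B r' hB hr' =>
      convBlocks_eq_conv (fun C r'' hC hr'' => convBlocks_eq_conv (fun D E hD hE => ?_) ?_) ?_) ?_)
        ?_
    · rw [List.length_ofFn] at hr
      rw [convBlocks_singleton, if_pos (by omega)]
      obtain ⟨L, hL⟩ : ∃ L, L = A ++ (B ++ (C ++ (D ++ E))) := ⟨_, rfl⟩
      simp only [← hL]
      rw [take_drop_eq (X := []) (Y := A) (Z := B ++ (C ++ (D ++ E))) hL List.length_nil hA,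
        take_drop_eq (X := A) (Y := B) (Z := C ++ (D ++ E)) hL hA hB,
        take_drop_eq (X := A ++ B) (Y := C) (Z := D ++ E) (by simp [hL])
          (by simp only [List.length_append, hA, hB]) hC,
        take_drop_eq (X := A ++ B ++ C) (Y := D) (Z := E) (by simp [hL])
          (by simp only [List.length_append, hA, hB, hC]) hD,
        take_drop_eq (X := A ++ B ++ C ++ D) (Y := E) (Z := []) (by simp [hL])
          (by simp only [List.length_append, hA, hB, hC, hD]) (by omega)]
    · intro D E hD
      rw [listOne_of_ne hD, map_zero, map_zero, P.listOp_zero_cons, LinearMap.zero_apply]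
    · refine fun C _ hC => conv_eq_zero (fun D E => ?_) _
      rw [R.listOp_of_ne (Ne.symm hC), LinearMap.zero_apply, map_zero, P.listOp_zero_cons,
        LinearMap.zero_apply]
    · refine fun B _ hB => conv_eq_zero (fun C _ => conv_eq_zero (fun D E => ?_) _) _
      rw [listOne_of_ne hB, map_zero, map_zero, LinearMap.zero_apply, P.listOp_zero_cons,
        LinearMap.zero_apply]
    · refine fun A _ hA => conv_eq_zero (fun B _ => conv_eq_zero (fun C _ =>
        conv_eq_zero (fun D E => ?_) _) _) _
      rw [Q.listOp_of_ne (Ne.symm hA), LinearMap.zero_apply, map_zero, LinearMap.zero_apply,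
        P.listOp_zero_cons, LinearMap.zero_apply]

theorem insertLast_eq_conv (H : g →ₗ[ℂ] g →ₗ[ℂ] V) (P : Cochain g V a) (Q : Cochain g V b)
    (R : Cochain g V c) (x : Fin (a + b + c + 1) → g × V) (y : g × V) :
    ((insertLast H P Q R (fun i => (x i).2) y.2, 0) : g × V)
      = conv (fun A B => P.listOp A (pairing (weightProduct H) Q.listOp R.listOp B y))
          (List.ofFn x) := by
  rw [conv_pairing]
  have key := sum_unshuffles_sign (b := [a, b, 1, c]) (n := a + b + c + 1)
    (by simp; omega) x fun l => P.listOp ((l.drop 0).take a) (weightProduct H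
      (Q.listOp ((l.drop a).take b) (listOne ((l.drop (a + b)).take 1)))
      (R.listOp ((l.drop (a + b + 1)).take c) y))
  refine Eq.trans ?_ (key.trans ?_)
  · rw [insertLast]
    refine (map_sum (LinearMap.inl ℂ g V) _ _).trans (Finset.sum_congr rfl fun σ _ => ?_)
    rw [Units.smul_def, map_zsmul, Units.smul_def]
    congr 1
    rw [← ofFn_block (x ∘ σ) 0 a (by omega), ← ofFn_block (x ∘ σ) a b (by omega),
      ← ofFn_block (x ∘ σ) (a + b + 1) c (by omega), ← listOne_ofFn (x ∘ σ) (a + b) (by omega),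
      Cochain.listOp_apply, Cochain.listOp_apply, Cochain.listOp_apply]
    rfl
  · refine convBlocks_eq_conv (fun A r hA hr => convBlocks_eq_conv (fun B r' hB hr' =>
      convBlocks_eq_conv (fun C D hC hD => ?_) ?_) ?_) ?_
    · rw [List.length_ofFn] at hr
      rw [convBlocks_singleton, if_pos (by omega)]
      obtain ⟨L, hL⟩ : ∃ L, L = A ++ (B ++ (C ++ D)) := ⟨_, rfl⟩
      simp only [← hL]
      rw [take_drop_eq (X := []) (Y := A) (Z := B ++ (C ++ D)) hL List.length_nil hA,
        take_drop_eq (X := A) (Y := B) (Z := C ++ D) hL hA hB,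
        take_drop_eq (X := A ++ B) (Y := C) (Z := D) (by simp [hL])
          (by simp only [List.length_append, hA, hB]) hC,
        take_drop_eq (X := A ++ B ++ C) (Y := D) (Z := []) (by simp [hL])
          (by simp only [List.length_append, hA, hB, hC])
          (by omega)]
    · intro C D hC
      rw [listOne_of_ne hC, map_zero, map_zero, LinearMap.zero_apply, map_zero]
    · refine fun B _ hB => conv_eq_zero (fun C D => ?_) _
      rw [Q.listOp_of_ne (Ne.symm hB), LinearMap.zero_apply, map_zero, LinearMap.zero_apply,
        map_zero]
    · refine fun A _ hA => conv_eq_zero (fun B _ => conv_eq_zero (fun C D => ?_) _) _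
      rw [P.listOp_of_ne (Ne.symm hA), LinearMap.zero_apply]

end Insert

/-! ### Comparison of the triple bracket with its explicit formula. -/

section Ternary

variable {g V : Type*} [LeftPreLieRing g] [LeftPreLieAlgebra ℂ g] [AddCommGroup V] [Module ℂ V]
variable {a b c : ℕ}

/-- There are two ways to place P and Q in the two arguments of the bilinear operation. The second
sign includes the exchange of the p + 1 arguments of P in the skew position with the q of Q. -/
theorem circ_circ_eq_pairing {P Q : List (g × V) → Module.End ℂ (g × V)} {p q : ℤ}
    (β : g × V →ₗ[ℂ] Module.End ℂ (g × V)) (hP : IsCochainOp p P) (hQ : IsCochainOp q Q) :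
    binaryOp β ⋄ P ⋄ Q
      = paritySign p • pairing β Q P + paritySign ((p + 1) * q) • pairing β P Q := by
  funext l
  rw [circ_circ_apply (isOp_binaryOp β) hP hQ.maps, conv_add, conv_zsmul, Pi.add_apply,
    Pi.smul_apply, Pi.smul_apply]
  refine congrArg₂ _ rfl ?_
  rw [pairing, conv_comm, ← conv_zsmul]
  refine conv_congr fun A B _ => ?_
  by_cases hA : (A.length : ℤ) = p + 1
  · by_cases hB : (B.length : ℤ) = q
    · rw [neg_one_pow_eq_paritySign, Nat.cast_mul, hA, hB]
      rfl
    · rw [hQ.isOp.supp B hB, mul_zero, mul_zero, smul_zero, smul_zero]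
  · rw [outer_supp hP.isOp hA, map_zero, zero_mul, smul_zero]
    simp [binaryOp, listOne]

theorem listOp_circ_pairing (H : g →ₗ[ℂ] g →ₗ[ℂ] V) (P : Cochain g V a) (Q : Cochain g V b)
    (R : Cochain g V c) (x : Fin (a + b + c + 1) → g × V) (y : g × V) :
    (P.listOp ⋄ pairing (weightProduct H) Q.listOp R.listOp) (List.ofFn x) y
      = (insertSkew H P Q R (fun i => (x i).2) y.2
          + paritySign (a * (b + c + 1)) • insertLast H P Q R (fun i => (x i).2) y.2, 0) := by
  have h : ((insertSkew H P Q R (fun i => (x i).2) y.2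
      + paritySign (a * (b + c + 1)) • insertLast H P Q R (fun i => (x i).2) y.2, 0) : g × V)
      = (insertSkew H P Q R (fun i => (x i).2) y.2, 0)
        + paritySign (a * (b + c + 1)) • (insertLast H P Q R (fun i => (x i).2) y.2, 0) := by
    simp
  rw [h, insertSkew_eq_conv, insertLast_eq_conv,
    conv_comm fun A B => P.listOp A (pairing (weightProduct H) Q.listOp R.listOp B y),
    ← conv_zsmul, ← conv_add, circ]
  refine (map_conv (LinearMap.applyₗ (R := ℂ) y) _ _).trans (conv_congr fun A B hl => ?_)
  rw [LinearMap.applyₗ_apply_apply, LinearMap.add_apply, Module.End.mul_apply]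
  congr 1
  by_cases hB : a = B.length
  · rw [List.length_ofFn] at hl
    rw [neg_one_pow_eq_paritySign, ← hB, show A.length = b + c + 1 by omega, ← mul_smul]
    push_cast
    rw [mul_comm (a : ℤ), paritySign_mul_self, one_smul]
  · simp [P.listOp_of_ne hB]

/-- The twelve terms count three choices of the outer cochain, two orders of the inner ones in H,
and insertion in a skew or the last argument. Their signs depend only on the parities of a, b, c. -/
theorem skewThree_listOp (H : g →ₗ[ℂ] g →ₗ[ℂ] V) (P : Cochain g V a) (Q : Cochain g V b)
    (R : Cochain g V c) (x : Fin (a + b + c + 1) → g × V) (y : g × V) :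
    skewThree (binaryOp (weightProduct H)) (a + 1) (b + 1) (c + 1) P.listOp Q.listOp R.listOp
      (List.ofFn x) y = (ternaryBracket H P Q R (fun i => (x i).2) y.2, 0) := by
  have hP := P.isCochainOp_listOp
  have hQ := Q.isCochainOp_listOp
  have hR := R.isCochainOp_listOp
  have h₁ := listOp_circ_pairing H P Q R x y
  have h₂ := listOp_circ_pairing H P R Q (x ∘ Fin.cast (by omega)) y
  have h₃ := listOp_circ_pairing H Q P R (x ∘ Fin.cast (by omega)) y
  have h₄ := listOp_circ_pairing H Q R P (x ∘ Fin.cast (by omega)) y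
  have h₅ := listOp_circ_pairing H R P Q (x ∘ Fin.cast (by omega)) y
  have h₆ := listOp_circ_pairing H R Q P (x ∘ Fin.cast (by omega)) y
  rw [ofFn_comp_cast] at h₂ h₃ h₄ h₅ h₆
  rw [skewThree]
  simp only [add_sub_cancel_right]
  rw [bracket_bracket_bracket (isOp_binaryOp _) hP hQ hR, circ_circ_eq_pairing _ hQ hR,
    circ_circ_eq_pairing _ hP hR, circ_circ_eq_pairing _ hP hQ]
  simp only [circ_add P.isMulti_listOp, circ_add Q.isMulti_listOp, circ_add R.isMulti_listOp,
    circ_zsmul P.isMulti_listOp, circ_zsmul Q.isMulti_listOp, circ_zsmul R.isMulti_listOp,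
    Pi.add_apply, Pi.smul_apply, Pi.neg_apply, LinearMap.add_apply, LinearMap.smul_apply,
    LinearMap.neg_apply, h₁, h₂, h₃, h₄, h₅, h₆, ternaryBracket, neg_one_pow_eq_paritySign]
  ext
  · simp only [Prod.fst_add, Prod.smul_fst, Prod.fst_neg, Function.comp_def, paritySign,
      Int.even_add, Int.even_mul, Nat.cast_add, Nat.cast_mul, Nat.cast_one, Int.not_even_one]
    by_cases ha : Even (a : ℤ) <;> by_cases hb : Even (b : ℤ) <;> by_cases hc : Even (c : ℤ) <;>
      simp only [ha, hb, hc, if_true, if_false, iff_true, iff_false, not_true, or_true, or_false,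
        one_smul, neg_smul] <;> abel
  · simp

end Ternary

/-! ### Maurer-Cartan elements -/

theorem LInftyStructure.isMaurerCartan_iff {E : Type*} [AddCommGroup E] [Module ℂ E]
    {𝒜 : ℤ → Submodule ℂ E} (A : LInftyStructure 𝒜) (h₁ : A.l 1 = 0)
    (h₄ : ∀ k, 4 ≤ k → A.l k = 0) (α : E) :
    A.IsMaurerCartan α ↔ α ∈ 𝒜 1 ∧
      (2 : ℂ)⁻¹ • A.l 2 (fun _ => α) + (6 : ℂ)⁻¹ • A.l 3 (fun _ => α) = 0 := by
  have h₃ : ∑ k ∈ Finset.Icc 1 3, ((Nat.factorial k : ℂ)⁻¹) • A.l k (fun _ => α)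
      = (2 : ℂ)⁻¹ • A.l 2 (fun _ => α) + (6 : ℂ)⁻¹ • A.l 3 (fun _ => α) := by
    rw [show Finset.Icc 1 3 = {1, 2, 3} from rfl, Finset.sum_insert (by decide),
      Finset.sum_insert (by decide), Finset.sum_singleton, h₁]
    simp [Nat.factorial]
  have h₅ (k : ℕ) (hk : 3 < k) : A.l k (fun _ => α) = 0 := by rw [h₄ k hk]; rfl
  refine and_congr_right fun _ => ⟨?_, fun h => ⟨3, h₅, h₃.trans h⟩⟩
  rintro ⟨N, hN, h⟩
  -- The bound N is arbitrary and may be below 3, so both sums are extended to max(3, N), where the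
  -- added terms vanish.
  rw [← h₃, ← h, Finset.sum_subset (Finset.Icc_subset_Icc_right (le_max_left 3 N)) fun k _ hk => ?_,
    Finset.sum_subset (Finset.Icc_subset_Icc_right (le_max_right 3 N)) fun k _ hk => ?_]
  · rw [hN k (by simp_all), smul_zero]
  · rw [h₅ k (by simp_all), smul_zero]

section MaurerCartan

variable {g V : Type*} [LeftPreLieRing g] [LeftPreLieAlgebra ℂ g] [AddCommGroup V] [Module ℂ V]

theorem circ_apply_one {W : Type*} [AddCommGroup W] [Module ℂ W]
    {P : List W → Module.End ℂ W} (hP : IsMulti P) (Q : List W → Module.End ℂ W) (x y : W) :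
    (P ⋄ Q) [x] y = P [Q [] x] y + P [] (Q [x] y) + P [x] (Q [] y) := by
  have h : P [0, x] = 0 := by rw [← hP.head_apply, map_zero]
  simp [circ, outer, conv_cons, conv_nil, listOne, h, add_assoc]

theorem eq_zero_iff_of_mem {m : ℕ} {x : CochainSpace g V} (hx : x ∈ cochainGrading g V (m + 1)) :
    x = 0 ↔ ∀ (u : Fin m → V) (v : V),
      toListOp g V x (List.ofFn fun i => ((0 : g), u i)) (0, v) = 0 := by
  refine ⟨fun h u v => by rw [h, map_zero]; rfl, fun h => DFinsupp.ext fun k => ?_⟩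
  by_cases hk : k = m
  · subst hk
    refine AlternatingMap.ext fun u => LinearMap.ext fun v => ?_
    have := h u v
    have e := listOp_eq_ite x k (List.ofFn fun i => ((0 : g), u i))
    rw [if_pos (by simp)] at e
    rw [← e, Cochain.listOp_apply] at this
    exact congrArg Prod.fst this
  · exact hx k (by omega)

/-- A linear map `V → g` as an alternating map of degree `0`. -/
abbrev constCochain (K : V →ₗ[ℂ] g) : Cochain g V 0 := AlternatingMap.constOfIsEmpty ℂ V (Fin 0) K

theorem listOp_constCochain_nil (K : V →ₗ[ℂ] g) (y : g × V) :
    (constCochain K).listOp [] y = (K y.2, 0) :=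
  (constCochain K).listOp_apply Fin.elim0 y

theorem skewTwo_constCochain (ρ : PreLieRep g V) (K : V →ₗ[ℂ] g) (u v : V) :
    skewTwo (binaryOp ρ.product) 1 1 (constCochain K).listOp (constCochain K).listOp
      [(0, u)] (0, v) = (2 : ℂ) • (K u * K v - K (ρ.L (K u) v + ρ.R (K v) u), 0) := by
  have hπ := isOp_binaryOp ρ.product
  have hK := (constCochain K).isMulti_listOp
  have hK₁ (x : g × V) : (constCochain K).listOp [x] = 0 := Cochain.listOp_of_ne _ (by simp)
  have h₀ : paritySign 0 = 1 := rfl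
  -- Bracketing with K measures how far it is from a derivation. A second bracket produces Kx · Ky
  -- twice, once from each argument, and each correction term twice as well.
  have hf (x y : g × V) : listBracket 1 0 (binaryOp ρ.product) (constCochain K).listOp [x] y
      = ρ.product (K x.2, 0) y + ρ.product x (K y.2, 0) - (K (ρ.product x y).2, 0) := by
    simp [listBracket, circ_apply_one hπ.multi, circ_apply_one hK, listOp_constCochain_nil, hK₁,
      h₀, binaryOp, listOne]
  have hb : IsOp 1 (listBracket 1 0 (binaryOp ρ.product) (constCochain K).listOp) :=
    hπ.bracket (constCochain K).isCochainOp_listOp.isOp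
  have h : skewTwo (binaryOp ρ.product) 1 1 (constCochain K).listOp (constCochain K).listOp
      = listBracket 1 0 (binaryOp ρ.product) (constCochain K).listOp ⋄ (constCochain K).listOp
        - (constCochain K).listOp ⋄
          listBracket 1 0 (binaryOp ρ.product) (constCochain K).listOp := by
    simp [skewTwo, listBracket, h₀]
  rw [h, Pi.sub_apply, LinearMap.sub_apply, circ_apply_one hb.multi, circ_apply_one hK,
    hb.supp [] (by simp)]
  simp only [hf, hK₁, listOp_constCochain_nil, PreLieRep.product_apply]
  ext
  · simp
    module
  · simp

/-- K has no skew argument, so only the six insertions in the last argument remain, and for p = q =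
r = 1 all their exponents are odd. -/
theorem ternaryBracket_constCochain (H : g →ₗ[ℂ] g →ₗ[ℂ] V) (K : V →ₗ[ℂ] g)
    (u : Fin 1 → V) (v : V) :
    ternaryBracket H (constCochain K) (constCochain K) (constCochain K) u v
      = (-6 : ℂ) • K (H (K (u 0)) (K v)) := by
  have h : unshuffles [0, 0, 1, 0] 1 = {1} := by decide
  simp [ternaryBracket, insertSkew, insertLast, h]
  module

theorem toListOp_lift (x : CochainSpace g V) {m : ℕ} (u : Fin m → g × V) (v : g × V) :
    Cochain.lift (x m) u v = toListOp g V x (List.ofFn u) v := by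
  rw [(x m).represents_lift u v, listOp_eq_ite, if_pos (by simp)]

theorem toListOp_apply_fst (x : CochainSpace g V) {m : ℕ} (u : Fin m → V) (v : V) :
    (toListOp g V x (List.ofFn fun i => ((0 : g), u i)) (0, v)).1 = x m u v := by
  rw [← toListOp_lift]
  rfl

theorem linearCochain_mem (K : V →ₗ[ℂ] g) : linearCochain K ∈ cochainGrading g V 1 :=
  toSpace_mem_cochainGrading (constCochain K)

theorem isReynolds_iff_isMaurerCartan (ρ : PreLieRep g V) (H : g →ₗ[ℂ] g →ₗ[ℂ] V)
    (A : LInftyStructure (E := CochainSpace g V) (cochainGrading g V)) (h₁ : A.l 1 = 0)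
    (h₄ : ∀ k, 4 ≤ k → A.l k = 0) (h₂ : IsSkewTwo (binaryOp ρ.product) (A.l 2))
    (h₃ : IsSkewThree (binaryOp (weightProduct H)) (A.l 3)) (K : V →ₗ[ℂ] g) :
    ρ.IsReynolds H K ↔ A.IsMaurerCartan (linearCochain K) := by
  have hK := linearCochain_mem K
  have e : toListOp g V (linearCochain K) = (constCochain K).listOp := toListOp_toSpace _
  have e₂ := h₂ (fun _ => 1) (fun _ => linearCochain K) fun _ => hK
  have e₃ := h₃ (fun _ => 1) (fun _ => linearCochain K) fun _ => hK
  have m₂ := A.degree 2 (by norm_num) (fun _ => 1) (fun _ => linearCochain K) fun _ => hK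
  have m₃ := A.degree 3 (by norm_num) (fun _ => 1) (fun _ => linearCochain K) fun _ => hK
  norm_num at m₂ m₃
  rw [e] at e₂ e₃
  rw [A.isMaurerCartan_iff h₁ h₄, and_iff_right hK, eq_zero_iff_of_mem (m := 1)
    (Submodule.add_mem _ (Submodule.smul_mem _ _ m₂) (Submodule.smul_mem _ _ m₃))]
  -- The factorials cancel the factors 2 and -6 of the two brackets, and the curvature of K is
  -- exactly its Reynolds defect.
  have key (u : Fin 1 → V) (v : V) : toListOp g V ((2 : ℂ)⁻¹ • A.l 2 (fun _ => linearCochain K)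
      + (6 : ℂ)⁻¹ • A.l 3 (fun _ => linearCochain K)) (List.ofFn fun i => ((0 : g), u i)) (0, v)
      = (K (u 0) * K v - K (ρ.L (K (u 0)) v + ρ.R (K v) (u 0) + H (K (u 0)) (K v)), 0) := by
    have t₂ := skewTwo_constCochain ρ K (u 0) v
    have t₃ := skewThree_listOp H (constCochain K) (constCochain K) (constCochain K)
      (fun i => ((0 : g), u i)) (0, v)
    rw [map_add, map_smul, map_smul, e₂, e₃]
    simp only [Pi.add_apply, Pi.smul_apply, LinearMap.add_apply, LinearMap.smul_apply]
    refine (congrArg₂ (fun a b => (2 : ℂ)⁻¹ • a + (6 : ℂ)⁻¹ • b) t₂ t₃).trans ?_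
    rw [ternaryBracket_constCochain]
    ext
    · simp
      module
    · simp
  constructor
  · intro h u v
    rw [key, h (u 0) v, sub_self]
    rfl
  · intro h u v
    exact sub_eq_zero.1 (congrArg Prod.fst ((key (fun _ => u) v).symm.trans (h _ _)))

end MaurerCartan

/-- The graded space `⨁ₙ Hom (∧^{n-1} V ⊗ V, g)` carries an L-infinity algebra structure with
`l 1 = 0`, with `l 2` the derived bracket `(-1)^{p-1} [[μ + L + R, P], Q]` (here `p = a + 1`), with
`l 3` the ternary bracket given by `H`, and with `l k = 0` for `k ≥ 4`; a linear map `K : V → g` is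
a relative cocycle weighted Reynolds operator iff it is a Maurer-Cartan element. -/
theorem mainTheorem1 (g V : Type*) [LeftPreLieRing g] [LeftPreLieAlgebra ℂ g]
    [AddCommGroup V] [Module ℂ V] (ρ : PreLieRep g V) (H : g →ₗ[ℂ] g →ₗ[ℂ] V)
    (hH : ρ.IsTwoCocycle H) :
    ∃ A : LInftyStructure (cochainGrading g V),
      A.l 1 = 0 ∧
      (∀ (a b : ℕ) (P : Cochain g V a) (Q : Cochain g V b),
        Cochain.lift ((A.l 2 ![P.toSpace, Q.toSpace]) (1 + a + b)) =
          ((-1 : ℤ) ^ a) • mnBracket (mnBracket ρ.semidirect P.lift) Q.lift) ∧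
      (∀ (a b c : ℕ) (P : Cochain g V a) (Q : Cochain g V b) (R : Cochain g V c)
          (u : Fin (a + b + c + 1) → V) (v : V),
        (A.l 3 ![P.toSpace, Q.toSpace, R.toSpace]) (a + b + c + 1) u v =
          ternaryBracket H P Q R u v) ∧
      (∀ k : ℕ, 4 ≤ k → A.l k = 0) ∧
      (∀ K : V →ₗ[ℂ] g, ρ.IsReynolds H K ↔ A.IsMaurerCartan (linearCochain K)) := by
  have hπ := isOp_binaryOp ρ.product
  have hH' := isOp_binaryOp (weightProduct H)
  obtain ⟨A, h₁, h₄, h₂, h₃⟩ := exists_lInftyStructure hπ ρ.preservesG_product hH'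
    ρ.product_bracket_product hH.product_bracket_weight (weight_bracket_weight H)
  refine ⟨A, h₁, fun a b P Q => ?_, fun a b c P Q R u v => ?_, h₄, fun K =>
    isReynolds_iff_isMaurerCartan ρ H A h₁ h₄ h₂ h₃ K⟩
  · have h := h₂ ![(a : ℤ) + 1, (b : ℤ) + 1] ![P.toSpace, Q.toSpace] (Fin.forall_fin_two.2
      ⟨toSpace_mem_cochainGrading P, toSpace_mem_cochainGrading Q⟩)
    have hP := P.isCochainOp_listOp.isOp
    have key := represents_mnBracket (p := 1 + a) (by exact_mod_cast hπ.bracket hP)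
      Q.isCochainOp_listOp.isOp
      (represents_mnBracket (p := 1) hπ hP ρ.represents_semidirect P.represents_lift)
      Q.represents_lift
    funext x y
    rw [toListOp_lift, h]
    simp only [Matrix.cons_val_zero, Matrix.cons_val_one, toListOp_toSpace, skewTwo,
      add_sub_cancel_right, Pi.smul_apply, LinearMap.smul_apply, neg_one_pow_eq_paritySign]
    rw [key x y]
    push_cast
    rfl
  · have h := h₃ ![(a : ℤ) + 1, (b : ℤ) + 1, (c : ℤ) + 1] ![P.toSpace, Q.toSpace, R.toSpace]
      (Fin.forall_fin_succ.2 ⟨toSpace_mem_cochainGrading P, Fin.forall_fin_two.2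
        ⟨toSpace_mem_cochainGrading Q, toSpace_mem_cochainGrading R⟩⟩)
    rw [← toListOp_apply_fst, h]
    simp only [Matrix.cons_val_zero, Matrix.cons_val_one, Matrix.cons_val, toListOp_toSpace]
    rw [skewThree_listOp]
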